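/- \textbf{Theorem.} An instance $\Gamma=(S,U,E)$ of SetCover is a finite bipartite graph; a cover is a set $C\subseteq S$ such that every $u\in U$ has a neighbour in $C$, and $\mathsf{OPT}(\Gamma)$ is the least size of a cover ($\infty$ if there is none). Let $n=|S|+|U|$. Assume $\mathsf{W[1]}\neq\mathsf{FPT}$, that is: there is no algorithm that decides, for a graph $G$ on $N$ vertices and an integer $k$, whether $G$ contains a clique of size $k$, in time $f(k)\cdot N^{O(1)}$ for some computable function $f$. Then there is a constant $C>0$ such that for every function $\rho$ with $\rho(n)=o\left(\frac{\log n}{\log\log n}\right)$ effectively, i.e. $\rho(n)\le\frac{\log n}{\iota(n)\,\log\log n}$ for all sufficiently large $n$, with some computable, non-decreasing and unbounded function $\iota:\mathbb N\to\mathbb N$, no polynomial-time algorithm approximates $k$-SetCover within ratio $\rho(n)$, even on inputs $(\Gamma,k)$ with $k\le C\left(\frac{\log n}{\log\log n}\right)^3$. Precisely, there is (a) no deterministic algorithm that on every such input $(\Gamma,k)$ halts in time $n^{O(1)}$, accepts if $\mathsf{OPT}(\Gamma)\le k$, and rejects if $\mathsf{OPT}(\Gamma)>\rho(n)\cdot k$;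 (b) no deterministic algorithm that on every such input $(\Gamma,k)$ halts in time $n^{O(1)}$ and, if $\mathsf{OPT}(\Gamma)\le k$, outputs a cover of size at most $\rho(n)\cdot k$. -/

import Mathlib

/-! ### Machine model

A deterministic random access machine: finitely many registers (those that the program mentions)
and an unbounded memory, all cells holding natural numbers. The arithmetic is addition and
truncated subtraction at unit cost (no multiplication), so that a number gains at most one bit per
step and running times agree with those of multitape Turing machines up to a polynomial. -/

namespace RAM

/-- The content of the registers and of the memory. -/
structure State where
  reg : ℕ → ℕ
  mem : ℕ → ℕ

/-- The elementary instructions. -/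
inductive Instr where
  /-- `reg d := v` -/
  | const (d v : ℕ)
  /-- `reg d := reg a + reg b` -/
  | add (d a b : ℕ)
  /-- `reg d := reg a - reg b`, or `0` if this is negative -/
  | sub (d a b : ℕ)
  /-- `reg d := mem (reg a)` -/
  | load (d a : ℕ)
  /-- `mem (reg a) := reg b` -/
  | store (a b : ℕ)

/-- The effect of an instruction. -/
def Instr.exec : Instr → State → State
  | .const d v, σ => { σ with reg := Function.update σ.reg d v }
  | .add d a b, σ => { σ with reg := Function.update σ.reg d (σ.reg a + σ.reg b) }
  | .sub d a b, σ => { σ with reg := Function.update σ.reg d (σ.reg a - σ.reg b) }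
  | .load d a, σ => { σ with reg := Function.update σ.reg d (σ.mem (σ.reg a)) }
  | .store a b, σ => { σ with mem := Function.update σ.mem (σ.reg a) (σ.reg b) }

/-- Programs with structured control flow: `ite r P Q` is "if `reg r ≠ 0` then `P` else `Q`", and
`loop r P` is "while `reg r ≠ 0` do `P`". -/
inductive Program where
  | skip
  | instr (i : Instr)
  | seq (P Q : Program)
  | ite (r : ℕ) (P Q : Program)
  | loop (r : ℕ) (P : Program)

/-- `RunsIn P σ τ t`: started in the state `σ`, the program `P` halts in the state `τ` after exactly
`t` steps. Every instruction and every evaluation of a test is one step. -/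
inductive RunsIn : Program → State → State → ℕ → Prop where
  | skip (σ : State) : RunsIn .skip σ σ 0
  | instr (i : Instr) (σ : State) : RunsIn (.instr i) σ (i.exec σ) 1
  | seq {P Q : Program} {σ τ υ : State} {s t : ℕ} :
      RunsIn P σ τ s → RunsIn Q τ υ t → RunsIn (.seq P Q) σ υ (s + t)
  | ite_true {r : ℕ} {P Q : Program} {σ τ : State} {t : ℕ} :
      σ.reg r ≠ 0 → RunsIn P σ τ t → RunsIn (.ite r P Q) σ τ (t + 1)
  | ite_false {r : ℕ} {P Q : Program} {σ τ : State} {t : ℕ} :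
      σ.reg r = 0 → RunsIn Q σ τ t → RunsIn (.ite r P Q) σ τ (t + 1)
  | loop_true {r : ℕ} {P : Program} {σ τ υ : State} {s t : ℕ} :
      σ.reg r ≠ 0 → RunsIn P σ τ s → RunsIn (.loop r P) τ υ t →
        RunsIn (.loop r P) σ υ (s + t + 1)
  | loop_false {r : ℕ} {P : Program} {σ : State} :
      σ.reg r = 0 → RunsIn (.loop r P) σ σ 1

/-- The initial state on the input `x`: the memory holds `x` followed by zeros and all registers
are zero. -/
def initial (x : List ℕ) : State where
  reg := fun _ => 0
  mem := fun i => x.getD i 0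

/-- A computation accepts if register `0` holds `1` in its final state. -/
def State.Accepts (σ : State) : Prop := σ.reg 0 = 1

end RAM

/-! ### The clique problem and the hypothesis W[1] ≠ FPT -/

open Classical in
/-- The input for the clique problem: the number of vertices, the number `k`, and the adjacency
matrix row by row. -/
noncomputable def cliqueInput {n : ℕ} (G : SimpleGraph (Fin n)) (k : ℕ) : List ℕ :=
  n :: k :: (List.finRange n).flatMap fun u =>
    (List.finRange n).map fun v => if G.Adj u v then 1 else 0

/-- Some algorithm decides on input `(G, k)` whether the `n`-vertex graph `G` contains a clique of
size `k`, in time `f(k) * n ^ O(1)` for some computable function `f`. -/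
def CliqueIsFPT : Prop :=
  ∃ (P : RAM.Program) (f : ℕ → ℕ) (p : Polynomial ℕ), Computable f ∧
    ∀ (n : ℕ) (G : SimpleGraph (Fin n)) (k : ℕ), ∃ (τ : RAM.State) (t : ℕ),
      RAM.RunsIn P (RAM.initial (cliqueInput G k)) τ t ∧ t ≤ f k * p.eval n ∧
        (τ.Accepts ↔ ∃ K : Finset (Fin n), G.IsNClique k K)

/-- The hypothesis `W[1] ≠ FPT`. -/
def W1NeFPT : Prop := ¬ CliqueIsFPT

/-! ### Set cover -/

/-- An (unweighted) set cover instance: a bipartite graph between the vertices in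
`S = Fin numSets` and the universe `U = Fin numElems`. -/
structure SetCover where
  numSets : ℕ
  numElems : ℕ
  adj : Fin numSets → Fin numElems → Bool

namespace SetCover

/-- The number of vertices of the bipartite graph. -/
def size (Γ : SetCover) : ℕ := Γ.numSets + Γ.numElems

/-- Every element of the universe has a neighbour in `C`. -/
def IsCover (Γ : SetCover) (C : Finset (Fin Γ.numSets)) : Prop :=
  ∀ u, ∃ s ∈ C, Γ.adj s u = true

/-- `OPT(Γ) ≤ x`, where `OPT(Γ)` is the least size of a cover, and infinite if there is none. -/
def OptLE (Γ : SetCover) (x : ℝ) : Prop :=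
  ∃ C : Finset (Fin Γ.numSets), Γ.IsCover C ∧ (C.card : ℝ) ≤ x

/-- The input for `k`-SetCover: the sizes of `S` and `U`, the number `k`, and the bipartite
adjacency matrix row by row. -/
def input (Γ : SetCover) (k : ℕ) : List ℕ :=
  Γ.numSets :: Γ.numElems :: k :: (List.finRange Γ.numSets).flatMap fun s =>
    (List.finRange Γ.numElems).map fun u => if Γ.adj s u = true then 1 else 0

/-- The set of vertices in `S` that a final state describes: the first `|S|` memory cells are read
as an indicator vector. -/
def output (Γ : SetCover) (τ : RAM.State) : Finset (Fin Γ.numSets) :=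
  Finset.univ.filter fun s => τ.mem s = 1

/-- Some polynomial time algorithm solves the `ρ(n)`-gap version of `k`-SetCover, where `n` is the
number of vertices, on the instances with `k ≤ κ(n)`: it accepts if `OPT(Γ) ≤ k`, and does not
accept if `OPT(Γ) > ρ(n) * k`. -/
def GapPolyTime (ρ κ : ℕ → ℝ) : Prop :=
  ∃ (P : RAM.Program) (p : Polynomial ℕ), ∀ (Γ : SetCover) (k : ℕ), (k : ℝ) ≤ κ Γ.size →
    ∃ (τ : RAM.State) (t : ℕ), RAM.RunsIn P (RAM.initial (Γ.input k)) τ t ∧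
      t ≤ p.eval Γ.size ∧
      (Γ.OptLE k → τ.Accepts) ∧ (¬ Γ.OptLE (ρ Γ.size * k) → ¬ τ.Accepts)

/-- Some polynomial time algorithm finds approximate solutions of `k`-SetCover within ratio `ρ(n)`,
where `n` is the number of vertices, on the instances with `k ≤ κ(n)`: if `OPT(Γ) ≤ k`, then it
outputs a cover of size at most `ρ(n) * k`. -/
def ApproxPolyTime (ρ κ : ℕ → ℝ) : Prop :=
  ∃ (P : RAM.Program) (p : Polynomial ℕ), ∀ (Γ : SetCover) (k : ℕ), (k : ℝ) ≤ κ Γ.size →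
    ∃ (τ : RAM.State) (t : ℕ), RAM.RunsIn P (RAM.initial (Γ.input k)) τ t ∧
      t ≤ p.eval Γ.size ∧
      (Γ.OptLE k → Γ.IsCover (Γ.output τ) ∧ ((Γ.output τ).card : ℝ) ≤ ρ Γ.size * k)

end SetCover

/-! ### Rates -/

/-- `φ = o(ψ)` effectively: `φ(n) ≤ ψ(n) / ι(n)` for all large `n`, with a computable,
non-decreasing and unbounded function `ι`. -/
def EffectiveLittleO (φ ψ : ℕ → ℝ) : Prop :=
  ∃ ι : ℕ → ℕ, Computable ι ∧ Monotone ι ∧ Filter.Tendsto ι Filter.atTop Filter.atTop ∧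
    ∀ᶠ n in Filter.atTop, φ n ≤ ψ n / ι n

/-- The function `log n / log log n`. -/
noncomputable def logOverLogLog (n : ℕ) : ℝ := Real.log n / Real.log (Real.log n)

/-! Both algorithms would put the clique problem in FPT, by a gap reduction based on Reed–Solomon
codes. Let `ell N` be about `log N / log log N`, let `M` be about `ell N / (k² + 1)` and `r = 4 *
ell N`, and let `q` be the least prime from `8 M² r` on. Vertices are encoded by polynomials over a
field with `q` elements, and a would-be clique by its columns: for each position `j < q`, the `k`
code symbols at `j`. There is a set for each copy `t < q` and each pair of vertices, and a set for
each position and each column. An element consists of a position `j`, a copy `t` and a list of `2M`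
columns, each with a test `(i, i')`. A column at `j` covers the element unless it is on the list; a
pair `(u, v)` in copy `t` covers it if `(u, v)` passes some test on the list, that is, if the
symbols of `u` and `v` at `j` are the entries `i` and `i'` of the column and `u`, `v` are adjacent
(or `i = i'`). The `q` copies make the pairs as expensive as the columns, so that averaging controls
both.

A clique gives a cover with `q (k² + 1)` sets (`Gap.exists_cover`). Conversely, in a cover with at
most `q M` sets some copy contains at most `M` pairs, and at some position at most `2M` columns are
chosen while the at most `2M` vertices of these pairs have distinct symbols. If every chosen column
had a test that all the pairs fail, the list of these columns and tests would be an uncovered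
element; so some column passes all tests, and decoding it gives a clique (`Gap.exists_isClique`).
The gap is `M / (k² + 1)`, of the order `ell N / (k² + 1)²`.

The lists cost only `(q^k k²)^(2M) ≤ N^6`, because `q` is polylogarithmic and `k M ≤ ell N`. Hence
the instance has size `n` between `N` and `N^15`, and `log n / log log n` agrees with `ell N` up to
constants. The budget `q (k² + 1)` is `O(ell N ^ 3)`, and the gap exceeds `ρ n` as soon as `ι n ≥
120 (k² + 1)²` (`Gap.Small.K_le_logOverLogLog`, `Gap.Small.ratio_mul_K_le`).

It remains to decide when the reduction may be trusted, since `ι` is computable but perhaps not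
quickly. `RAM.exists_certifier` gives a test that runs in time polynomial in `N`, never
overestimates `ι`, and succeeds once `N` exceeds a computable function of `k`. If it fails, `N` is
bounded in terms of `k` and exhaustive search is affordable (`RAM.cliqueIsFPT_of_solves`). The
programs are obtained by compiling a language of expressions with bounded loops
(`RAM.exists_evaluates`), and the hypothetical algorithm runs on a relocated part of the memory
(`RAM.RunsIn.reloc`). -/

namespace RAM

/-! ### Running programs within a time bound -/

/-- Started in `σ`, the program `P` halts within `T` steps in a state with the property `Q`. -/
def Reaches (P : Program) (σ : State) (T : ℕ) (Q : State → Prop) : Prop :=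
  ∃ τ t, RunsIn P σ τ t ∧ t ≤ T ∧ Q τ

theorem Reaches.mono {P : Program} {σ : State} {T T' : ℕ} {Q Q' : State → Prop}
    (h : Reaches P σ T Q) (hT : T ≤ T') (hQ : ∀ τ, Q τ → Q' τ) : Reaches P σ T' Q' := by
  obtain ⟨τ, t, h1, h2, h3⟩ := h
  exact ⟨τ, t, h1, h2.trans hT, hQ _ h3⟩

theorem Reaches.seq {P P' : Program} {σ : State} {T T' : ℕ} {Q Q' : State → Prop}
    (h : Reaches P σ T Q) (h' : ∀ τ, Q τ → Reaches P' τ T' Q') :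
    Reaches (.seq P P') σ (T + T') Q' := by
  obtain ⟨τ, t, h1, h2, h3⟩ := h
  obtain ⟨τ', t', h1', h2', h3'⟩ := h' τ h3
  exact ⟨τ', t + t', .seq h1 h1', by omega, h3'⟩

theorem Reaches.instr {i : Instr} {σ : State} {Q : State → Prop} (h : Q (i.exec σ)) :
    Reaches (.instr i) σ 1 Q :=
  ⟨_, 1, .instr i σ, le_rfl, h⟩

theorem Reaches.ite {P P' : Program} {r : ℕ} {σ : State} {T : ℕ} {Q : State → Prop}
    (h : σ.reg r ≠ 0 → Reaches P σ T Q) (h' : σ.reg r = 0 → Reaches P' σ T Q) :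
    Reaches (.ite r P P') σ (T + 1) Q := by
  by_cases hr : σ.reg r = 0
  · obtain ⟨τ, t, h1, h2, h3⟩ := h' hr
    exact ⟨τ, t + 1, .ite_false hr h1, by omega, h3⟩
  · obtain ⟨τ, t, h1, h2, h3⟩ := h hr
    exact ⟨τ, t + 1, .ite_true hr h1, by omega, h3⟩

/-- A loop whose counter register decreases by one in each round, with an invariant indexed by the
remaining number of rounds. -/
theorem Reaches.loop {P : Program} {r T : ℕ} {I : ℕ → State → Prop}
    (hr : ∀ n σ, I n σ → σ.reg r = n)
    (h : ∀ n σ, I (n + 1) σ → Reaches P σ T (I n)) (n : ℕ) (σ : State) (hσ : I n σ) :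
    Reaches (.loop r P) σ (n * (T + 1) + 1) (I 0) := by
  induction n generalizing σ with
  | zero => exact ⟨σ, 1, .loop_false (hr _ _ hσ), by omega, hσ⟩
  | succ n ih =>
    obtain ⟨τ, t, h1, h2, h3⟩ := h n σ hσ
    obtain ⟨υ, s, h1', h2', h3'⟩ := ih τ h3
    refine ⟨υ, t + s + 1, .loop_true ?_ h1 h1', ?_, h3'⟩
    · rw [hr _ _ hσ]; omega
    · rw [add_mul]; omega

/-- Copy register `s` to register `d`, with `z` as a scratch register. -/
def Program.move (d s z : ℕ) : Program := .seq (.instr (.const z 0)) (.instr (.add d s z))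

theorem reaches_move {d s z : ℕ} (hz : z ≠ s) (σ : State) :
    Reaches (.move d s z) σ 2 fun τ => τ.mem = σ.mem ∧ τ.reg d = σ.reg s ∧
      ∀ r, r ≠ d → r ≠ z → τ.reg r = σ.reg r := by
  refine Reaches.seq (T := 1) (T' := 1) (Q := fun τ => τ = (Instr.const z 0).exec σ)
    (.instr rfl) ?_
  rintro τ rfl
  refine .instr ⟨rfl, ?_, ?_⟩
  · simp [Instr.exec, Function.update_of_ne hz.symm]
  · intro r h1 h2
    simp [Instr.exec, Function.update_of_ne h1, Function.update_of_ne h2]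

/-! ### Expressions with bounded loops -/

/-- Arithmetical expressions. The variables refer to an environment, which is a list; `bound` is a
global bound, which limits the number of rounds of all loops. In `iter n a b`, the body `b` is
evaluated in the environment extended by the accumulator and the index of the round. -/
inductive Ex where
  | var (i : ℕ)
  | const (c : ℕ)
  | bound
  | add (a b : Ex)
  | sub (a b : Ex)
  | mem (a : Ex)
  | ite (c a b : Ex)
  | iter (n a b : Ex)
  | call (f : Ex) (k : ℕ) (args : Fin k → Ex)

/-- `f (n - 1) (⋯ (f 1 (f 0 a)))`. -/
def iterate (f : ℕ → ℕ → ℕ) (a : ℕ) : ℕ → ℕ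
  | 0 => a
  | n + 1 => f n (iterate f a n)

/-- The value of an expression, for a given memory and bound. -/
def Ex.eval (m : ℕ → ℕ) (B : ℕ) : Ex → List ℕ → ℕ
  | .var i, env => env.getD i 0
  | .const c, _ => c
  | .bound, _ => B
  | .add a b, env => a.eval m B env + b.eval m B env
  | .sub a b, env => a.eval m B env - b.eval m B env
  | .mem a, env => m (a.eval m B env)
  | .ite c a b, env => if c.eval m B env ≠ 0 then a.eval m B env else b.eval m B env
  | .iter n a b, env =>
      iterate (fun i x => b.eval m B (env ++ [x, i])) (a.eval m B env) (min (n.eval m B env) B)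
  | .call f _ args, env => f.eval m B (List.ofFn fun i => (args i).eval m B env)

/-- `P` evaluates `e` into the register `top`, where the environment of length `n` is found in
the registers `loc i`, the bound is in register `0`, and the registers below `top` are kept. -/
def Evaluates (P : Program) (e : Ex) (n : ℕ) (loc : ℕ → ℕ) (top c d : ℕ) : Prop :=
  ∀ (σ : State) (env : List ℕ), env.length = n → (∀ i < n, σ.reg (loc i) = env.getD i 0) →
    Reaches P σ (c * (σ.reg 0 + 1) ^ d) fun τ => τ.mem = σ.mem ∧ (∀ r < top, τ.reg r = σ.reg r) ∧
      τ.reg top = e.eval σ.mem (σ.reg 0) env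

/-- Bounds of the form `c * x ^ d` are closed under addition. -/
theorem mul_pow_add_le (c₁ d₁ c₂ d₂ x : ℕ) :
    c₁ * (x + 1) ^ d₁ + c₂ * (x + 1) ^ d₂ ≤ (c₁ + c₂) * (x + 1) ^ (d₁ + d₂) := by
  have h1 : (x + 1) ^ d₁ ≤ (x + 1) ^ (d₁ + d₂) := Nat.pow_le_pow_right (by omega) (by omega)
  have h2 : (x + 1) ^ d₂ ≤ (x + 1) ^ (d₁ + d₂) := Nat.pow_le_pow_right (by omega) (by omega)
  rw [add_mul]
  exact add_le_add (Nat.mul_le_mul_left _ h1) (Nat.mul_le_mul_left _ h2)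

/-- Compiling `b` with its result one register higher protects the value of `a`. -/
theorem exists_evaluates_binary {a b : Ex} {n : ℕ} {loc : ℕ → ℕ} {top : ℕ} (htop : 1 ≤ top)
    (hloc : ∀ i < n, loc i < top)
    (ha : ∀ n loc top, 1 ≤ top → (∀ i < n, loc i < top) → ∃ P c d, Evaluates P a n loc top c d)
    (hb : ∀ n loc top, 1 ≤ top → (∀ i < n, loc i < top) → ∃ P c d, Evaluates P b n loc top c d) :
    ∃ P c d, ∀ (σ : State) (env : List ℕ), env.length = n →
      (∀ i < n, σ.reg (loc i) = env.getD i 0) →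
      Reaches P σ (c * (σ.reg 0 + 1) ^ d) fun τ => τ.mem = σ.mem ∧
        (∀ r < top, τ.reg r = σ.reg r) ∧ τ.reg top = a.eval σ.mem (σ.reg 0) env ∧
        τ.reg (top + 1) = b.eval σ.mem (σ.reg 0) env := by
  obtain ⟨P, c, d, hP⟩ := ha n loc top htop hloc
  obtain ⟨P', c', d', hP'⟩ := hb n loc (top + 1) (by omega) fun i hi => (hloc i hi).trans (by omega)
  refine ⟨.seq P P', c + c', d + d', fun σ env hn henv => ?_⟩
  refine ((hP σ env hn henv).seq (T' := c' * (σ.reg 0 + 1) ^ d') ?_).mono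
    (mul_pow_add_le _ _ _ _ _) fun _ h => h
  rintro τ ⟨h1, h2, h3⟩
  have h0 : τ.reg 0 = σ.reg 0 := h2 0 (by omega)
  have := hP' τ env hn fun i hi => by rw [h2 _ (hloc i hi), henv i hi]
  rw [h0] at this
  refine this.mono le_rfl ?_
  rintro υ ⟨h1', h2', h3'⟩
  refine ⟨h1'.trans h1, fun r hr => (h2' r (by omega)).trans (h2 r hr), ?_, ?_⟩
  · rw [h2' top (by omega), h3]
  · rw [h3', h1]

/-- The arguments of a call are put in consecutive registers, which then serve as the environment of
the called expression. The induction on `j` handles one argument at a time. -/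
theorem exists_evaluates_args {k : ℕ} {args : Fin k → Ex} {n : ℕ} {loc : ℕ → ℕ} {top : ℕ}
    (htop : 1 ≤ top) (hloc : ∀ i < n, loc i < top)
    (h : ∀ i, ∀ n loc top, 1 ≤ top → (∀ i < n, loc i < top) →
      ∃ P c d, Evaluates P (args i) n loc top c d) (j : ℕ) (hj : j ≤ k) :
    ∃ P c d, ∀ (σ : State) (env : List ℕ), env.length = n →
      (∀ i < n, σ.reg (loc i) = env.getD i 0) →
      Reaches P σ (c * (σ.reg 0 + 1) ^ d) fun τ => τ.mem = σ.mem ∧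
        (∀ r < top, τ.reg r = σ.reg r) ∧
        ∀ i : Fin k, i < j → τ.reg (top + i) = (args i).eval σ.mem (σ.reg 0) env := by
  induction j with
  | zero =>
    exact ⟨.skip, 0, 0, fun σ env _ _ => ⟨σ, 0, .skip σ, by simp, rfl, fun _ _ => rfl, by simp⟩⟩
  | succ j ih =>
    obtain ⟨P, c, d, hP⟩ := ih (by omega)
    obtain ⟨P', c', d', hP'⟩ := h ⟨j, hj⟩ n loc (top + j) (by omega)
      fun i hi => (hloc i hi).trans_le (by omega)
    refine ⟨.seq P P', c + c', d + d', fun σ env hn henv => ?_⟩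
    refine ((hP σ env hn henv).seq (T' := c' * (σ.reg 0 + 1) ^ d') ?_).mono
      (mul_pow_add_le _ _ _ _ _) fun _ h => h
    rintro τ ⟨h1, h2, h3⟩
    have h0 : τ.reg 0 = σ.reg 0 := h2 0 (by omega)
    have := hP' τ env hn fun i hi => by rw [h2 _ (hloc i hi), henv i hi]
    rw [h0] at this
    refine this.mono le_rfl ?_
    rintro υ ⟨h1', h2', h3'⟩
    refine ⟨h1'.trans h1, fun r hr => (h2' r (by omega)).trans (h2 r hr), fun i hi => ?_⟩
    rcases Nat.lt_succ_iff_lt_or_eq.1 hi with hi | hi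
    · rw [h2' _ (by omega), h3 i hi]
    · obtain rfl : i = ⟨j, hj⟩ := Fin.ext hi
      rw [h3', h1]

theorem getD_append_pair (env : List ℕ) (x y i : ℕ) :
    (env ++ [x, y]).getD i 0 =
      if i < env.length then env.getD i 0 else if i = env.length then x else
        if i = env.length + 1 then y else 0 := by
  split_ifs with h1 h2 h3
  · rw [List.getD_append _ _ _ _ h1]
  · rw [List.getD_append_right _ _ _ _ (by omega), h2]; simp
  · rw [List.getD_append_right _ _ _ _ (by omega), h3]; simp
  · exact List.getD_eq_default _ _ (by simp; omega)

/-- Every expression is evaluated by some program in time polynomial in the bound. -/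
theorem exists_evaluates (e : Ex) : ∀ n loc top, 1 ≤ top → (∀ i < n, loc i < top) →
    ∃ P c d, Evaluates P e n loc top c d := by
  induction e with
  | var i =>
    intro n loc top htop hloc
    by_cases hi : i < n
    · refine ⟨.move top (loc i) (top + 1), 2, 0, fun σ env hn henv => ?_⟩
      refine (reaches_move (by have := hloc i hi; omega) σ).mono (by simp) ?_
      rintro τ ⟨h1, h2, h3⟩
      exact ⟨h1, fun r hr => h3 r (by omega) (by omega), by rw [h2, henv i hi]; rfl⟩
    · refine ⟨.instr (.const top 0), 1, 0, fun σ env hn henv => .instr ⟨rfl, fun r hr => ?_, ?_⟩⟩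
      · simp [Instr.exec, Function.update_of_ne hr.ne]
      · simp [Instr.exec, Ex.eval, List.getElem?_eq_none (show env.length ≤ i by omega)]
  | const c =>
    intro n loc top htop hloc
    refine ⟨.instr (.const top c), 1, 0, fun σ env hn henv => .instr ⟨rfl, fun r hr => ?_, ?_⟩⟩
    · simp [Instr.exec, Function.update_of_ne hr.ne]
    · simp [Instr.exec, Ex.eval]
  | bound =>
    intro n loc top htop hloc
    refine ⟨.move top 0 (top + 1), 2, 0, fun σ env hn henv => ?_⟩
    refine (reaches_move (by omega) σ).mono (by simp) ?_
    rintro τ ⟨h1, h2, h3⟩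
    exact ⟨h1, fun r hr => h3 r (by omega) (by omega), h2⟩
  | add a b iha ihb =>
    intro n loc top htop hloc
    obtain ⟨P, c, d, hP⟩ := exists_evaluates_binary htop hloc iha ihb
    refine ⟨.seq P (.instr (.add top top (top + 1))), c + 1, d + 0, fun σ env hn henv => ?_⟩
    refine ((hP σ env hn henv).seq (T' := 1 * (σ.reg 0 + 1) ^ 0) ?_).mono
      (mul_pow_add_le _ _ _ _ _) fun _ h => h
    rintro τ ⟨h1, h2, h3, h4⟩
    refine .instr ⟨h1, fun r hr => ?_, ?_⟩
    · simp [Instr.exec, Function.update_of_ne hr.ne, h2 r hr]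
    · simp [Instr.exec, Ex.eval, h3, h4]
  | sub a b iha ihb =>
    intro n loc top htop hloc
    obtain ⟨P, c, d, hP⟩ := exists_evaluates_binary htop hloc iha ihb
    refine ⟨.seq P (.instr (.sub top top (top + 1))), c + 1, d + 0, fun σ env hn henv => ?_⟩
    refine ((hP σ env hn henv).seq (T' := 1 * (σ.reg 0 + 1) ^ 0) ?_).mono
      (mul_pow_add_le _ _ _ _ _) fun _ h => h
    rintro τ ⟨h1, h2, h3, h4⟩
    refine .instr ⟨h1, fun r hr => ?_, ?_⟩
    · simp [Instr.exec, Function.update_of_ne hr.ne, h2 r hr]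
    · simp [Instr.exec, Ex.eval, h3, h4]
  | mem a iha =>
    intro n loc top htop hloc
    obtain ⟨P, c, d, hP⟩ := iha n loc top htop hloc
    refine ⟨.seq P (.instr (.load top top)), c + 1, d + 0, fun σ env hn henv => ?_⟩
    refine ((hP σ env hn henv).seq (T' := 1 * (σ.reg 0 + 1) ^ 0) ?_).mono
      (mul_pow_add_le _ _ _ _ _) fun _ h => h
    rintro τ ⟨h1, h2, h3⟩
    refine .instr ⟨h1, fun r hr => ?_, ?_⟩
    · simp [Instr.exec, Function.update_of_ne hr.ne, h2 r hr]
    · simp [Instr.exec, Ex.eval, h1, h3]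
  | ite b a a' ihb iha iha' =>
    intro n loc top htop hloc
    obtain ⟨P, c, d, hP⟩ := ihb n loc top htop hloc
    obtain ⟨P₁, c₁, d₁, hP₁⟩ := iha n loc top htop hloc
    obtain ⟨P₂, c₂, d₂, hP₂⟩ := iha' n loc top htop hloc
    refine ⟨.seq P (.ite top P₁ P₂), c + (c₁ + c₂ + 1), d + (d₁ + d₂ + 0), fun σ env hn henv => ?_⟩
    refine ((hP σ env hn henv).seq
      (T' := (c₁ + c₂ + 1) * (σ.reg 0 + 1) ^ (d₁ + d₂ + 0)) ?_).mono
      (mul_pow_add_le _ _ _ _ _) fun _ h => h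
    rintro τ ⟨h1, h2, h3⟩
    have h0 : τ.reg 0 = σ.reg 0 := h2 0 (by omega)
    have henv' : ∀ i < n, τ.reg (loc i) = env.getD i 0 := fun i hi => by
      rw [h2 _ (hloc i hi), henv i hi]
    have e1 := hP₁ τ env hn henv'
    have e2 := hP₂ τ env hn henv'
    rw [h0, h1] at e1 e2
    have b1 := mul_pow_add_le c₁ d₁ c₂ d₂ (σ.reg 0)
    refine (Reaches.ite (T := (c₁ + c₂) * (σ.reg 0 + 1) ^ (d₁ + d₂))
      (fun hr => ?_) fun hr => ?_).mono (by simpa [add_mul] using Nat.one_le_pow _ _ (by omega)) fun _ h => h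
    · refine e1.mono (by omega) ?_
      rintro υ ⟨h1', h2', h3'⟩
      refine ⟨h1', fun r hr => (h2' r hr).trans (h2 r hr), ?_⟩
      rw [h3', Ex.eval, if_pos (by rw [← h3]; exact hr)]
    · refine e2.mono (by omega) ?_
      rintro υ ⟨h1', h2', h3'⟩
      refine ⟨h1', fun r hr => (h2' r hr).trans (h2 r hr), ?_⟩
      rw [h3', Ex.eval, if_neg (by rw [← h3]; simpa using hr)]
  | iter e a b ihe iha ihb =>
    intro n loc top htop hloc
    obtain ⟨P, c, d, hP⟩ := ihe n loc (top + 2) (by omega)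
      fun i hi => (hloc i hi).trans (by omega)
    obtain ⟨P₁, c₁, d₁, hP₁⟩ := iha n loc (top + 3) (by omega)
      fun i hi => (hloc i hi).trans (by omega)
    -- The register `top` holds the accumulator, `top + 1` the index of the round and `top + 2` the
    -- number of rounds left. The body puts its value in `top + 3`, so it keeps all three.
    obtain ⟨P₂, c₂, d₂, hP₂⟩ := ihb (n + 2)
      (fun i => if i < n then loc i else if i = n then top else top + 1) (top + 3) (by omega)
      (fun i hi => by
        split_ifs with h1 h2
        · exact (hloc i h1).trans (by omega)
        · omega
        · omega)
    -- With truncated subtraction, `x - (x - B) = min x B`; the register `0` holds `B`.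
    let clip : Program := .seq (.instr (.sub (top + 3) (top + 2) 0))
      (.instr (.sub (top + 2) (top + 2) (top + 3)))
    let start : Program := .seq (.move top (top + 3) (top + 4)) (.instr (.const (top + 1) 0))
    let next : Program := .seq (.move top (top + 3) (top + 4)) (.seq (.instr (.const (top + 3) 1))
      (.seq (.instr (.add (top + 1) (top + 1) (top + 3)))
        (.instr (.sub (top + 2) (top + 2) (top + 3)))))
    refine ⟨.seq P (.seq clip (.seq P₁ (.seq start (.loop (top + 2) (.seq P₂ next))))),
      c + (c₁ + (c₂ + 12)), d + (d₁ + (d₂ + 1)), fun σ env hn henv => ?_⟩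
    set B := σ.reg 0 with hB
    set v := min (e.eval σ.mem B env) B with hv
    set f := fun i x => b.eval σ.mem B (env ++ [x, i]) with hf
    set x₀ := a.eval σ.mem B env with hx₀
    let Inv : ℕ → State → Prop := fun m τ => τ.mem = σ.mem ∧ (∀ r < top, τ.reg r = σ.reg r) ∧
      τ.reg (top + 2) = m ∧ m ≤ v ∧ τ.reg (top + 1) = v - m ∧ τ.reg top = iterate f x₀ (v - m)
    have hclip : ∀ τ : State, (τ.mem = σ.mem ∧ (∀ r < top + 2, τ.reg r = σ.reg r) ∧
        τ.reg (top + 2) = e.eval σ.mem B env) → Reaches clip τ 2 fun υ =>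
          υ.mem = σ.mem ∧ (∀ r < top + 2, υ.reg r = σ.reg r) ∧ υ.reg (top + 2) = v := by
      rintro τ ⟨h1, h2, h3⟩
      refine Reaches.seq (T := 1) (T' := 1)
        (Q := fun υ => υ = (Instr.sub (top + 3) (top + 2) 0).exec τ) (.instr rfl) ?_
      rintro _ rfl
      have h0 : τ.reg 0 = B := h2 0 (by omega)
      refine .instr ⟨h1, fun r hr => ?_, ?_⟩
      · simp [Instr.exec, Function.update_of_ne hr.ne, Function.update_of_ne
          (show r ≠ top + 3 by omega), h2 r hr]
      · simp [Instr.exec, h3, h0, hv]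
        omega
    have hstart : ∀ τ : State, (τ.mem = σ.mem ∧ (∀ r < top + 2, τ.reg r = σ.reg r) ∧
        τ.reg (top + 2) = v ∧ τ.reg (top + 3) = x₀) → Reaches start τ 3 (Inv v) := by
      rintro τ ⟨h1, h2, h3, h4⟩
      refine (reaches_move (by omega) τ).seq (T' := 1) ?_
      rintro υ ⟨h1', h2', h3'⟩
      refine .instr ⟨h1'.trans h1, fun r hr => ?_, ?_, le_rfl, ?_, ?_⟩
      · simp [Instr.exec, Function.update_of_ne (show r ≠ top + 1 by omega),
          h3' r (by omega) (by omega), h2 r (by omega)]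
      · simp [Instr.exec, h3' (top + 2) (by omega) (by omega), h3]
      · simp [Instr.exec]
      · simp [Instr.exec, h2', h4, iterate]
    have hbody : ∀ m τ, Inv (m + 1) τ →
        Reaches (.seq P₂ next) τ (c₂ * (B + 1) ^ d₂ + 5) (Inv m) := by
      rintro m τ ⟨h1, h2, h3, h4, h5, h6⟩
      have h0 : τ.reg 0 = B := h2 0 (by omega)
      have := hP₂ τ (env ++ [iterate f x₀ (v - (m + 1)), v - (m + 1)]) (by simp [hn]) (by
        intro i hi
        rw [getD_append_pair, hn]
        dsimp only
        split_ifs with g1 g2 g3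
        · rw [h2 _ (hloc i g1), henv i g1]
        · exact h6
        · exact h5
        · omega)
      rw [h0, h1] at this
      refine this.seq (T' := 5) ?_
      rintro υ ⟨h1', h2', h3'⟩
      refine ((reaches_move (by omega) υ).seq (T' := 3) ?_).mono (by omega) fun _ h => h
      rintro φ ⟨k1, k2, k3⟩
      refine Reaches.seq (T := 1) (T' := 2)
        (Q := fun ψ => ψ = (Instr.const (top + 3) 1).exec φ) (.instr rfl) ?_
      rintro _ rfl
      refine Reaches.seq (T := 1) (T' := 1)
        (Q := fun ψ => ψ = (Instr.add (top + 1) (top + 1) (top + 3)).exec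
          ((Instr.const (top + 3) 1).exec φ)) (.instr rfl) ?_
      rintro _ rfl
      have hm : v - m = v - (m + 1) + 1 := by omega
      refine .instr ⟨(k1.trans h1'), fun r hr => ?_, ?_, by omega, ?_, ?_⟩
      · simp [Instr.exec, Function.update_of_ne (show r ≠ top + 1 by omega),
          Function.update_of_ne (show r ≠ top + 2 by omega),
          Function.update_of_ne (show r ≠ top + 3 by omega),
          k3 r (by omega) (by omega), h2' r (by omega), h2 r hr]
      · simp [Instr.exec, k3 (top + 2) (by omega) (by omega), h2' (top + 2) (by omega), h3]
      · simp [Instr.exec, k3 (top + 1) (by omega) (by omega), h2' (top + 1) (by omega), h5]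
        omega
      · rw [hm, iterate]
        simp [Instr.exec, k2, h3', hf]
    refine ((hP σ env hn henv).seq (T' := 2 + (c₁ * (B + 1) ^ d₁ + (3 +
      (v * (c₂ * (B + 1) ^ d₂ + 5 + 1) + 1)))) ?_).mono ?_ fun _ h => h
    · intro τ hτ
      refine (hclip τ hτ).seq ?_
      rintro υ ⟨h1, h2, h3⟩
      have := hP₁ υ env hn fun i hi => by
        rw [h2 _ ((hloc i hi).trans (by omega)), henv i hi]
      rw [h2 0 (by omega), h1] at this
      refine this.seq ?_
      rintro φ ⟨h1', h2', h3'⟩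
      refine (hstart φ ⟨h1', fun r hr => (h2' r (by omega)).trans (h2 r hr), ?_, h3'⟩).seq ?_
      · rw [h2' _ (by omega), h3]
      · intro ψ hψ
        refine (Reaches.loop (I := Inv) (fun m τ h => h.2.2.1) hbody v ψ hψ).mono le_rfl ?_
        rintro χ ⟨k1, k2, k3, k4, k5, k6⟩
        refine ⟨k1, k2, ?_⟩
        rw [k6, Nat.sub_zero, Ex.eval]
    · have hvB : v ≤ B := min_le_right _ _
      have hpow : 1 ≤ (B + 1) ^ d₂ := Nat.one_le_pow _ _ (by omega)
      have key : v * (c₂ * (B + 1) ^ d₂ + 5 + 1) + 6 ≤ (c₂ + 12) * (B + 1) ^ (d₂ + 1) := by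
        calc _ ≤ B * (c₂ * (B + 1) ^ d₂ + 6) + 6 :=
              Nat.add_le_add_right (Nat.mul_le_mul_right _ hvB) _
          _ ≤ B * (c₂ * (B + 1) ^ d₂ + 6 * (B + 1) ^ d₂) + 6 * (B + 1) ^ d₂ := by
              gcongr <;> omega
          _ ≤ (c₂ + 12) * (B + 1) ^ (d₂ + 1) := by
              rw [pow_succ]; nlinarith [Nat.zero_le c₂]
      have e1 := mul_pow_add_le c₁ d₁ (c₂ + 12) (d₂ + 1) B
      have e2 := mul_pow_add_le c d (c₁ + (c₂ + 12)) (d₁ + (d₂ + 1)) B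
      rw [← hB]
      omega
  | call f k args ihf iha =>
    intro n loc top htop hloc
    obtain ⟨P, c, d, hP⟩ := exists_evaluates_args htop hloc iha k le_rfl
    -- The called expression sees only its arguments, so its variables are numbered independently of
    -- the place of the call.
    obtain ⟨P', c', d', hP'⟩ := ihf k (fun i => top + i) (top + k) (by omega) fun i hi => by omega
    refine ⟨.seq P (.seq P' (.move top (top + k) (top + k + 1))), c + (c' + 2), d + (d' + 0),
      fun σ env hn henv => ?_⟩
    refine ((hP σ env hn henv).seq (T' := (c' + 2) * (σ.reg 0 + 1) ^ (d' + 0)) ?_).mono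
      (mul_pow_add_le _ _ _ _ _) fun _ h => h
    rintro τ ⟨h1, h2, h3⟩
    have h0 : τ.reg 0 = σ.reg 0 := h2 0 (by omega)
    have := hP' τ (List.ofFn fun i => (args i).eval σ.mem (σ.reg 0) env) (by simp) (by
      intro i hi
      rw [h3 ⟨i, hi⟩ hi, List.getD_eq_getElem _ _ (by simpa using hi)]
      simp)
    rw [h0, h1] at this
    refine (this.seq (T' := 2 * (σ.reg 0 + 1) ^ 0) ?_).mono (mul_pow_add_le _ _ _ _ _) fun _ h => h
    rintro υ ⟨h1', h2', h3'⟩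
    refine (reaches_move (by omega) υ).mono (by simp) ?_
    rintro φ ⟨k1, k2, k3⟩
    refine ⟨k1.trans h1', fun r hr => ?_, ?_⟩
    · rw [k3 r (by omega) (by omega), h2' r (by omega), h2 r hr]
    · rw [k2, h3', Ex.eval]

end RAM

namespace RAM

/-- The bound register and the memory are kept, and register `1` receives the value of `e`. -/
theorem exists_reaches_eval (e : Ex) : ∃ P c d, ∀ σ : State,
    Reaches P σ (c * (σ.reg 0 + 1) ^ d) fun τ => τ.mem = σ.mem ∧ τ.reg 0 = σ.reg 0 ∧
      τ.reg 1 = e.eval σ.mem (σ.reg 0) [] := by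
  obtain ⟨P, c, d, hP⟩ := exists_evaluates e 0 id 1 le_rfl (by simp)
  refine ⟨P, c, d, fun σ => (hP σ [] rfl (by simp)).mono le_rfl ?_⟩
  rintro τ ⟨h1, h2, h3⟩
  exact ⟨h1, h2 0 (by omega), h3⟩

/-- The value of `e` is written into register `0`. -/
theorem exists_reaches_set_bound (e : Ex) : ∃ P c d, ∀ σ : State,
    Reaches P σ (c * (σ.reg 0 + 1) ^ d) fun τ => τ.mem = σ.mem ∧
      τ.reg 0 = e.eval σ.mem (σ.reg 0) [] := by
  obtain ⟨P, c, d, hP⟩ := exists_reaches_eval e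
  refine ⟨.seq P (.move 0 1 2), c + 2, d + 0, fun σ => ?_⟩
  refine ((hP σ).seq (T' := 2 * (σ.reg 0 + 1) ^ 0) ?_).mono (mul_pow_add_le _ _ _ _ _)
    fun _ h => h
  rintro τ ⟨h1, h2, h3⟩
  refine (reaches_move (by omega) τ).mono (by simp) ?_
  rintro υ ⟨h1', h2', -⟩
  exact ⟨h1'.trans h1, h2'.trans h3⟩

/-! ### Registers that a program does not use -/

/-- A program writes only to the finitely many registers it names. This is why clearing finitely
many registers restores an initial state for the program that runs next. -/
theorem exists_registers_kept (P : Program) :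
    ∃ R, ∀ σ τ t, RunsIn P σ τ t → ∀ r ≥ R, τ.reg r = σ.reg r := by
  induction P with
  | skip => exact ⟨0, fun σ τ t h r _ => by cases h; rfl⟩
  | instr i =>
    cases i with
    | const d v =>
      refine ⟨d + 1, fun σ τ t h r hr => ?_⟩
      cases h
      simp [Instr.exec, Function.update_of_ne (show r ≠ d by omega)]
    | add d a b =>
      refine ⟨d + 1, fun σ τ t h r hr => ?_⟩
      cases h
      simp [Instr.exec, Function.update_of_ne (show r ≠ d by omega)]
    | sub d a b =>
      refine ⟨d + 1, fun σ τ t h r hr => ?_⟩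
      cases h
      simp [Instr.exec, Function.update_of_ne (show r ≠ d by omega)]
    | load d a =>
      refine ⟨d + 1, fun σ τ t h r hr => ?_⟩
      cases h
      simp [Instr.exec, Function.update_of_ne (show r ≠ d by omega)]
    | store a b =>
      refine ⟨0, fun σ τ t h r hr => ?_⟩
      cases h
      rfl
  | seq P Q ihP ihQ =>
    obtain ⟨R, hR⟩ := ihP
    obtain ⟨R', hR'⟩ := ihQ
    refine ⟨R + R', fun σ τ t h r hr => ?_⟩
    cases h with
    | seq h1 h2 => rw [hR' _ _ _ h2 r (by omega), hR _ _ _ h1 r (by omega)]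
  | ite r P Q ihP ihQ =>
    obtain ⟨R, hR⟩ := ihP
    obtain ⟨R', hR'⟩ := ihQ
    refine ⟨R + R', fun σ τ t h r hr => ?_⟩
    cases h with
    | ite_true _ h => exact hR _ _ _ h r (by omega)
    | ite_false _ h => exact hR' _ _ _ h r (by omega)
  | loop r P ih =>
    obtain ⟨R, hR⟩ := ih
    refine ⟨R, fun σ τ t h => ?_⟩
    generalize hL : Program.loop r P = L at h
    induction h with
    | loop_true _ h1 _ _ ih2 =>
      cases hL
      intro r hr
      rw [ih2 rfl r hr, hR _ _ _ h1 r hr]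
    | loop_false _ => exact fun _ _ => rfl
    | _ => cases hL

/-- Set the registers `2, …, n + 1` to zero. -/
def Program.clear : ℕ → Program
  | 0 => .skip
  | n + 1 => .seq (.clear n) (.instr (.const (n + 2) 0))

theorem reaches_clear (n : ℕ) (σ : State) : Reaches (.clear n) σ n fun τ => τ.mem = σ.mem ∧
    (∀ r < n, τ.reg (r + 2) = 0) ∧ ∀ r, r < 2 ∨ n + 2 ≤ r → τ.reg r = σ.reg r := by
  induction n with
  | zero => exact ⟨σ, 0, .skip σ, le_rfl, rfl, by simp, fun _ _ => rfl⟩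
  | succ n ih =>
    refine ih.seq ?_
    rintro τ ⟨h1, h2, h3⟩
    refine .instr ⟨h1, fun r hr => ?_, fun r hr => ?_⟩
    · by_cases h : r = n
      · simp [Instr.exec, h]
      · simp [Instr.exec, h, h2 r (by omega)]
    · simp [Instr.exec, Function.update_of_ne (show r ≠ n + 2 by omega), h3 r (by omega)]

/-! ### Relocation -/

/-- The program that works like `P`, on the memory from the address in register `0` on. -/
def Program.reloc : Program → Program
  | .skip => .skip
  | .instr (.const d v) => .instr (.const (d + 2) v)
  | .instr (.add d a b) => .instr (.add (d + 2) (a + 2) (b + 2))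
  | .instr (.sub d a b) => .instr (.sub (d + 2) (a + 2) (b + 2))
  | .instr (.load d a) => .seq (.instr (.add 1 0 (a + 2))) (.instr (.load (d + 2) 1))
  | .instr (.store a b) => .seq (.instr (.add 1 0 (a + 2))) (.instr (.store 1 (b + 2)))
  | .seq P Q => .seq P.reloc Q.reloc
  | .ite r P Q => .ite (r + 2) P.reloc Q.reloc
  | .loop r P => .loop (r + 2) P.reloc

/-- The state `σ'` contains `σ` from address `B` on, and the memory `m` below. -/
structure Embeds (B : ℕ) (m : ℕ → ℕ) (σ σ' : State) : Prop where
  base : σ'.reg 0 = B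
  reg : ∀ r, σ'.reg (r + 2) = σ.reg r
  mem : ∀ i, σ'.mem (B + i) = σ.mem i
  low : ∀ i < B, σ'.mem i = m i

theorem Embeds.update_reg {B : ℕ} {m : ℕ → ℕ} {σ σ' : State} (h : Embeds B m σ σ') (d v : ℕ) :
    Embeds B m { σ with reg := Function.update σ.reg d v }
      { σ' with reg := Function.update σ'.reg (d + 2) v } where
  base := by simp [h.base]
  reg r := by
    by_cases hr : r = d
    · simp [hr]
    · simp [hr, h.reg]
  mem := h.mem
  low := h.low

theorem Embeds.update_scratch {B : ℕ} {m : ℕ → ℕ} {σ σ' : State} (h : Embeds B m σ σ') (v : ℕ) :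
    Embeds B m σ { σ' with reg := Function.update σ'.reg 1 v } where
  base := by simp [h.base]
  reg r := by simp [h.reg]
  mem := h.mem
  low := h.low

theorem Embeds.update_mem {B : ℕ} {m : ℕ → ℕ} {σ σ' : State} (h : Embeds B m σ σ') (a v : ℕ) :
    Embeds B m { σ with mem := Function.update σ.mem a v }
      { σ' with mem := Function.update σ'.mem (B + a) v } where
  base := h.base
  reg := h.reg
  mem i := by
    by_cases hi : i = a
    · simp [hi]
    · simp [hi, h.mem]
  low i hi := by
    simp [Function.update_of_ne (show i ≠ B + a by omega), h.low i hi]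

/-- Shifting all registers by two frees `0` for the base address and `1` for computed addresses.
Only `load` and `store` need an additional instruction, whence the factor 2 in the time. -/
theorem RunsIn.reloc {B : ℕ} {m : ℕ → ℕ} {P : Program} {σ τ : State} {t : ℕ}
    (h : RunsIn P σ τ t) : ∀ σ', Embeds B m σ σ' → Reaches P.reloc σ' (2 * t) (Embeds B m τ) := by
  induction h with
  | skip σ => exact fun σ' h => ⟨σ', 0, .skip σ', by omega, h⟩
  | instr i σ =>
    intro σ' h
    cases i with
    | const d v => exact (Reaches.instr (h.update_reg d v)).mono (by omega) fun _ h => h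
    | add d a b =>
      refine (Reaches.instr (Q := Embeds B m _) ?_).mono (by omega) fun _ h => h
      have := h.update_reg d (σ.reg a + σ.reg b)
      simpa only [Instr.exec, h.reg] using this
    | sub d a b =>
      refine (Reaches.instr (Q := Embeds B m _) ?_).mono (by omega) fun _ h => h
      have := h.update_reg d (σ.reg a - σ.reg b)
      simpa only [Instr.exec, h.reg] using this
    | load d a =>
      refine Reaches.seq (T := 1) (T' := 1)
        (Q := fun υ => υ = (Instr.add 1 0 (a + 2)).exec σ') (.instr rfl) ?_
      rintro _ rfl
      refine .instr ?_
      have := (h.update_scratch (B + σ.reg a)).update_reg d (σ.mem (σ.reg a))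
      simpa [Instr.exec, h.reg, h.base, h.mem] using this
    | store a b =>
      refine Reaches.seq (T := 1) (T' := 1)
        (Q := fun υ => υ = (Instr.add 1 0 (a + 2)).exec σ') (.instr rfl) ?_
      rintro _ rfl
      refine .instr ?_
      have := (h.update_scratch (B + σ.reg a)).update_mem (σ.reg a) (σ.reg b)
      simpa [Instr.exec, h.reg, h.base] using this
  | seq _ _ ih1 ih2 =>
    exact fun σ' h => ((ih1 σ' h).seq ih2).mono (by omega) fun _ h => h
  | ite_true hr _ ih =>
    intro σ' h
    refine (Reaches.ite (fun _ => ih σ' h) fun h0 => ?_).mono (by omega) fun _ h => h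
    exact absurd (by rw [← h.reg, h0]) hr
  | ite_false hr _ ih =>
    intro σ' h
    refine (Reaches.ite (fun h0 => ?_) fun _ => ih σ' h).mono (by omega) fun _ h => h
    exact absurd (by rw [h.reg, hr]) h0
  | loop_true hr _ _ ih1 ih2 =>
    intro σ' h
    obtain ⟨τ, s, h1, h2, h3⟩ := ih1 σ' h
    obtain ⟨υ, t, h1', h2', h3'⟩ := ih2 τ h3
    exact ⟨υ, s + t + 1, .loop_true (by rw [h.reg]; exact hr) h1 h1', by omega, h3'⟩
  | loop_false hr =>
    exact fun σ' h => ⟨σ', 1, .loop_false (by rw [h.reg, hr]), by omega, h⟩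

/-! ### Writing a table -/

/-- Write the table of a function that is given by an expression, from the address in register `0`
on. -/
theorem exists_reaches_table (len e : Ex) : ∃ P c d, ∀ (σ : State) (L : ℕ) (g : ℕ → ℕ),
    len.eval σ.mem (σ.reg 0) [] = L → L ≤ σ.reg 0 →
    (∀ m, (∀ i < σ.reg 0, m i = σ.mem i) → ∀ i < L, e.eval m (σ.reg 0) [i] = g i) →
    Reaches P σ (c * (σ.reg 0 + 1) ^ d) fun τ => τ.reg 0 = σ.reg 0 ∧
      (∀ i < σ.reg 0, τ.mem i = σ.mem i) ∧ (∀ i < L, τ.mem (σ.reg 0 + i) = g i) ∧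
      ∀ i, L ≤ i → τ.mem (σ.reg 0 + i) = σ.mem (σ.reg 0 + i) := by
  obtain ⟨P, c, d, hP⟩ := exists_evaluates len 0 id 2 (by omega) (by simp)
  obtain ⟨P₁, c₁, d₁, hP₁⟩ := exists_evaluates e 1 (fun _ => 1) 4 (by omega) (by simp)
  let start : Program := .seq (.instr (.const 1 0)) (.instr (.add 3 0 1))
  let next : Program := .seq (.instr (.store 3 4)) (.seq (.instr (.const 4 1))
      (.seq (.instr (.add 1 1 4)) (.seq (.instr (.add 3 3 4)) (.instr (.sub 2 2 4)))))
  have hstart (τ : State) : Reaches start τ 2 fun υ => υ.mem = τ.mem ∧ υ.reg 0 = τ.reg 0 ∧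
      υ.reg 1 = 0 ∧ υ.reg 2 = τ.reg 2 ∧ υ.reg 3 = τ.reg 0 := by
    refine Reaches.seq (T := 1) (T' := 1)
        (Q := fun υ => υ = (Instr.const 1 0).exec τ) (.instr rfl) ?_
    rintro _ rfl
    exact .instr ⟨rfl, by simp [Instr.exec], by simp [Instr.exec], by simp [Instr.exec],
      by simp [Instr.exec]⟩
  have hnext (τ : State) : Reaches next τ 5 fun υ =>
      υ.mem = Function.update τ.mem (τ.reg 3) (τ.reg 4) ∧ υ.reg 0 = τ.reg 0 ∧
      υ.reg 1 = τ.reg 1 + 1 ∧ υ.reg 2 = τ.reg 2 - 1 ∧ υ.reg 3 = τ.reg 3 + 1 := by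
    refine ⟨_, _, .seq (.instr _ _) (.seq (.instr _ _) (.seq (.instr _ _) (.seq (.instr _ _)
      (.instr _ _)))), by omega, ?_⟩
    simp [Instr.exec]
  refine ⟨.seq P (.seq start (.loop 2 (.seq P₁ next))), c + (c₁ + 9), d + (d₁ + 1),
    fun σ L g hL hLB hg => ?_⟩
  set B := σ.reg 0 with hB
  let Inv : ℕ → State → Prop := fun m τ => τ.reg 0 = B ∧ τ.reg 2 = m ∧ m ≤ L ∧ τ.reg 1 = L - m ∧
    τ.reg 3 = B + (L - m) ∧ (∀ i < B, τ.mem i = σ.mem i) ∧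
    (∀ i < L - m, τ.mem (B + i) = g i) ∧ ∀ i, L - m ≤ i → τ.mem (B + i) = σ.mem (B + i)
  have hbody : ∀ m τ, Inv (m + 1) τ →
      Reaches (.seq P₁ next) τ (c₁ * (B + 1) ^ d₁ + 5) (Inv m) := by
    rintro m τ ⟨h1, h2, h3, h4, h5, h6, h7, h8⟩
    -- The table overwrites only addresses from `B` on, and `hg` allows any memory that is intact
    -- below `B`; so `e` still has the right value on the half-written memory.
    have := hP₁ τ [L - (m + 1)] rfl (by simpa using h4)
    rw [h1, hg _ h6 _ (by omega)] at this
    refine this.seq (T' := 5) ?_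
    rintro υ ⟨h1', h2', h3'⟩
    refine (hnext υ).mono le_rfl ?_
    rintro φ ⟨k1, k2, k3, k4, k5⟩
    rw [h1', h2' 3 (by omega), h5, h3'] at k1
    rw [h2' 0 (by omega), h1] at k2
    rw [h2' 1 (by omega), h4] at k3
    rw [h2' 2 (by omega), h2] at k4
    rw [h2' 3 (by omega), h5] at k5
    refine ⟨k2, k4, by omega, by omega, by omega, fun i hi => ?_, fun i hi => ?_, fun i hi => ?_⟩
    · rw [k1, Function.update_of_ne (by omega), h6 i hi]
    · rw [k1]
      by_cases hi' : i = L - (m + 1)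
      · simp [hi']
      · rw [Function.update_of_ne (by omega), h7 i (by omega)]
    · rw [k1, Function.update_of_ne (by omega), h8 i (by omega)]
  refine ((hP σ [] rfl (by simp)).seq (T' := 2 +
      (L * (c₁ * (B + 1) ^ d₁ + 5 + 1) + 1)) ?_).mono ?_ fun _ h => h
  · rintro τ ⟨h1, h2, h3⟩
    refine (hstart τ).seq ?_
    rintro υ ⟨k1, k2, k3, k4, k5⟩
    refine (Reaches.loop (I := Inv) (fun m τ h => h.2.1) hbody L υ ⟨?_, ?_, le_rfl, ?_, ?_, ?_,
      ?_, ?_⟩).mono le_rfl ?_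
    · rw [k2, h2 0 (by omega)]
    · rw [k4, h3, hL]
    · omega
    · rw [k5, h2 0 (by omega)]; omega
    · intro i _; rw [k1, h1]
    · intro i hi; omega
    · intro i _; rw [k1, h1]
    · rintro φ ⟨g1, g2, g3, g4, g5, g6, g7, g8⟩
      exact ⟨g1, g6, fun i hi => g7 i (by omega), fun i hi => g8 i (by omega)⟩
  · have hpow : 1 ≤ (B + 1) ^ d₁ := Nat.one_le_pow _ _ (by omega)
    have key : 2 + (L * (c₁ * (B + 1) ^ d₁ + 5 + 1) + 1) ≤ (c₁ + 9) * (B + 1) ^ (d₁ + 1) := by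
      calc _ ≤ B * (c₁ * (B + 1) ^ d₁ + 6) + 3 := by
              have := Nat.mul_le_mul_right (c₁ * (B + 1) ^ d₁ + 5 + 1) hLB
              linarith
        _ ≤ B * (c₁ * (B + 1) ^ d₁ + 6 * (B + 1) ^ d₁) + 3 * (B + 1) ^ d₁ := by
            gcongr <;> omega
        _ ≤ (c₁ + 9) * (B + 1) ^ (d₁ + 1) := by
            rw [pow_succ]; nlinarith [Nat.zero_le c₁]
    have e1 := mul_pow_add_le c d (c₁ + 9) (d₁ + 1) B
    rw [← hB]
    omega

end RAM

/-! ### Connectives, bounded sums, quantifiers and counting as expressions -/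

namespace RAM

theorem iterate_eq_sum {f : ℕ → ℕ → ℕ} {g : ℕ → ℕ} {n : ℕ} (a : ℕ)
    (h : ∀ i < n, ∀ x, f i x = x + g i) :
    iterate f a n = a + ∑ i ∈ Finset.range n, g i := by
  induction n with
  | zero => simp [iterate]
  | succ n ih =>
    rw [iterate, ih fun i hi => h i (by omega), h n (by omega), Finset.sum_range_succ, add_assoc]

namespace Ex

/-- Negation, where nonzero numbers are read as true. -/
def not (a : Ex) : Ex := ite a (const 0) (const 1)

def and (a b : Ex) : Ex := ite a b (const 0)

def or (a b : Ex) : Ex := ite a (const 1) b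

def lt (a b : Ex) : Ex := sub b a

def le (a b : Ex) : Ex := not (sub a b)

def eq (a b : Ex) : Ex := not (add (sub a b) (sub b a))

/-- The sum of the values of `b` for the indices below `n`. Here `k` is the length of the
environment; the index is the variable `k + 1` in `b`. -/
def sum (k : ℕ) (n b : Ex) : Ex := iter n (const 0) (add (var k) b)

/-- Bounded existential quantification. -/
def some (k : ℕ) (n p : Ex) : Ex := sum k n (and p (const 1))

/-- Bounded universal quantification. -/
def all (k : ℕ) (n p : Ex) : Ex := not (some k n (not p))

variable {m : ℕ → ℕ} {B : ℕ} {env : List ℕ}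

theorem eval_not {a : Ex} : (not a).eval m B env ≠ 0 ↔ ¬ a.eval m B env ≠ 0 := by
  simp [not, eval]

theorem eval_and {a b : Ex} :
    (and a b).eval m B env ≠ 0 ↔ a.eval m B env ≠ 0 ∧ b.eval m B env ≠ 0 := by
  simp only [and, eval]
  split_ifs <;> simp_all

theorem eval_or {a b : Ex} :
    (or a b).eval m B env ≠ 0 ↔ a.eval m B env ≠ 0 ∨ b.eval m B env ≠ 0 := by
  simp only [or, eval]
  split_ifs <;> simp_all

theorem eval_lt {a b : Ex} :
    (lt a b).eval m B env ≠ 0 ↔ a.eval m B env < b.eval m B env := by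
  simp only [lt, eval]
  omega

theorem eval_le {a b : Ex} :
    (le a b).eval m B env ≠ 0 ↔ a.eval m B env ≤ b.eval m B env := by
  rw [le, eval_not]
  simp only [eval]
  omega

theorem eval_eq {a b : Ex} :
    (eq a b).eval m B env ≠ 0 ↔ a.eval m B env = b.eval m B env := by
  rw [eq, eval_not]
  simp only [eval]
  omega

/-- Loops are cut off after `B` rounds, so the range has to be within the bound. The accumulator `x`
is visible to `b`, whose value must not depend on it. -/
theorem eval_sum {k : ℕ} {n b : Ex} {g : ℕ → ℕ} (hk : env.length = k) (hn : n.eval m B env ≤ B)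
    (h : ∀ x, ∀ i < n.eval m B env, b.eval m B (env ++ [x, i]) = g i) :
    (sum k n b).eval m B env = ∑ i ∈ Finset.range (n.eval m B env), g i := by
  rw [sum, eval, min_eq_left hn, iterate_eq_sum (g := g)]
  · simp [eval]
  · intro i hi x
    rw [eval, h x i hi, eval, getD_append_pair, if_neg (by omega), if_pos hk.symm]

theorem eval_some {k : ℕ} {n b : Ex} {p : ℕ → Prop} (hk : env.length = k)
    (hn : n.eval m B env ≤ B)
    (h : ∀ x, ∀ i < n.eval m B env, (b.eval m B (env ++ [x, i]) ≠ 0 ↔ p i)) :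
    (some k n b).eval m B env ≠ 0 ↔ ∃ i < n.eval m B env, p i := by
  classical
  rw [some, eval_sum (g := fun i => if p i then 1 else 0) hk hn]
  · simp
  · intro x i hi
    rw [and, eval, ← h x i hi]
    simp [eval]

theorem eval_all {k : ℕ} {n b : Ex} {p : ℕ → Prop} (hk : env.length = k)
    (hn : n.eval m B env ≤ B)
    (h : ∀ x, ∀ i < n.eval m B env, (b.eval m B (env ++ [x, i]) ≠ 0 ↔ p i)) :
    (all k n b).eval m B env ≠ 0 ↔ ∀ i < n.eval m B env, p i := by
  rw [all, eval_not, eval_some (p := fun i => ¬ p i) hk hn]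
  · simp
  · intro x i hi
    rw [eval_not, h x i hi]

/-- The number of indices below `n` with the property `p`. -/
def count (k : ℕ) (n p : Ex) : Ex := sum k n (and p (const 1))

/-- If `p` holds exactly for the indices below `c`, then `count` finds `c`. -/
theorem eval_count {k : ℕ} {n b : Ex} {c : ℕ} (hk : env.length = k)
    (hn : n.eval m B env ≤ B) (hc : c ≤ n.eval m B env)
    (h : ∀ x, ∀ i < n.eval m B env, (b.eval m B (env ++ [x, i]) ≠ 0 ↔ i < c)) :
    (count k n b).eval m B env = c := by
  rw [count, eval_sum (g := fun i => if i < c then 1 else 0) hk hn]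
  · rw [Finset.sum_ite, Finset.sum_const_zero, add_zero, Finset.sum_const, smul_eq_mul, mul_one,
      show (Finset.range (n.eval m B env)).filter (· < c) = Finset.range c by ext; simp; omega,
      Finset.card_range]
  · intro x i hi
    rw [and, eval, if_congr (h x i hi) rfl rfl]
    simp [eval]

/-! ### Arithmetic -/

/-- Evaluation of calls and variables. -/
def mul (a b : Ex) : Ex :=
  call (iter (var 1) (const 0) (add (var 2) (var 0))) 2 ![a, b]

/-- The second factor counts the rounds of repeated addition, and therefore it alone must be within
the bound. Products may exceed the bound. -/
theorem eval_mul {a b : Ex} (hb : b.eval m B env ≤ B) :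
    (mul a b).eval m B env = a.eval m B env * b.eval m B env := by
  have := iterate_eq_sum (f := fun _ x => x + a.eval m B env) (g := fun _ => a.eval m B env)
    (n := b.eval m B env) 0 fun _ _ _ => rfl
  simp only [mul, eval, List.ofFn_succ, List.ofFn_zero, Matrix.cons_val_zero, Matrix.cons_val_succ]
  simp [hb, this, mul_comm]

def pow (a b : Ex) : Ex :=
  call (iter (var 1) (const 1) (mul (var 2) (var 0))) 2 ![a, b]

/-- In each round the accumulator is the first factor and the base the second, so the power itself
may exceed the bound. -/
theorem eval_pow {a b : Ex} (ha : a.eval m B env ≤ B) (hb : b.eval m B env ≤ B) :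
    (pow a b).eval m B env = a.eval m B env ^ b.eval m B env := by
  simp only [pow, eval, List.ofFn_succ, List.ofFn_zero, Matrix.cons_val_zero, Matrix.cons_val_succ]
  simp only [List.getD_cons_zero, List.getD_cons_succ]
  rw [min_eq_left hb]
  have key : ∀ x y n, x ≤ B → iterate (fun i z => eval m B ((var 2).mul (var 0)) ([x, y] ++ [z, i])) 1 n =
      x ^ n := by
    intro x y n hx
    induction n with
    | zero => rfl
    | succ n ih =>
      rw [iterate, eval_mul (by simpa [eval]), pow_succ, ← ih]
      simp [eval]
  exact key _ _ _ ha

/-- `2 ^ a` -/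
def twoPow (a : Ex) : Ex :=
  call (iter (var 0) (const 1) (add (var 1) (var 1))) 1 ![a]

theorem eval_twoPow {a : Ex} (ha : a.eval m B env ≤ B) :
    (twoPow a).eval m B env = 2 ^ a.eval m B env := by
  simp only [twoPow, eval, List.ofFn_succ, List.ofFn_zero, Matrix.cons_val_zero]
  simp only [List.getD_cons_zero]
  rw [min_eq_left ha]
  generalize eval m B a env = y
  induction y with
  | zero => rfl
  | succ y ih =>
    rw [iterate, pow_succ, ← ih]
    simp [mul_two]

/-- The quotient is the number of `i < a` with `(i + 1) * b ≤ a`. For `b = 0` this would count every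
`i`, so that case is set to the conventional value 0. -/
def div (a b : Ex) : Ex :=
  call (ite (var 1) (count 2 (var 0) (le (mul (add (var 3) (const 1)) (var 1)) (var 0)))
    (const 0)) 2 ![a, b]

theorem eval_div {a b : Ex} (ha : a.eval m B env ≤ B) (hb : b.eval m B env ≤ B) :
    (div a b).eval m B env = a.eval m B env / b.eval m B env := by
  rw [div, eval]
  simp only [List.ofFn_succ, List.ofFn_zero, Matrix.cons_val_zero, Matrix.cons_val_succ]
  generalize eval m B a env = x at *
  generalize eval m B b env = y at *
  rw [eval]
  rcases Nat.eq_zero_or_pos y with rfl | hy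
  · simp [eval]
  · rw [if_pos (by simp [eval]; omega)]
    refine eval_count rfl (by simpa [eval]) (by simpa [eval] using Nat.div_le_self x y) ?_
    intro _ i _
    rw [eval_le, eval_mul (by simpa [eval])]
    simp only [eval, List.cons_append, List.nil_append, List.getD_cons_zero, List.getD_cons_succ]
    rw [← Nat.le_div_iff_mul_le hy]
    rfl

def mod (a b : Ex) : Ex := sub a (mul (div a b) b)

theorem eval_mod {a b : Ex} (ha : a.eval m B env ≤ B) (hb : b.eval m B env ≤ B) :
    (mod a b).eval m B env = a.eval m B env % b.eval m B env := by
  rw [mod, eval, eval_mul hb, eval_div ha hb, mul_comm, Nat.mod_eq_sub_mul_div]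

def log (a : Ex) : Ex :=
  call (count 1 (var 0) (le (twoPow (add (var 2) (const 1))) (var 0))) 1 ![a]

theorem eval_log {a : Ex} (ha : a.eval m B env ≤ B) :
    (log a).eval m B env = Nat.log 2 (a.eval m B env) := by
  rw [log, eval]
  simp only [List.ofFn_succ, List.ofFn_zero, Matrix.cons_val_zero]
  generalize eval m B a env = x at *
  refine eval_count rfl (by simpa [eval]) (by simpa [eval] using Nat.log_le_self 2 x) ?_
  intro _ i hi
  simp only [eval, List.getD_cons_zero] at hi
  rw [eval_le, eval_twoPow (by simp [eval]; omega)]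
  simp only [eval, List.cons_append, List.nil_append, List.getD_cons_zero, List.getD_cons_succ]
  rw [← Nat.le_log_iff_pow_le (by omega) (by omega)]
  rfl

def sqrt (a : Ex) : Ex :=
  call (count 1 (var 0) (le (mul (add (var 2) (const 1)) (add (var 2) (const 1))) (var 0))) 1 ![a]

theorem eval_sqrt {a : Ex} (ha : a.eval m B env ≤ B) :
    (sqrt a).eval m B env = Nat.sqrt (a.eval m B env) := by
  rw [sqrt, eval]
  simp only [List.ofFn_succ, List.ofFn_zero, Matrix.cons_val_zero]
  generalize eval m B a env = x at *
  refine eval_count rfl (by simpa [eval]) (by simpa [eval] using Nat.sqrt_le_self x) ?_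
  intro _ i hi
  simp only [eval, List.getD_cons_zero] at hi
  rw [eval_le, eval_mul (by simp [eval]; omega)]
  simp only [eval, List.cons_append, List.nil_append, List.getD_cons_zero, List.getD_cons_succ]
  rw [← Nat.le_sqrt]
  rfl

def prime (a : Ex) : Ex :=
  call (and (le (const 2) (var 0))
    (all 1 (var 0) (or (lt (var 2) (const 2)) (mod (var 0) (var 2))))) 1 ![a]

theorem eval_prime {a : Ex} (ha : a.eval m B env ≤ B) :
    (prime a).eval m B env ≠ 0 ↔ (a.eval m B env).Prime := by
  rw [prime, eval]
  simp only [List.ofFn_succ, List.ofFn_zero, Matrix.cons_val_zero]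
  generalize eval m B a env = x at *
  rw [eval_and, eval_le, eval_all (k := 1) (p := fun i => i < 2 ∨ ¬ i ∣ x) rfl (by simpa [eval]),
    Nat.prime_def_lt']
  · simp only [eval, List.getD_cons_zero]
    refine and_congr_right fun _ => forall_congr' fun i => ?_
    by_cases h : i < 2
    · simp [h]
    · simp only [h, false_or]
      exact ⟨fun k _ hi => k hi, fun k hi => k (by omega) hi⟩
  · intro _ i hi
    simp only [eval, List.getD_cons_zero] at hi
    rw [eval_or, eval_lt, eval_mod (by simpa [eval]) (by simp [eval]; omega)]
    simp [eval, Nat.dvd_iff_mod_eq_zero]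

end Ex

/-- The least prime number from `m` on. -/
noncomputable def leastPrime (m : ℕ) : ℕ := by
  classical exact Nat.find (Nat.exists_infinite_primes m)

theorem le_leastPrime (m : ℕ) : m ≤ leastPrime m := by
  classical exact (Nat.find_spec (Nat.exists_infinite_primes m)).1

theorem prime_leastPrime (m : ℕ) : (leastPrime m).Prime := by
  classical exact (Nat.find_spec (Nat.exists_infinite_primes m)).2

theorem leastPrime_le {m p : ℕ} (hm : m ≤ p) (hp : p.Prime) : leastPrime m ≤ p := by
  classical exact Nat.find_min' (Nat.exists_infinite_primes m) ⟨hm, hp⟩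

theorem leastPrime_le_two_mul {m : ℕ} (hm : m ≠ 0) : leastPrime m ≤ 2 * m := by
  obtain ⟨p, hp, h1, h2⟩ := Nat.exists_prime_lt_and_le_two_mul m hm
  exact (leastPrime_le h1.le hp).trans h2

namespace Ex

variable {m : ℕ → ℕ} {B : ℕ} {env : List ℕ}

/-- The accumulator is 0 until a prime is met and then stays fixed. The candidates run from `a` to
`2 * a`, which suffices by Bertrand's postulate. -/
def primeGe (a : Ex) : Ex :=
  call (iter (add (var 0) (const 1)) (const 0)
    (ite (var 1) (var 1) (ite (prime (add (var 0) (var 2))) (add (var 0) (var 2)) (const 0)))) 1 ![a]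

theorem eval_primeGe {a : Ex} (ha : 2 * a.eval m B env ≤ B) (ha0 : a.eval m B env ≠ 0) :
    (primeGe a).eval m B env = leastPrime (a.eval m B env) := by
  rw [primeGe, eval]
  simp only [List.ofFn_succ, List.ofFn_zero, Matrix.cons_val_zero]
  generalize eval m B a env = x at *
  rw [eval]
  have h1 : (add (var 0) (const 1)).eval m B [x] = x + 1 := by simp [eval]
  rw [h1, min_eq_left (by omega)]
  have key : ∀ n ≤ x + 1, iterate (fun i y => eval m B (ite (var 1) (var 1)
      (ite (prime (add (var 0) (var 2))) (add (var 0) (var 2)) (const 0))) ([x] ++ [y, i]))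
      ((const 0).eval m B [x]) n = if leastPrime x < x + n then leastPrime x else 0 := by
    intro n hn
    induction n with
    | zero =>
      rw [if_neg (by have := le_leastPrime x; omega)]
      rfl
    | succ n ih =>
      rw [iterate, ih (by omega), eval]
      have hp := (prime_leastPrime x).pos
      have hx := le_leastPrime x
      have hprime := eval_prime (m := m) (B := B) (a := add (var 0) (var 2))
        (env := [x] ++ [if leastPrime x < x + n then leastPrime x else 0, n])
        (by simp [eval]; omega)
      simp only [eval, List.cons_append, List.nil_append, List.getD_cons_zero,
        List.getD_cons_succ] at hprime ⊢
      by_cases h1 : leastPrime x < x + n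
      · rw [if_pos h1, if_pos (by omega), if_pos (by omega)]
      · rw [if_neg h1] at hprime ⊢
        rw [if_neg (by omega), if_congr hprime rfl rfl]
        split_ifs with h2 h3 h3
        · have := leastPrime_le (m := x) (by omega) h2
          omega
        · have := leastPrime_le (m := x) (by omega) h2
          omega
        · refine absurd ?_ h2
          rw [show x + n = leastPrime x by omega]
          exact prime_leastPrime x
        · rfl
  rw [key _ le_rfl, if_pos (by have := leastPrime_le_two_mul ha0; omega)]

end Ex
end RAM

/-! ### Primitive recursive functions as expressions that may report failure -/

namespace RAM
namespace Ex

variable {m : ℕ → ℕ} {B : ℕ} {env : List ℕ}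

theorem eval_ite (c a b : Ex) : (ite c a b).eval m B env =
    if c.eval m B env ≠ 0 then a.eval m B env else b.eval m B env := rfl

theorem eval_add (a b : Ex) : (add a b).eval m B env = a.eval m B env + b.eval m B env := rfl

theorem eval_sub (a b : Ex) : (sub a b).eval m B env = a.eval m B env - b.eval m B env := rfl

def pair (a b : Ex) : Ex :=
  call (ite (lt (var 0) (var 1)) (add (mul (var 1) (var 1)) (var 0))
    (add (add (mul (var 0) (var 0)) (var 0)) (var 1))) 2 ![a, b]

theorem eval_pair {a b : Ex} (ha : a.eval m B env ≤ B) (hb : b.eval m B env ≤ B) :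
    (pair a b).eval m B env = Nat.pair (a.eval m B env) (b.eval m B env) := by
  rw [pair, eval]
  simp only [List.ofFn_succ, List.ofFn_zero, Matrix.cons_val_zero, Matrix.cons_val_succ]
  generalize eval m B a env = x at *
  generalize eval m B b env = y at *
  simp only [eval_ite, eval_lt, eval_add]
  rw [eval_mul (by simpa [eval]), eval_mul (by simpa [eval])]
  simp [eval, Nat.pair]

def left (a : Ex) : Ex :=
  call (ite (lt (sub (var 0) (mul (sqrt (var 0)) (sqrt (var 0)))) (sqrt (var 0)))
    (sub (var 0) (mul (sqrt (var 0)) (sqrt (var 0)))) (sqrt (var 0))) 1 ![a]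

theorem eval_left {a : Ex} (ha : a.eval m B env ≤ B) :
    (left a).eval m B env = (Nat.unpair (a.eval m B env)).1 := by
  rw [left, eval]
  simp only [List.ofFn_succ, List.ofFn_zero, Matrix.cons_val_zero]
  generalize eval m B a env = x at *
  have hs := Nat.sqrt_le_self x
  simp only [eval_ite, eval_lt, eval_sub]
  rw [eval_mul, eval_sqrt]
  · simp only [eval, List.getD_cons_zero, Nat.unpair]
    split_ifs <;> rfl
  · simpa [eval]
  · rw [eval_sqrt] <;> simp [eval] <;> omega

def right (a : Ex) : Ex :=
  call (ite (lt (sub (var 0) (mul (sqrt (var 0)) (sqrt (var 0)))) (sqrt (var 0)))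
    (sqrt (var 0)) (sub (sub (var 0) (mul (sqrt (var 0)) (sqrt (var 0)))) (sqrt (var 0)))) 1 ![a]

theorem eval_right {a : Ex} (ha : a.eval m B env ≤ B) :
    (right a).eval m B env = (Nat.unpair (a.eval m B env)).2 := by
  rw [right, eval]
  simp only [List.ofFn_succ, List.ofFn_zero, Matrix.cons_val_zero]
  generalize eval m B a env = x at *
  have hs := Nat.sqrt_le_self x
  simp only [eval_ite, eval_lt, eval_sub]
  rw [eval_mul, eval_sqrt]
  · simp only [eval, List.getD_cons_zero, Nat.unpair]
    split_ifs <;> rfl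
  · simpa [eval]
  · rw [eval_sqrt] <;> simp [eval] <;> omega

/-- If `a` has the value `v + 1` with `v` at most the bound, then `f v`, and else `0`. -/
def bind (a f : Ex) : Ex :=
  call (ite (var 0) (ite (lt bound (sub (var 0) (const 1))) (const 0)
    (call f 1 ![sub (var 0) (const 1)])) (const 0)) 1 ![a]

theorem eval_bind {a f : Ex} : (bind a f).eval m B env =
    if a.eval m B env = 0 ∨ B < a.eval m B env - 1 then 0
      else f.eval m B [a.eval m B env - 1] := by
  rw [bind, eval]
  simp only [List.ofFn_succ, List.ofFn_zero, Matrix.cons_val_zero]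
  generalize eval m B a env = x at *
  simp only [eval_ite, eval_lt]
  simp only [eval, List.getD_cons_zero, List.ofFn_succ, List.ofFn_zero, Matrix.cons_val_zero]
  split_ifs <;> first | rfl | omega

end Ex

/-- The expression `e` computes `f` as long as the bound is large enough, and reports failure
otherwise: the value is `0` or `f x + 1`, and the latter for all bounds from `β x` on. -/
def Approximates (e : Ex) (f β : ℕ → ℕ) : Prop :=
  ∀ m B x, (e.eval m B [x] = 0 ∨ e.eval m B [x] = f x + 1) ∧
    (β x ≤ B → e.eval m B [x] = f x + 1)

-- The structure of a primitive recursive definition is copied, and failure is passed on whenever an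
-- intermediate value exceeds the bound. The resource function `β` dominates the intermediate values
-- that arise, and is again primitive recursive.
open Ex in
theorem exists_approximates {f : ℕ → ℕ} (hf : Nat.Primrec f) :
    ∃ e β, Approximates e f β ∧ Nat.Primrec β := by
  induction hf with
  | zero => exact ⟨.const 1, fun _ => 0, fun m B x => by simp [Ex.eval], .zero⟩
  | succ => exact ⟨.add (.var 0) (.const 2), fun _ => 0, fun m B x => by simp [Ex.eval], .zero⟩
  | left =>
    refine ⟨.ite (.le (.var 0) .bound) (.add (.left (.var 0)) (.const 1)) (.const 0), id,
      fun m B x => ?_, .id⟩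
    simp only [eval_ite, eval_le]
    by_cases h : x ≤ B
    · rw [if_pos (by simpa [Ex.eval]), Ex.eval, eval_left (by simpa [Ex.eval])]
      simp [Ex.eval]
    · rw [if_neg (by simpa [Ex.eval] using h)]
      simp [Ex.eval, h]
  | right =>
    refine ⟨.ite (.le (.var 0) .bound) (.add (.right (.var 0)) (.const 1)) (.const 0), id,
      fun m B x => ?_, .id⟩
    simp only [eval_ite, eval_le]
    by_cases h : x ≤ B
    · rw [if_pos (by simpa [Ex.eval]), Ex.eval, eval_right (by simpa [Ex.eval])]
      simp [Ex.eval]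
    · rw [if_neg (by simpa [Ex.eval] using h)]
      simp [Ex.eval, h]
  | @pair f g hf hg ihf ihg =>
    obtain ⟨e, β, he, hβ⟩ := ihf
    obtain ⟨e', β', he', hβ'⟩ := ihg
    refine ⟨call (ite (and (and (var 0) (le (var 0) bound)) (and (var 1) (le (var 1) bound)))
        (add (.pair (sub (var 0) (const 1)) (sub (var 1) (const 1))) (const 1)) (const 0)) 2 ![e, e'],
      fun x => (β x + β' x) + (f x + g x) + 1, fun m B x => ?_, ?_⟩
    · rw [Ex.eval]
      simp only [List.ofFn_succ, List.ofFn_zero, Matrix.cons_val_zero, Matrix.cons_val_succ]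
      obtain ⟨h1, h2⟩ := he m B x
      obtain ⟨h1', h2'⟩ := he' m B x
      generalize eval m B e [x] = u at *
      generalize eval m B e' [x] = v at *
      simp only [eval_ite, eval_and, eval_le]
      simp only [Ex.eval, List.getD_cons_zero, List.getD_cons_succ]
      constructor
      · split_ifs with h
        · rw [eval_pair (by simp [Ex.eval]; omega) (by simp [Ex.eval]; omega)]
          simp only [Ex.eval, List.getD_cons_zero, List.getD_cons_succ]
          right
          rw [h1.resolve_left h.1.1, h1'.resolve_left h.2.1]
          rfl
        · exact .inl rfl
      · intro hB
        have k1 := h2 (by omega)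
        have k2 := h2' (by omega)
        rw [if_pos (by omega), eval_pair (by simp [Ex.eval]; omega) (by simp [Ex.eval]; omega)]
        simp only [Ex.eval, List.getD_cons_zero, List.getD_cons_succ]
        rw [k1, k2]
        rfl
    · have := fun {f g : ℕ → ℕ} (hf : Nat.Primrec f) (hg : Nat.Primrec g) =>
        (Nat.Primrec.add.comp (hf.pair hg)).of_eq (g := fun x => f x + g x) (by simp)
      exact this (this (this hβ hβ') (this hf hg)) (.const 1)
  | @comp f g hf hg ihf ihg =>
    obtain ⟨e, β, he, hβ⟩ := ihf
    obtain ⟨e', β', he', hβ'⟩ := ihg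
    refine ⟨.bind e' e, fun x => β' x + (g x + β (g x)), fun m B x => ?_, ?_⟩
    · rw [eval_bind]
      obtain ⟨h1, h2⟩ := he' m B x
      constructor
      · split_ifs with h
        · exact .inl rfl
        · rw [h1.resolve_left (by omega)]
          exact (he m B (g x)).1
      · intro hB
        dsimp only at hB
        rw [h2 (by omega), if_neg (by omega)]
        exact (he m B (g x)).2 (by omega)
    · have := fun {f g : ℕ → ℕ} (hf : Nat.Primrec f) (hg : Nat.Primrec g) =>
        (Nat.Primrec.add.comp (hf.pair hg)).of_eq (g := fun x => f x + g x) (by simp)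
      exact this hβ' (this hg (hβ.comp hg))
  | @prec f g hf hg ihf ihg =>
    obtain ⟨e, β, he, hβ⟩ := ihf
    obtain ⟨e', β', he', hβ'⟩ := ihg
    let h : ℕ → ℕ → ℕ := fun z n => n.rec (f z) fun y IH => g (Nat.pair z (Nat.pair y IH))
    let c : ℕ → ℕ → ℕ := fun z y => h z y + Nat.pair y (h z y) + Nat.pair z (Nat.pair y (h z y)) +
      β' (Nat.pair z (Nat.pair y (h z y))) + 1
    -- Adding up the needs of all rounds, rather than taking only those of the last, ensures that no
    -- earlier round fails.
    let γ : ℕ → ℕ → ℕ := fun z n => n.rec (β z) fun y s => s + c z y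
    let p : Ex := .pair (var 3) (sub (var 2) (const 1))
    let body : Ex := ite (and (var 2) (and (le (var 2) bound) (le p bound)))
      (.bind (add (.pair (var 0) p) (const 1)) e') (const 0)
    have hbody : ∀ m B z n u i, z ≤ B → i ≤ B → body.eval m B [z, n, u, i] =
        if u ≠ 0 ∧ u ≤ B ∧ Nat.pair i (u - 1) ≤ B ∧ Nat.pair z (Nat.pair i (u - 1)) ≤ B then
          e'.eval m B [Nat.pair z (Nat.pair i (u - 1))] else 0 := by
      intro m B z n u i hz hi
      simp only [body]
      simp only [eval_ite, eval_and, eval_le]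
      by_cases hu : u ≤ B
      · have hp : p.eval m B [z, n, u, i] = Nat.pair i (u - 1) := by
          rw [eval_pair (by simpa [Ex.eval]) (by simp [Ex.eval]; omega)]
          rfl
        simp only [hp, Ex.eval, List.getD_cons_zero, List.getD_cons_succ]
        rw [eval_bind]
        by_cases hp' : Nat.pair i (u - 1) ≤ B
        · have hq : (Ex.pair (var 0) p).eval m B [z, n, u, i] =
              Nat.pair z (Nat.pair i (u - 1)) := by
            rw [eval_pair (by simpa [Ex.eval]) (by rwa [hp]), hp]
            rfl
          rw [Ex.eval, hq]
          simp only [Ex.eval, Nat.add_sub_cancel, Nat.add_one_ne_zero, false_or]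
          split_ifs <;> first | rfl | omega
        · rw [if_neg (by tauto), if_neg (by tauto)]
      · simp only [Ex.eval, List.getD_cons_zero, List.getD_cons_succ]
        rw [if_neg (by tauto), if_neg (by tauto)]
    refine ⟨ite (.le (var 0) bound) (call (iter (var 1) (call e 1 ![var 0]) body) 2
      ![.left (var 0), .right (var 0)]) (const 0),
      fun x => x + γ x.unpair.1 x.unpair.2, fun m B x => ?_, ?_⟩
    · simp only [eval_ite, eval_le]
      simp only [Ex.eval, List.getD_cons_zero, List.ofFn_succ, List.ofFn_zero,
        Matrix.cons_val_zero, Matrix.cons_val_succ, List.getD_cons_succ]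
      by_cases hx : x ≤ B
      swap
      · rw [if_neg hx]
        exact ⟨.inl rfl, fun _ => by omega⟩
      rw [if_pos hx, eval_left (by simpa [Ex.eval]), eval_right (by simpa [Ex.eval])]
      simp only [Ex.eval, List.getD_cons_zero]
      have hz : x.unpair.1 ≤ B := (Nat.unpair_left_le x).trans hx
      have hn : x.unpair.2 ≤ B := (Nat.unpair_right_le x).trans hx
      rw [min_eq_left hn]
      have key : ∀ z n₀ n, z ≤ B → n ≤ B → ∀ u, u = iterate (fun i u =>
          body.eval m B ([z, n₀] ++ [u, i])) (e.eval m B [z]) n →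
          (u = 0 ∨ u = h z n + 1) ∧ (γ z n ≤ B → u = h z n + 1) := by
        intro z n₀ n hz hn
        induction n with
        | zero =>
          rintro u rfl
          exact he m B z
        | succ n ih =>
          rintro u rfl
          obtain ⟨k1, k2⟩ := ih (by omega) _ rfl
          rw [iterate]
          generalize iterate _ _ n = u at k1 k2 ⊢
          simp only [List.cons_append, List.nil_append]
          rw [hbody m B z n₀ u n hz (by omega)]
          obtain ⟨l1, l2⟩ := he' m B (Nat.pair z (Nat.pair n (h z n)))
          constructor
          · split_ifs with hu
            · obtain rfl := k1.resolve_left hu.1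
              exact l1
            · exact .inl rfl
          · intro hγ
            have hγ' : γ z n + c z n ≤ B := hγ
            obtain rfl := k2 (by omega)
            simp only [c] at hγ'
            rw [Nat.add_sub_cancel, if_pos (by omega)]
            exact l2 (by omega)
      obtain ⟨k1, k2⟩ := key x.unpair.1 x.unpair.2 x.unpair.2 hz hn _ rfl
      exact ⟨k1, fun hB => k2 (by omega)⟩
    · rw [← Primrec.nat_iff] at hf hg hβ hβ' ⊢
      have hh : Primrec₂ h := Primrec.nat_rec hf
        (hg.comp (Primrec₂.natPair.comp .fst (Primrec₂.natPair.comp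
          (Primrec.fst.comp .snd) (Primrec.snd.comp .snd)))).to₂
      have hp : Primrec₂ fun z y => Nat.pair y (h z y) := Primrec₂.natPair.comp₂ Primrec₂.right hh
      have hq : Primrec₂ fun z y => Nat.pair z (Nat.pair y (h z y)) :=
        Primrec₂.natPair.comp₂ Primrec₂.left hp
      have hc : Primrec₂ c := Primrec.nat_add.comp₂ (Primrec.nat_add.comp₂ (Primrec.nat_add.comp₂
        (Primrec.nat_add.comp₂ hh hp) hq) (hβ'.comp₂ hq)) (Primrec₂.const 1)
      have hγ : Primrec₂ γ := Primrec.nat_rec (g := fun z (q : ℕ × ℕ) => q.2 + c z q.1) hβ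
        (Primrec.nat_add.comp (Primrec.snd.comp .snd)
          (hc.comp Primrec.fst (Primrec.fst.comp .snd))).to₂
      exact Primrec.nat_add.comp .id (hγ.comp (Primrec.fst.comp .unpair) (Primrec.snd.comp .unpair))

end RAM

/-! ### Certified lower bounds on a computable unbounded function -/

namespace RAM

open Nat.Partrec (Code)

/-- Below every computable monotone unbounded function there is a primitive recursive unbounded
function. -/
theorem exists_primrec_le {ι : ℕ → ℕ} (hι : Computable ι) (hm : Monotone ι)
    (ht : Filter.Tendsto ι Filter.atTop Filter.atTop) :
    ∃ θ : ℕ → ℕ, Primrec θ ∧ (∀ y, θ y ≤ ι y) ∧ ∀ K, ∃ y, K ≤ θ y := by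
  obtain ⟨c, hc⟩ := Code.exists_code.1 (Partrec.nat_iff.1 hι)
  -- The number `y` codes a time limit `s` and an argument `x`; the value is `ι x` if it is found
  -- within the limit and 0 otherwise. As `x ≤ y` and `ι` is monotone, it is at most `ι y`.
  refine ⟨fun y => (Code.evaln y.unpair.1 c y.unpair.2).getD 0, ?_, fun y => ?_, fun K => ?_⟩
  · refine Primrec.option_getD.comp (Code.primrec_evaln.comp
      (((Primrec.fst.comp .unpair).pair (.const c)).pair (Primrec.snd.comp .unpair))) (.const 0)
  · dsimp only
    cases h : Code.evaln y.unpair.1 c y.unpair.2 with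
    | none => simp
    | some v =>
      have := Code.evaln_sound (Option.mem_def.2 h)
      rw [hc] at this
      obtain rfl : v = ι y.unpair.2 := by simpa using this
      exact hm (Nat.unpair_right_le y)
  · obtain ⟨x, hx⟩ := (ht.eventually_ge_atTop K).exists
    have : ι x ∈ Code.eval c x := by rw [hc]; simp
    obtain ⟨s, hs⟩ := Code.evaln_complete.1 this
    refine ⟨Nat.pair s x, ?_⟩
    rw [Option.mem_def] at hs
    simpa [hs] using hx

/-- Unbounded search terminates by `h`. -/
theorem computable_of_find {θ : ℕ → ℕ} (hθ : Primrec θ) (h : ∀ K, ∃ y, K ≤ θ y) :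
    Computable fun K => Nat.find (h K) := by
  have hp : Primrec₂ fun K y : ℕ => decide (K ≤ θ y) :=
    (Primrec.nat_le.comp₂ Primrec₂.left (hθ.comp₂ Primrec₂.right)).decide
  have := Partrec.rfind (p := fun K y => Part.some (decide (K ≤ θ y))) hp.to_comp
  refine this.of_eq fun K => ?_
  rw [PFun.coe_val, Part.eq_some_iff]
  refine Nat.mem_rfind.2 ⟨?_, ?_⟩
  · simpa using Nat.find_spec (h K)
  · intro y hy
    simpa using Nat.find_min (h K) hy

/-- For a computable monotone unbounded function `ι`, an expression that certifies lower bounds on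
the values of `ι`, and the computable amount of resources that it needs. -/
theorem exists_certifier {ι : ℕ → ℕ} (hι : Computable ι) (hm : Monotone ι)
    (ht : Filter.Tendsto ι Filter.atTop Filter.atTop) :
    ∃ (e : Ex) (T : ℕ → ℕ), Computable T ∧ (∀ m B y K, K < e.eval m B [y] → K ≤ ι y) ∧
      ∀ K, ∃ y ≤ T K, ∀ m B, T K ≤ B → K < e.eval m B [y] := by
  obtain ⟨θ, h1, h2, h3⟩ := exists_primrec_le hι hm ht
  obtain ⟨e, β, he, hβ⟩ := exists_approximates (Primrec.nat_iff.1 h1)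
  have hf := computable_of_find h1 h3
  -- The first summand makes room for a witness `y`, the second for the evaluation of `e` at it. A
  -- successful evaluation gives `θ y + 1`, which explains the strict inequalities.
  refine ⟨e, fun K => Nat.find (h3 K) + β (Nat.find (h3 K)), ?_, fun m B y K h => ?_,
    fun K => ⟨Nat.find (h3 K), Nat.le_add_right _ _, fun m B hB => ?_⟩⟩
  · exact Primrec.nat_add.to_comp.comp hf ((Primrec.nat_iff.2 hβ).to_comp.comp hf)
  · have := (he m B y).1
    have := h2 y
    omega
  · rw [(he m B _).2 ((Nat.le_add_left _ _).trans hB)]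
    exact Nat.lt_succ_of_le (Nat.find_spec (h3 K))

end RAM

/-! ### Digits and Reed–Solomon codes -/

theorem eq_of_digits_eq {q r u v : ℕ} (hu : u < q ^ r) (hv : v < q ^ r)
    (h : ∀ l < r, u / q ^ l % q = v / q ^ l % q) : u = v := by
  induction r generalizing u v with
  | zero => simp at hu hv; omega
  | succ r ih =>
    have h0 : u % q = v % q := by simpa using h 0 (by omega)
    have h1 : u / q = v / q := by
      refine ih (Nat.div_lt_of_lt_mul (by rwa [← pow_succ'])) (Nat.div_lt_of_lt_mul
        (by rwa [← pow_succ'])) fun l hl => ?_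
      rw [Nat.div_div_eq_div_mul, Nat.div_div_eq_div_mul, ← pow_succ']
      exact h _ (by omega)
    rw [← Nat.div_add_mod u q, ← Nat.div_add_mod v q, h0, h1]

theorem exists_digits {Q n : ℕ} {d : ℕ → ℕ} (h : ∀ l < n, d l < Q) :
    ∃ w < Q ^ n, ∀ l < n, w / Q ^ l % Q = d l := by
  induction n generalizing d with
  | zero => exact ⟨0, by simp, by simp⟩
  | succ n ih =>
    obtain ⟨w, hw, hd⟩ := ih (d := fun l => d (l + 1)) fun l hl => h _ (by omega)
    have h0 := h 0 (by omega)
    have hdiv : (Q * w + d 0) / Q = w := by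
      rw [Nat.mul_add_div (by omega), Nat.div_eq_of_lt h0, add_zero]
    refine ⟨Q * w + d 0, ?_, fun l hl => ?_⟩
    · calc Q * w + d 0 < Q * w + Q := by omega
        _ = Q * (w + 1) := by ring
        _ ≤ Q * Q ^ n := Nat.mul_le_mul_left _ hw
        _ = Q ^ (n + 1) := (pow_succ' _ _).symm
    · cases l with
      | zero => simp [Nat.mod_eq_of_lt h0]
      | succ l =>
        rw [pow_succ', ← Nat.div_div_eq_div_mul, hdiv]
        exact hd l (by omega)

/-- The symbol at position `j` of the Reed–Solomon codeword for `v`, whose message consists of the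
`r` lowest digits of `v` in base `q`. -/
def codeword (q r v j : ℕ) : ℕ := (∑ l ∈ Finset.range r, v / q ^ l % q * j ^ l) % q

theorem codeword_lt {q : ℕ} (hq : 0 < q) (r v j : ℕ) : codeword q r v j < q := Nat.mod_lt _ hq

/-- Each agreement is a root of the difference of the two message polynomials. This difference is
nonzero, since `u` and `v` differ in some digit, and has degree at most `r`. -/
theorem card_codeword_eq_le {q r u v : ℕ} (hq : q.Prime) (hu : u < q ^ r) (hv : v < q ^ r)
    (huv : u ≠ v) :
    ((Finset.range q).filter fun j => codeword q r u j = codeword q r v j).card ≤ r := by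
  open Polynomial in
  have := Fact.mk hq
  let p : (ZMod q)[X] := ∑ l ∈ Finset.range r,
    C (((u / q ^ l % q : ℕ) : ZMod q) - ((v / q ^ l % q : ℕ) : ZMod q)) * X ^ l
  have hp : p ≠ 0 := by
    intro hp
    refine huv (eq_of_digits_eq hu hv fun l hl => ?_)
    have h1 : p.coeff l = ((u / q ^ l % q : ℕ) : ZMod q) - ((v / q ^ l % q : ℕ) : ZMod q) := by
      simp only [p, Polynomial.finsetSum_coeff, Polynomial.coeff_C_mul_X_pow]
      rw [Finset.sum_ite_eq, if_pos (Finset.mem_range.2 hl)]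
    rw [hp, Polynomial.coeff_zero, eq_comm, sub_eq_zero, ZMod.natCast_eq_natCast_iff'] at h1
    simpa using h1
  have hdeg : p.natDegree ≤ r := by
    refine Polynomial.natDegree_sum_le_of_forall_le _ _ fun l hl => ?_
    exact (Polynomial.natDegree_C_mul_X_pow_le _ _).trans (Finset.mem_range.1 hl).le
  refine le_trans ?_ (hdeg)
  refine le_trans ?_ (p.card_roots')
  refine le_trans ?_ (Multiset.toFinset_card_le _)
  refine Finset.card_le_card_of_injOn (fun j => (j : ZMod q)) (fun j hj => ?_) ?_
  · simp only [Finset.coe_filter, Finset.mem_range, Set.mem_ofPred_eq] at hj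
    simp only [Finset.mem_coe, Multiset.mem_toFinset, Polynomial.mem_roots hp,
      Polynomial.IsRoot.def]
    have h2 := (ZMod.natCast_eq_natCast_iff' _ _ _).2 hj.2
    push_cast at h2
    simp only [p, Polynomial.eval_finsetSum, Polynomial.eval_mul, Polynomial.eval_C,
      Polynomial.eval_pow, Polynomial.eval_X, sub_mul, Finset.sum_sub_distrib]
    rw [sub_eq_zero]
    exact_mod_cast h2
  · intro i hi j hj hij
    simp only [Finset.coe_filter, Finset.mem_range, Set.mem_ofPred_eq] at hi hj
    have := (ZMod.natCast_eq_natCast_iff' _ _ _).1 hij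
    rwa [Nat.mod_eq_of_lt hi.1, Nat.mod_eq_of_lt hj.1] at this

/-! ### The gap instance -/

/-- The parameters of the reduction from the problem of finding a `k`-clique in a graph with the
vertices below `N` and the adjacency relation `A`: the order `q` of the field, the bound `M` on the
average number of candidates, and the length `r` of the messages. -/
structure Gap where
  N : ℕ
  k : ℕ
  q : ℕ
  M : ℕ
  r : ℕ
  A : ℕ → ℕ → Prop

namespace Gap

variable (g : Gap)

/-- The number of pairs of a column and a test for it. -/
def Q : ℕ := g.q ^ g.k * (g.k * g.k)

/-- The number of lists of `2 * M` columns with tests. -/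
def W : ℕ := g.Q ^ (2 * g.M)

/-- There is a set for each copy `t < q` and each pair of vertices, and one for each position
`j < q` and each possible column of `k` symbols. -/
def numSets : ℕ := g.q * (g.N * g.N) + g.q * g.q ^ g.k

/-- There is an element for each position, each copy, and each list of columns with tests. -/
def numElems : ℕ := g.q * g.q * g.W

/-- The test that `x` encodes at position `j`, for the pair `(u, v)`: the code symbols are the ones
of the column, and the pair is an edge unless both positions are the same. -/
def Passes (j u v x : ℕ) : Prop :=
  codeword g.q g.r u j = x / (g.k * g.k) / g.q ^ (x % (g.k * g.k) / g.k) % g.q ∧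
  codeword g.q g.r v j = x / (g.k * g.k) / g.q ^ (x % (g.k * g.k) % g.k) % g.q ∧
  (x % (g.k * g.k) / g.k = x % (g.k * g.k) % g.k ∨ g.A u v)

/-- The numbers code tuples: `e = (j * q + t) * W + w` for position `j`, copy `t` and list `w`,
whose entries are the digits to the base `Q`. A set `s` is either `t * N² + (u * N + v)`, or `q * N²
+ (j * q ^ k + b)` with a column `b`. -/
def Covers (s e : ℕ) : Prop :=
  if s < g.q * (g.N * g.N) then
    s / (g.N * g.N) = e / g.W % g.q ∧ ∃ l < 2 * g.M,
      g.Passes (e / g.W / g.q) (s % (g.N * g.N) / g.N) (s % (g.N * g.N) % g.N)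
        (e % g.W / g.Q ^ l % g.Q)
  else
    (s - g.q * (g.N * g.N)) / g.q ^ g.k = e / g.W / g.q ∧ ∀ l < 2 * g.M,
      e % g.W / g.Q ^ l % g.Q / (g.k * g.k) ≠ (s - g.q * (g.N * g.N)) % g.q ^ g.k

/-- The vertices `c i` for `i < k` form a clique. -/
def IsClique (c : ℕ → ℕ) : Prop :=
  (∀ i < g.k, c i < g.N) ∧ ∀ i < g.k, ∀ j < g.k, i ≠ j → g.A (c i) (c j)

variable {g}

/-- Take all pairs of clique vertices in all copies, and at each position the column of their code
symbols: `q * k²` and `q` sets. -/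
theorem exists_cover (hq : 0 < g.q) {c : ℕ → ℕ} (hc : g.IsClique c) :
    ∃ C : Finset ℕ, C ⊆ Finset.range g.numSets ∧ (∀ e < g.numElems, ∃ s ∈ C, g.Covers s e) ∧
      C.card ≤ g.q * (g.k * g.k + 1) := by
  classical
  have hqk : 0 < g.q ^ g.k := Nat.pow_pos hq
  have hb : ∀ j, ∃ b < g.q ^ g.k, ∀ i < g.k, b / g.q ^ i % g.q = codeword g.q g.r (c i) j :=
    fun j => exists_digits fun i _ => codeword_lt hq _ _ _
  choose b hb hb' using hb
  let C₁ := (Finset.range g.q ×ˢ (Finset.range g.k ×ˢ Finset.range g.k)).image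
    fun x => x.1 * (g.N * g.N) + (c x.2.1 * g.N + c x.2.2)
  let C₂ := (Finset.range g.q).image fun j => g.q * (g.N * g.N) + (j * g.q ^ g.k + b j)
  have hpair : ∀ i < g.k, ∀ i' < g.k, c i * g.N + c i' < g.N * g.N := by
    intro i hi i' hi'
    have h1 := hc.1 i hi
    have h2 := hc.1 i' hi'
    nlinarith
  have hlt : ∀ {x n y m : ℕ}, x < n → y < m → x * m + y < n * m := by
    intro x n y m h1 h2
    nlinarith
  refine ⟨C₁ ∪ C₂, ?_, ?_, ?_⟩
  · intro s hs
    rw [Finset.mem_range, numSets]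
    rcases Finset.mem_union.1 hs with hs | hs
    · obtain ⟨⟨t, i, i'⟩, hx, rfl⟩ := Finset.mem_image.1 hs
      simp only [Finset.mem_product, Finset.mem_range] at hx
      have := hlt hx.1 (hpair i hx.2.1 i' hx.2.2)
      dsimp only
      omega
    · obtain ⟨j, hj, rfl⟩ := Finset.mem_image.1 hs
      have := hlt (Finset.mem_range.1 hj) (hb j)
      omega
  · intro e he
    have hW : 0 < g.W := by
      rcases Nat.eq_zero_or_pos g.W with h | h
      · simp [numElems, h] at he
      · exact h
    have hj : e / g.W / g.q < g.q := by
      rw [Nat.div_div_eq_div_mul]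
      exact Nat.div_lt_of_lt_mul (by rw [numElems] at he; convert he using 1; ring)
    have ht : e / g.W % g.q < g.q := Nat.mod_lt _ hq
    -- If the true column is on the list, then the clique vertices that its test names pass it; if
    -- not, then the column itself covers `e`.
    by_cases h : ∃ l < 2 * g.M, e % g.W / g.Q ^ l % g.Q / (g.k * g.k) = b (e / g.W / g.q)
    · obtain ⟨l, hl, hx⟩ := h
      set x := e % g.W / g.Q ^ l % g.Q with hx0
      -- For `k = 0` there are no tests, and `W = 0 ^ (2 * M) = 0` leaves no elements.
      have hk : 0 < g.k := by
        rcases Nat.eq_zero_or_pos g.k with h | h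
        · rw [W, Q, h] at hW
          simp [show g.M ≠ 0 by omega] at hW
        · exact h
      have hi : x % (g.k * g.k) / g.k < g.k :=
        Nat.div_lt_of_lt_mul (Nat.mod_lt _ (Nat.mul_pos hk hk))
      have hi' : x % (g.k * g.k) % g.k < g.k := Nat.mod_lt _ hk
      set i := x % (g.k * g.k) / g.k with hidef
      set i' := x % (g.k * g.k) % g.k with hidef'
      have hp := hpair i hi i' hi'
      refine ⟨e / g.W % g.q * (g.N * g.N) + (c i * g.N + c i'), Finset.mem_union_left _
        (Finset.mem_image.2 ⟨⟨e / g.W % g.q, i, i'⟩, by simp [hi, hi', ht], rfl⟩), ?_⟩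
      rw [Covers, if_pos (hlt ht hp)]
      have h1 : (e / g.W % g.q * (g.N * g.N) + (c i * g.N + c i')) / (g.N * g.N) =
          e / g.W % g.q := by
        rw [mul_comm, Nat.mul_add_div (by omega), Nat.div_eq_of_lt hp, add_zero]
      have h2 : (e / g.W % g.q * (g.N * g.N) + (c i * g.N + c i')) % (g.N * g.N) =
          c i * g.N + c i' := by
        rw [Nat.mul_add_mod', Nat.mod_eq_of_lt hp]
      have hN := hc.1 i' hi'
      refine ⟨h1, l, hl, ?_⟩
      rw [h2, ← hx0, Passes, ← hidef, ← hidef', hx, hb' _ i hi, hb' _ i' hi', mul_comm (c i),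
        Nat.mul_add_div (by omega), Nat.div_eq_of_lt hN, add_zero, Nat.mul_add_mod,
        Nat.mod_eq_of_lt hN]
      refine ⟨rfl, rfl, ?_⟩
      by_cases hii : i = i'
      · exact .inl hii
      · exact .inr (hc.2 i hi i' hi' hii)
    · push Not at h
      refine ⟨g.q * (g.N * g.N) + (e / g.W / g.q * g.q ^ g.k + b (e / g.W / g.q)),
        Finset.mem_union_right _ (Finset.mem_image.2 ⟨_, Finset.mem_range.2 hj, rfl⟩), ?_⟩
      rw [Covers, if_neg (by omega), Nat.add_sub_cancel_left]
      refine ⟨?_, fun l hl => ?_⟩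
      · rw [mul_comm, Nat.mul_add_div hqk, Nat.div_eq_of_lt (hb _), add_zero]
      · rw [Nat.mul_add_mod', Nat.mod_eq_of_lt (hb _)]
        exact h l hl
  · have h1 : C₁.card ≤ g.q * (g.k * g.k) := Finset.card_image_le.trans (by simp)
    have h2 : C₂.card ≤ g.q := Finset.card_image_le.trans (by simp)
    have := Finset.card_union_le C₁ C₂
    rw [mul_add, mul_one]
    omega

/-- If there is no clique, an uncovered element can be built from a cheap copy and a good position.
The hypothesis `hN` makes the encoding injective, and `hM` makes collisions of code symbols rare. -/
theorem exists_isClique (hq : g.q.Prime) (hN : g.N ≤ g.q ^ g.r)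
    (hM : 8 * (g.M * g.M) * g.r ≤ g.q) {C : Finset ℕ}
    (hcov : ∀ e < g.numElems, ∃ s ∈ C, g.Covers s e) (hcard : C.card ≤ g.q * g.M) :
    ∃ c, g.IsClique c := by
  classical
  by_contra hno
  have hq0 := hq.pos
  have hqk : 0 < g.q ^ g.k := Nat.pow_pos hq0
  let X : ℕ → Finset ℕ := fun t => C.filter fun s => s < g.q * (g.N * g.N) ∧ s / (g.N * g.N) = t
  let L : ℕ → Finset ℕ := fun j =>
    C.filter fun s => ¬ s < g.q * (g.N * g.N) ∧ (s - g.q * (g.N * g.N)) / g.q ^ g.k = j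
  have hX : ∑ t ∈ Finset.range g.q, (X t).card ≤ g.q * g.M := by
    rw [← Finset.card_biUnion]
    · exact (Finset.card_le_card (Finset.biUnion_subset.2 fun t _ => Finset.filter_subset _ _)).trans
        hcard
    · intro t _ t' _ htt
      change Disjoint (X t) (X t')
      rw [Finset.disjoint_left]
      intro s hs hs'
      exact htt ((Finset.mem_filter.1 hs).2.2.symm.trans (Finset.mem_filter.1 hs').2.2)
  have hL : ∑ j ∈ Finset.range g.q, (L j).card ≤ g.q * g.M := by
    rw [← Finset.card_biUnion]
    · exact (Finset.card_le_card (Finset.biUnion_subset.2 fun t _ => Finset.filter_subset _ _)).trans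
        hcard
    · intro t _ t' _ htt
      change Disjoint (L t) (L t')
      rw [Finset.disjoint_left]
      intro s hs hs'
      exact htt ((Finset.mem_filter.1 hs).2.2.symm.trans (Finset.mem_filter.1 hs').2.2)
  obtain ⟨t, ht, hXt⟩ : ∃ t < g.q, (X t).card ≤ g.M := by
    by_contra! h
    have : ∑ t ∈ Finset.range g.q, (g.M + 1) ≤ ∑ t ∈ Finset.range g.q, (X t).card :=
      Finset.sum_le_sum fun t ht => h t (Finset.mem_range.1 ht)
    simp at this
    nlinarith
  let fst : ℕ → ℕ := fun s => s % (g.N * g.N) / g.N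
  let snd : ℕ → ℕ := fun s => s % (g.N * g.N) % g.N
  have hfst : ∀ s ∈ X t, fst s < g.N ∧ snd s < g.N := by
    intro s hs
    have h1 := (Finset.mem_filter.1 hs).2.1
    have hN0 : 0 < g.N := by
      rcases Nat.eq_zero_or_pos g.N with h | h
      · simp [h] at h1
      · exact h
    exact ⟨Nat.div_lt_of_lt_mul (Nat.mod_lt _ (Nat.mul_pos hN0 hN0)), Nat.mod_lt _ hN0⟩
  let Z := (X t).image fst ∪ (X t).image snd
  have hZN : ∀ z ∈ Z, z < g.N := by
    intro z hz
    rcases Finset.mem_union.1 hz with hz | hz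
    · obtain ⟨s, hs, rfl⟩ := Finset.mem_image.1 hz
      exact (hfst s hs).1
    · obtain ⟨s, hs, rfl⟩ := Finset.mem_image.1 hz
      exact (hfst s hs).2
  have hZ : Z.card ≤ 2 * g.M := by
    have h1 : ((X t).image fst).card ≤ (X t).card := Finset.card_image_le
    have h2 : ((X t).image snd).card ≤ (X t).card := Finset.card_image_le
    have h3 : Z.card ≤ _ := Finset.card_union_le ((X t).image fst) ((X t).image snd)
    omega
  -- Positions with too many chosen columns are fewer than half by Markov's inequality. Positions
  -- where two vertices of `Z` collide number at most `(2 * M)² * r ≤ q / 2`. So some position is in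
  -- neither set.
  let bad₁ := (Finset.range g.q).filter fun j => 2 * g.M < (L j).card
  let bad₂ := Z.offDiag.biUnion fun z => (Finset.range g.q).filter fun j =>
    codeword g.q g.r z.1 j = codeword g.q g.r z.2 j
  have hbad₁ : bad₁.card * (2 * g.M + 1) ≤ g.q * g.M := by
    calc bad₁.card * (2 * g.M + 1) = ∑ j ∈ bad₁, (2 * g.M + 1) := by simp
      _ ≤ ∑ j ∈ bad₁, (L j).card :=
          Finset.sum_le_sum fun j hj => (Finset.mem_filter.1 hj).2
      _ ≤ ∑ j ∈ Finset.range g.q, (L j).card :=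
          Finset.sum_le_sum_of_subset (Finset.filter_subset _ _)
      _ ≤ _ := hL
  have hbad₂ : bad₂.card ≤ 4 * (g.M * g.M) * g.r := by
    calc bad₂.card ≤ Z.offDiag.card * g.r := by
          refine Finset.card_biUnion_le_card_mul _ _ _ fun z hz => ?_
          rw [Finset.mem_offDiag] at hz
          exact card_codeword_eq_le hq ((hZN _ hz.1).trans_le hN) ((hZN _ hz.2.1).trans_le hN)
            hz.2.2
      _ ≤ _ := by
          refine Nat.mul_le_mul_right _ ?_
          rw [Finset.offDiag_card]
          calc Z.card * Z.card - Z.card ≤ Z.card * Z.card := Nat.sub_le _ _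
            _ ≤ (2 * g.M) * (2 * g.M) := Nat.mul_le_mul hZ hZ
            _ = _ := by ring
  obtain ⟨j, hj, hLj, hinj⟩ : ∃ j < g.q, (L j).card ≤ 2 * g.M ∧ ∀ u ∈ Z, ∀ v ∈ Z,
      codeword g.q g.r u j = codeword g.q g.r v j → u = v := by
    have hlt : (bad₁ ∪ bad₂).card < (Finset.range g.q).card := by
      rw [Finset.card_range]
      refine (Finset.card_union_le _ _).trans_lt ?_
      by_contra! h
      have h8 : 2 * (4 * (g.M * g.M) * g.r) ≤ g.q := by
        calc _ = 8 * (g.M * g.M) * g.r := by ring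
          _ ≤ _ := hM
      have : g.q ≤ 2 * bad₁.card := by omega
      nlinarith
    obtain ⟨j, hj, hj'⟩ := Finset.exists_mem_notMem_of_card_lt_card hlt
    rw [Finset.mem_union, not_or] at hj'
    refine ⟨j, Finset.mem_range.1 hj, ?_, fun u hu v hv huv => ?_⟩
    · by_contra! h
      exact hj'.1 (Finset.mem_filter.2 ⟨hj, h⟩)
    · by_contra h
      exact hj'.2 (Finset.mem_biUnion.2 ⟨(u, v), Finset.mem_offDiag.2 ⟨hu, hv, h⟩,
        Finset.mem_filter.2 ⟨hj, huv⟩⟩)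
  have hbad : ∀ b, ∃ i < g.k, ∃ i' < g.k, ∀ s ∈ X t,
      ¬ (codeword g.q g.r (fst s) j = b / g.q ^ i % g.q ∧
        codeword g.q g.r (snd s) j = b / g.q ^ i' % g.q ∧ (i = i' ∨ g.A (fst s) (snd s))) := by
    intro b
    by_contra! h
    -- The diagonal tests `(i, i)` decode the entries of the column into vertices of `Z`. As the
    -- symbols at `j` determine the vertices of `Z`, the remaining tests show that the decoded
    -- vertices are pairwise adjacent.
    have h' : ∀ i, ∃ c, i < g.k → c ∈ Z ∧ codeword g.q g.r c j = b / g.q ^ i % g.q := by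
      intro i
      by_cases hi : i < g.k
      · obtain ⟨s, hs, h1, -⟩ := h i hi i hi
        exact ⟨fst s, fun _ => ⟨Finset.mem_union_left _ (Finset.mem_image_of_mem _ hs), h1⟩⟩
      · exact ⟨0, fun h => absurd h hi⟩
    choose c hc using h'
    refine hno ⟨c, fun i hi => hZN _ (hc i hi).1, fun i hi i' hi' hii => ?_⟩
    obtain ⟨s, hs, h1, h2, h3⟩ := h i hi i' hi'
    have e1 : fst s = c i := hinj _ (Finset.mem_union_left _ (Finset.mem_image_of_mem _ hs)) _
      (hc i hi).1 (h1.trans (hc i hi).2.symm)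
    have e2 : snd s = c i' := hinj _ (Finset.mem_union_right _ (Finset.mem_image_of_mem _ hs)) _
      (hc i' hi').1 (h2.trans (hc i' hi').2.symm)
    rw [← e1, ← e2]
    exact h3.resolve_left hii
  choose I hI I' hI' hbad using hbad
  have hk : 0 < g.k := by have := hI 0; omega
  let bs := (L j).image fun s => (s - g.q * (g.N * g.N)) % g.q ^ g.k
  have hbs : bs.card ≤ 2 * g.M := Finset.card_image_le.trans hLj
  -- The list is padded to length `2 * M` by the column 0. This is harmless, because `hbad` provides
  -- a failing test for every column, chosen or not.
  let col : ℕ → ℕ := fun l => bs.toList.getD l 0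
  have hcol : ∀ l, col l < g.q ^ g.k := by
    intro l
    by_cases hl : l < bs.toList.length
    · have : col l ∈ bs := by
        rw [← Finset.mem_toList]
        simp only [col, List.getD_eq_getElem _ _ hl]
        exact List.getElem_mem hl
      obtain ⟨s, -, hs⟩ := Finset.mem_image.1 this
      rw [← hs]
      exact Nat.mod_lt _ hqk
    · simp only [col, List.getD_eq_default _ _ (not_lt.1 hl)]
      exact hqk
  have htest : ∀ b, I b * g.k + I' b < g.k * g.k := by
    intro b
    have h1 := hI b
    have h2 := hI' b
    nlinarith
  -- The uncovered element: it lists every column chosen at position `j`, each with a test that no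
  -- pair in copy `t` passes.
  obtain ⟨w, hw, hdig⟩ := exists_digits (Q := g.Q) (n := 2 * g.M)
    (d := fun l => col l * (g.k * g.k) + (I (col l) * g.k + I' (col l))) (by
      intro l _
      have h1 := hcol l
      have h2 := htest (col l)
      rw [Q]
      nlinarith)
  have hW : w < g.W := hw
  have he : (j * g.q + t) * g.W + w < g.numElems := by
    rw [numElems]
    have : j * g.q + t < g.q * g.q := by nlinarith
    nlinarith
  obtain ⟨s, hs, hse⟩ := hcov _ he
  have e1 : ((j * g.q + t) * g.W + w) % g.W = w := by
    rw [Nat.mul_add_mod', Nat.mod_eq_of_lt hW]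
  have e2 : ((j * g.q + t) * g.W + w) / g.W = j * g.q + t := by
    rw [mul_comm, Nat.mul_add_div (by omega), Nat.div_eq_of_lt hW, add_zero]
  have e3 : (j * g.q + t) % g.q = t := by rw [Nat.mul_add_mod', Nat.mod_eq_of_lt ht]
  have e4 : (j * g.q + t) / g.q = j := by
    rw [mul_comm, Nat.mul_add_div hq0, Nat.div_eq_of_lt ht, add_zero]
  have hkk := Nat.mul_pos hk hk
  have hcolumn : ∀ l < 2 * g.M, w / g.Q ^ l % g.Q / (g.k * g.k) = col l := by
    intro l hl
    rw [hdig l hl, mul_comm, Nat.mul_add_div hkk, Nat.div_eq_of_lt (htest _), add_zero]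
  have htests : ∀ l < 2 * g.M, w / g.Q ^ l % g.Q % (g.k * g.k) =
      I (col l) * g.k + I' (col l) := by
    intro l hl
    rw [hdig l hl, Nat.mul_add_mod', Nat.mod_eq_of_lt (htest _)]
  rw [Covers, e1, e2, e3, e4] at hse
  split_ifs at hse with hsN
  · obtain ⟨h1, l, hl, hpass⟩ := hse
    rw [Passes, hcolumn l hl, htests l hl, Nat.mul_add_mod', Nat.mod_eq_of_lt (hI' _),
      mul_comm (I _), Nat.mul_add_div hk, Nat.div_eq_of_lt (hI' _), add_zero] at hpass
    exact hbad (col l) s (Finset.mem_filter.2 ⟨hs, hsN, h1⟩) hpass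
  · obtain ⟨h1, h2⟩ := hse
    have hmem : (s - g.q * (g.N * g.N)) % g.q ^ g.k ∈ bs :=
      Finset.mem_image_of_mem _ (Finset.mem_filter.2 ⟨hs, hsN, h1⟩)
    rw [← Finset.mem_toList, List.mem_iff_getElem] at hmem
    obtain ⟨l, hl, hls⟩ := hmem
    have hl2 : l < 2 * g.M := by
      rw [Finset.length_toList] at hl
      omega
    refine h2 l hl2 ?_
    rw [hcolumn l hl2, ← hls]
    exact List.getD_eq_getElem _ _ hl

end Gap

/-! ### The parameters of the reduction and the arithmetic bounds they require -/

/-- The integral part of `log N / log log N`, for logarithms to base two. -/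
def ell (N : ℕ) : ℕ := Nat.log 2 N / Nat.log 2 (Nat.log 2 N)

namespace Gap

/-- The reduction with the parameters that it needs on graphs with `N` vertices. -/
noncomputable def of (N k : ℕ) (A : ℕ → ℕ → Prop) : Gap where
  N := N
  k := k
  M := ell N / (k * k + 1)
  r := 4 * ell N
  q := RAM.leastPrime (8 * (ell N / (k * k + 1) * (ell N / (k * k + 1))) * (4 * ell N))
  A := A

/-- The memory `m` holds the graph, and the bound `B` suffices for the arithmetic in the
reduction. -/
structure Fits (g : Gap) (m : ℕ → ℕ) (B : ℕ) : Prop where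
  memN : m 0 = g.N
  memk : m 1 = g.k
  memA : ∀ u < g.N, ∀ v < g.N, m (2 + u * g.N + v) ≠ 0 ↔ g.A u v
  M_eq : g.M = ell g.N / (g.k * g.k + 1)
  r_eq : g.r = 4 * ell g.N
  q_eq : g.q = RAM.leastPrime (8 * (g.M * g.M) * g.r)
  one_le_k : 1 ≤ g.k
  q_arg_ne : 8 * (g.M * g.M) * g.r ≠ 0
  q_arg_le : 2 * (8 * (g.M * g.M) * g.r) ≤ B
  N_le : g.N * g.N ≤ B
  k_le : g.k * g.k + 1 ≤ B
  q_le : g.q ≤ B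
  qk_le : g.q ^ g.k ≤ B
  Q_le : g.Q ≤ B
  W_le : g.W ≤ B
  M_le : 2 * g.M ≤ B
  r_le : g.r ≤ B
  qr_le : g.q ^ g.r ≤ B
  sum_le : g.r * (g.q * g.q ^ g.r) ≤ B
  numSets_le : g.numSets ≤ B
  numElems_le : g.numElems ≤ B
  table_le : 3 + g.numSets * g.numElems ≤ B

namespace Fits

variable {g : Gap} {m : ℕ → ℕ} {B : ℕ}

theorem q_pos (h : g.Fits m B) : 0 < g.q := h.q_eq ▸ (RAM.prime_leastPrime _).pos

theorem Q_pos (h : g.Fits m B) : 0 < g.Q :=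
  Nat.mul_pos (Nat.pow_pos h.q_pos) (Nat.mul_pos h.one_le_k h.one_le_k)

theorem N_le' (h : g.Fits m B) : g.N ≤ B := (Nat.le_mul_self _).trans h.N_le

theorem k_le' (h : g.Fits m B) : g.k ≤ B := by
  have := h.k_le
  have := Nat.le_mul_self g.k
  omega

end Fits
end Gap

namespace RAM
namespace Ex

variable {m : ℕ → ℕ} {B : ℕ} {env : List ℕ} {g : Gap}

/-! ### The parameters -/

def theN : Ex := mem (const 0)

def theK : Ex := mem (const 1)

def theEll : Ex := div (log theN) (log (log theN))

def theM : Ex := div theEll (add (mul theK theK) (const 1))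

def theR : Ex := mul (const 4) theEll

def theq : Ex := primeGe (mul (mul (const 8) (mul theM theM)) theR)

def theQ : Ex := mul (pow theq theK) (mul theK theK)

def theW : Ex := pow theQ (mul (const 2) theM)

def theNN : Ex := mul theN theN

def theNumSets : Ex := add (mul theq theNN) (mul theq (pow theq theK))

def theNumElems : Ex := mul (mul theq theq) theW

theorem eval_theN (h : g.Fits m B) : theN.eval m B env = g.N := h.memN

theorem eval_theK (h : g.Fits m B) : theK.eval m B env = g.k := h.memk

theorem eval_theEll_of_le {N : ℕ} (h0 : m 0 = N) (hN : N ≤ B) :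
    theEll.eval m B env = ell N := by
  have hN' : theN.eval m B env = N := h0
  have h1 : (log theN).eval m B env = Nat.log 2 N := by
    rw [eval_log (by rwa [hN']), hN']
  have h2 : Nat.log 2 N ≤ N := Nat.log_le_self 2 N
  have h3 : (log (log theN)).eval m B env = Nat.log 2 (Nat.log 2 N) := by
    rw [eval_log (by rw [h1]; omega), h1]
  have h4 := Nat.log_le_self 2 (Nat.log 2 N)
  rw [theEll, eval_div (by rw [h1]; omega) (by rw [h3]; omega), h1, h3, ell]

theorem eval_theEll (h : g.Fits m B) : theEll.eval m B env = ell g.N :=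
  eval_theEll_of_le h.memN h.N_le'

theorem ell_le (N : ℕ) : ell N ≤ N := (Nat.div_le_self _ _).trans (Nat.log_le_self 2 N)

theorem eval_theKK (h : g.Fits m B) : (mul theK theK).eval m B env = g.k * g.k := by
  rw [eval_mul (by rw [eval_theK h]; exact h.k_le'), eval_theK h]

theorem eval_theM (h : g.Fits m B) : theM.eval m B env = g.M := by
  have h1 : (add (mul theK theK) (const 1)).eval m B env = g.k * g.k + 1 := by
    rw [eval_add, eval_theKK h]; rfl
  rw [theM, eval_div, h1, eval_theEll h, h.M_eq]
  · rw [eval_theEll h]; exact (ell_le _).trans h.N_le'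
  · rw [h1]; exact h.k_le

theorem eval_theR (h : g.Fits m B) : theR.eval m B env = g.r := by
  rw [theR, eval_mul, eval_theEll h, h.r_eq]
  · rfl
  · rw [eval_theEll h]; exact (ell_le _).trans h.N_le'

theorem eval_theq (h : g.Fits m B) : theq.eval m B env = g.q := by
  have hM := h.M_le
  have h1 : (mul theM theM).eval m B env = g.M * g.M := by
    rw [eval_mul, eval_theM h]
    rw [eval_theM h]; omega
  have hr : 1 ≤ g.r := Nat.one_le_iff_ne_zero.2 (right_ne_zero_of_mul h.q_arg_ne)
  have h2 : (mul (const 8) (mul theM theM)).eval m B env = 8 * (g.M * g.M) := by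
    rw [eval_mul, h1]
    · rfl
    · rw [h1]
      have := h.q_arg_le
      nlinarith
  have h3 : (mul (mul (const 8) (mul theM theM)) theR).eval m B env =
      8 * (g.M * g.M) * g.r := by
    rw [eval_mul, h2, eval_theR h]
    rw [eval_theR h]; exact h.r_le
  rw [theq, eval_primeGe, h3, h.q_eq]
  · rw [h3]; exact h.q_arg_le
  · rw [h3]; exact h.q_arg_ne

theorem eval_theqk (h : g.Fits m B) : (pow theq theK).eval m B env = g.q ^ g.k := by
  rw [eval_pow, eval_theq h, eval_theK h]
  · rw [eval_theq h]; exact h.q_le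
  · rw [eval_theK h]; exact h.k_le'

theorem eval_theQ (h : g.Fits m B) : theQ.eval m B env = g.Q := by
  have := h.k_le
  rw [theQ, eval_mul, eval_theqk h, eval_theKK h, Gap.Q]
  rw [eval_theKK h]; omega

theorem eval_theTwoM (h : g.Fits m B) : (mul (const 2) theM).eval m B env = 2 * g.M := by
  have := h.M_le
  rw [eval_mul, eval_theM h]
  · rfl
  · rw [eval_theM h]; omega

theorem eval_theW (h : g.Fits m B) : theW.eval m B env = g.W := by
  rw [theW, eval_pow, eval_theQ h, eval_theTwoM h, Gap.W]
  · rw [eval_theQ h]; exact h.Q_le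
  · rw [eval_theTwoM h]; exact h.M_le

theorem eval_theNN (h : g.Fits m B) : theNN.eval m B env = g.N * g.N := by
  rw [theNN, eval_mul, eval_theN h]
  rw [eval_theN h]; exact h.N_le'

theorem eval_theqNN (h : g.Fits m B) : (mul theq theNN).eval m B env = g.q * (g.N * g.N) := by
  rw [eval_mul, eval_theNN h, eval_theq h]
  rw [eval_theNN h]; exact h.N_le

theorem eval_theNumSets (h : g.Fits m B) : theNumSets.eval m B env = g.numSets := by
  rw [theNumSets, eval_add, eval_theqNN h, eval_mul, eval_theqk h, eval_theq h, Gap.numSets]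
  rw [eval_theqk h]; exact h.qk_le

theorem eval_theNumElems (h : g.Fits m B) : theNumElems.eval m B env = g.numElems := by
  rw [theNumElems, eval_mul, eval_theW h, eval_mul, eval_theq h, Gap.numElems]
  · rw [eval_theq h]; exact h.q_le
  · rw [eval_theW h]; exact h.W_le

/-! ### The instance -/

def codeword (v j : Ex) : Ex :=
  call (mod (sum 2 theR (mul (mod (div (var 0) (pow theq (var 3))) theq)
    (pow (var 1) (var 3)))) theq) 2 ![v, j]

theorem eval_codeword (h : g.Fits m B) {v j : Ex} (hv : v.eval m B env ≤ B)
    (hj : j.eval m B env ≤ g.q) :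
    (codeword v j).eval m B env = _root_.codeword g.q g.r (v.eval m B env) (j.eval m B env) := by
  rw [codeword, eval]
  simp only [List.ofFn_succ, List.ofFn_zero, Matrix.cons_val_zero, Matrix.cons_val_succ]
  generalize eval m B v env = x at *
  generalize eval m B j env = y at *
  have hpow : ∀ {z l}, z ≤ g.q → l < g.r → z ^ l ≤ g.q ^ g.r := fun h1 h2 =>
    (Nat.pow_le_pow_left h1 _).trans (Nat.pow_le_pow_right h.q_pos h2.le)
  have hsum : (sum 2 theR (mul (mod (div (var 0) (pow theq (var 3))) theq)
      (pow (var 1) (var 3)))).eval m B [x, y] =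
      ∑ l ∈ Finset.range g.r, x / g.q ^ l % g.q * y ^ l := by
    rw [eval_sum (k := 2) (g := fun l => x / g.q ^ l % g.q * y ^ l) rfl, eval_theR h]
    · rw [eval_theR h]; exact h.r_le
    · intro a l hl
      rw [eval_theR h] at hl
      have hl' := hl.le.trans h.r_le
      have e1 : (pow theq (var 3)).eval m B ([x, y] ++ [a, l]) = g.q ^ l := by
        rw [eval_pow, eval_theq h]
        · rfl
        · rw [eval_theq h]; exact h.q_le
        · exact hl'
      have e2 : (div (var 0) (pow theq (var 3))).eval m B ([x, y] ++ [a, l]) = x / g.q ^ l := by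
        rw [eval_div, e1]
        · rfl
        · exact hv
        · rw [e1]; exact (hpow le_rfl hl).trans h.qr_le
      have e3 : (pow (var 1) (var 3)).eval m B ([x, y] ++ [a, l]) = y ^ l := by
        rw [eval_pow]
        · rfl
        · exact hj.trans h.q_le
        · exact hl'
      rw [eval_mul, eval_mod, e2, e3, eval_theq h]
      · rw [e2]; exact (Nat.div_le_self _ _).trans hv
      · rw [eval_theq h]; exact h.q_le
      · rw [e3]; exact (hpow hj hl).trans h.qr_le
  rw [eval_mod, hsum, eval_theq h, _root_.codeword]
  · rw [hsum]
    -- The division in `mod` needs the whole sum within the bound, before it is reduced modulo `q`;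
    -- `Fits.sum_le` is meant for this.
    refine (Finset.sum_le_card_nsmul _ _ (g.q * g.q ^ g.r) fun l hl => ?_).trans
      (by simpa using h.sum_le)
    exact Nat.mul_le_mul (Nat.mod_lt _ h.q_pos).le (hpow hj (Finset.mem_range.1 hl))
  · rw [eval_theq h]; exact h.q_le

def passes (j u v x : Ex) : Ex :=
  call (and
    (eq (codeword (var 1) (var 0)) (mod (div (div (var 3) (mul theK theK))
      (pow theq (div (mod (var 3) (mul theK theK)) theK))) theq))
    (and (eq (codeword (var 2) (var 0)) (mod (div (div (var 3) (mul theK theK))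
      (pow theq (mod (mod (var 3) (mul theK theK)) theK))) theq))
      (or (eq (div (mod (var 3) (mul theK theK)) theK) (mod (mod (var 3) (mul theK theK)) theK))
        (mem (add (add (const 2) (mul (var 1) theN)) (var 2)))))) 4 ![j, u, v, x]

theorem eval_passes (h : g.Fits m B) {j u v x : Ex} (hj : j.eval m B env ≤ g.q)
    (hu : u.eval m B env < g.N) (hv : v.eval m B env < g.N) (hx : x.eval m B env ≤ B) :
    (passes j u v x).eval m B env ≠ 0 ↔
      g.Passes (j.eval m B env) (u.eval m B env) (v.eval m B env) (x.eval m B env) := by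
  rw [passes, eval]
  simp only [List.ofFn_succ, List.ofFn_zero, Matrix.cons_val_zero, Matrix.cons_val_succ]
  generalize eval m B j env = y at *
  generalize eval m B u env = a at *
  generalize eval m B v env = b at *
  generalize eval m B x env = z at *
  have hk := h.one_le_k
  have hkk := h.k_le
  have hk' := h.k_le'
  have e1 : (div (var 3) (mul theK theK)).eval m B [y, a, b, z] = z / (g.k * g.k) := by
    rw [eval_div, eval_theKK h]
    · rfl
    · exact hx
    · rw [eval_theKK h]; omega
  have e2 : (mod (var 3) (mul theK theK)).eval m B [y, a, b, z] = z % (g.k * g.k) := by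
    rw [eval_mod, eval_theKK h]
    · rfl
    · exact hx
    · rw [eval_theKK h]; omega
  have e2' : z % (g.k * g.k) ≤ B := (Nat.mod_le _ _).trans hx
  have e3 : (div (mod (var 3) (mul theK theK)) theK).eval m B [y, a, b, z] =
      z % (g.k * g.k) / g.k := by
    rw [eval_div, eval_theK h, e2]
    · rwa [e2]
    · rwa [eval_theK h]
  have e4 : (mod (mod (var 3) (mul theK theK)) theK).eval m B [y, a, b, z] =
      z % (g.k * g.k) % g.k := by
    rw [eval_mod, eval_theK h, e2]
    · rwa [e2]
    · rwa [eval_theK h]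
  have e5 : ∀ i : Ex, i.eval m B [y, a, b, z] ≤ g.k → (mod (div (div (var 3) (mul theK theK))
      (pow theq i)) theq).eval m B [y, a, b, z] =
      z / (g.k * g.k) / g.q ^ i.eval m B [y, a, b, z] % g.q := by
    intro i hi
    have hz : z / (g.k * g.k) ≤ B := (Nat.div_le_self _ _).trans hx
    have h1 : (pow theq i).eval m B [y, a, b, z] = g.q ^ i.eval m B [y, a, b, z] := by
      rw [eval_pow, eval_theq h]
      · rw [eval_theq h]; exact h.q_le
      · exact hi.trans hk'
    have h2 : (div (div (var 3) (mul theK theK)) (pow theq i)).eval m B [y, a, b, z] =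
        z / (g.k * g.k) / g.q ^ i.eval m B [y, a, b, z] := by
      rw [eval_div, e1, h1]
      · rwa [e1]
      · rw [h1]; exact (Nat.pow_le_pow_right h.q_pos hi).trans h.qk_le
    rw [eval_mod, h2, eval_theq h]
    · rw [h2]; exact (Nat.div_le_self _ _).trans hz
    · rw [eval_theq h]; exact h.q_le
  have hi : z % (g.k * g.k) / g.k ≤ g.k :=
    (Nat.div_lt_of_lt_mul (Nat.mod_lt _ (Nat.mul_pos hk hk))).le
  have hi' : z % (g.k * g.k) % g.k ≤ g.k := (Nat.mod_lt _ hk).le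
  have e6 : (mem (add (add (const 2) (mul (var 1) theN)) (var 2))).eval m B [y, a, b, z] =
      m (2 + a * g.N + b) := by
    rw [eval, eval_add, eval_add, eval_mul, eval_theN h]
    · rfl
    · rw [eval_theN h]; exact h.N_le'
  rw [eval_and, eval_and, eval_or, eval_eq, eval_eq, eval_eq, e5 _ (by rw [e3]; exact hi),
    e5 _ (by rw [e4]; exact hi'), e3, e4, e6, h.memA a hu b hv,
    eval_codeword h (v := var 1) (j := var 0) (env := [y, a, b, z]) (hu.le.trans h.N_le') hj,
    eval_codeword h (v := var 2) (j := var 0) (env := [y, a, b, z]) (hv.le.trans h.N_le') hj]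
  rfl

def covers (s e : Ex) : Ex :=
  call (ite (lt (var 0) (mul theq theNN))
    (and (eq (div (var 0) theNN) (mod (div (var 1) theW) theq))
      (some 2 (mul (const 2) theM) (passes (div (div (var 1) theW) theq)
        (div (mod (var 0) theNN) theN) (mod (mod (var 0) theNN) theN)
        (mod (div (mod (var 1) theW) (pow theQ (var 3))) theQ))))
    (and (eq (div (sub (var 0) (mul theq theNN)) (pow theq theK)) (div (div (var 1) theW) theq))
      (all 2 (mul (const 2) theM) (not (eq
        (div (mod (div (mod (var 1) theW) (pow theQ (var 3))) theQ) (mul theK theK))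
        (mod (sub (var 0) (mul theq theNN)) (pow theq theK)))))))
    2 ![s, e]

theorem eval_covers (h : g.Fits m B) {s e : Ex} (hs : s.eval m B env < g.numSets)
    (he : e.eval m B env < g.numElems) :
    (covers s e).eval m B env ≠ 0 ↔ g.Covers (s.eval m B env) (e.eval m B env) := by
  rw [covers, eval]
  simp only [List.ofFn_succ, List.ofFn_zero, Matrix.cons_val_zero, Matrix.cons_val_succ]
  generalize eval m B s env = x at *
  generalize eval m B e env = y at *
  have hx := hs.le.trans h.numSets_le
  have hy := he.le.trans h.numElems_le
  have hkk : g.k * g.k ≤ B := by have := h.k_le; omega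
  have hj : y / g.W / g.q ≤ g.q := by
    rw [Nat.div_div_eq_div_mul]
    refine (Nat.div_lt_of_lt_mul ?_).le
    rw [Gap.numElems] at he
    convert he using 1
    ring
  have e1 (l : List ℕ) : (div (var 1) theW).eval m B (x :: y :: l) = y / g.W := by
    rw [eval_div, eval_theW h]
    · rfl
    · exact hy
    · rw [eval_theW h]; exact h.W_le
  have hyW : y / g.W ≤ B := (Nat.div_le_self _ _).trans hy
  have e2 (l : List ℕ) : (div (div (var 1) theW) theq).eval m B (x :: y :: l) = y / g.W / g.q := by
    rw [eval_div, eval_theq h, e1]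
    · rwa [e1]
    · rw [eval_theq h]; exact h.q_le
  have e3 (l : List ℕ) : (mod (div (var 1) theW) theq).eval m B (x :: y :: l) = y / g.W % g.q := by
    rw [eval_mod, eval_theq h, e1]
    · rwa [e1]
    · rw [eval_theq h]; exact h.q_le
  have e4 (l : List ℕ) : (div (var 0) theNN).eval m B (x :: y :: l) = x / (g.N * g.N) := by
    rw [eval_div, eval_theNN h]
    · rfl
    · exact hx
    · rw [eval_theNN h]; exact h.N_le
  have e5 (l : List ℕ) : (mod (var 0) theNN).eval m B (x :: y :: l) = x % (g.N * g.N) := by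
    rw [eval_mod, eval_theNN h]
    · rfl
    · exact hx
    · rw [eval_theNN h]; exact h.N_le
  have hxN : x % (g.N * g.N) ≤ B := (Nat.mod_le _ _).trans hx
  have e6 (l : List ℕ) : (div (mod (var 0) theNN) theN).eval m B (x :: y :: l) =
      x % (g.N * g.N) / g.N := by
    rw [eval_div, eval_theN h, e5]
    · rwa [e5]
    · rw [eval_theN h]; exact h.N_le'
  have e7 (l : List ℕ) : (mod (mod (var 0) theNN) theN).eval m B (x :: y :: l) =
      x % (g.N * g.N) % g.N := by
    rw [eval_mod, eval_theN h, e5]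
    · rwa [e5]
    · rw [eval_theN h]; exact h.N_le'
  have e8 (l : List ℕ) : (mod (var 1) theW).eval m B (x :: y :: l) = y % g.W := by
    rw [eval_mod, eval_theW h]
    · rfl
    · exact hy
    · rw [eval_theW h]; exact h.W_le
  have hyW' : y % g.W ≤ B := (Nat.mod_le _ _).trans hy
  have e9 (a l : ℕ) (hl : l < 2 * g.M) : (mod (div (mod (var 1) theW) (pow theQ (var 3)))
      theQ).eval m B ([x, y] ++ [a, l]) = y % g.W / g.Q ^ l % g.Q := by
    have h1 : (pow theQ (var 3)).eval m B ([x, y] ++ [a, l]) = g.Q ^ l := by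
      rw [eval_pow, eval_theQ h]
      · rfl
      · rw [eval_theQ h]; exact h.Q_le
      · exact hl.le.trans h.M_le
    have h2 : (div (mod (var 1) theW) (pow theQ (var 3))).eval m B ([x, y] ++ [a, l]) =
        y % g.W / g.Q ^ l := by
      rw [eval_div, h1]
      · exact congrArg (· / g.Q ^ l) (e8 [a, l])
      · exact (e8 [a, l]).trans_le hyW'
      · rw [h1]; exact (Nat.pow_le_pow_right h.Q_pos hl.le).trans h.W_le
    rw [eval_mod, h2, eval_theQ h]
    · rw [h2]; exact (Nat.div_le_self _ _).trans hyW'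
    · rw [eval_theQ h]; exact h.Q_le
  have hdig (l : ℕ) : y % g.W / g.Q ^ l % g.Q ≤ B := (Nat.mod_lt _ h.Q_pos).le.trans h.Q_le
  have e10 (l : List ℕ) : (sub (var 0) (mul theq theNN)).eval m B (x :: y :: l) =
      x - g.q * (g.N * g.N) := by
    rw [eval_sub, eval_theqNN h]; rfl
  have hxq : x - g.q * (g.N * g.N) ≤ B := (Nat.sub_le _ _).trans hx
  have e11 (l : List ℕ) : (div (sub (var 0) (mul theq theNN)) (pow theq theK)).eval m B
      (x :: y :: l) = (x - g.q * (g.N * g.N)) / g.q ^ g.k := by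
    rw [eval_div, eval_theqk h, e10]
    · rwa [e10]
    · rw [eval_theqk h]; exact h.qk_le
  have e12 (l : List ℕ) : (mod (sub (var 0) (mul theq theNN)) (pow theq theK)).eval m B
      (x :: y :: l) = (x - g.q * (g.N * g.N)) % g.q ^ g.k := by
    rw [eval_mod, eval_theqk h, e10]
    · rwa [e10]
    · rw [eval_theqk h]; exact h.qk_le
  simp only [eval_ite, eval_lt]
  rw [eval_theqNN h, Gap.Covers]
  by_cases hlt : x < g.q * (g.N * g.N)
  · rw [if_pos hlt, if_pos (by exact hlt), eval_and, eval_eq, e4, e3, eval_some (k := 2) rfl, eval_theTwoM h]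
    · rw [eval_theTwoM h]; exact h.M_le
    · intro a l hl
      rw [eval_theTwoM h] at hl
      have hN0 : 0 < g.N := by
        rcases Nat.eq_zero_or_pos g.N with h | h
        · simp [h] at hlt
        · exact h
      rw [eval_passes h]
      · rw [e9 a l hl]
        exact iff_of_eq (congr (congr (congr rfl (e2 _)) (e6 _)) (e7 _) |> fun h => congrFun h _)
      · exact (e2 _).trans_le hj
      · exact (e6 _).trans_lt (Nat.div_lt_of_lt_mul (Nat.mod_lt _ (Nat.mul_pos hN0 hN0)))
      · exact (e7 _).trans_lt (Nat.mod_lt _ hN0)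
      · rw [e9 a l hl]; exact hdig l
  · rw [if_neg hlt, if_neg (by exact hlt), eval_and, eval_eq, e11, e2, eval_all (k := 2) rfl, eval_theTwoM h]
    · rw [eval_theTwoM h]; exact h.M_le
    · intro a l hl
      rw [eval_theTwoM h] at hl
      rw [eval_not, eval_eq, eval_div, e9 a l hl, eval_theKK h]
      · exact not_congr (iff_of_eq (congrArg _ (e12 _)))
      · rw [e9 a l hl]; exact hdig l
      · rw [eval_theKK h]; exact hkk

end Ex
end RAM

/-! ### The layout of the inputs -/

theorem getD_flatMap_range (f : ℕ → ℕ → ℕ) (a b i : ℕ) :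
    ((List.range a).flatMap fun s => (List.range b).map (f s)).getD i 0 =
      if i < a * b then f (i / b) (i % b) else 0 := by
  induction a generalizing i with
  | zero => simp
  | succ a ih =>
    have hlen : ((List.range a).flatMap fun s => (List.range b).map (f s)).length = a * b := by
      simp [List.length_flatMap]
    rw [List.range_succ, List.flatMap_append, List.flatMap_singleton]
    by_cases h1 : i < a * b
    · rw [List.getD_append _ _ _ _ (by rwa [hlen]), ih, if_pos h1, if_pos (by rw [add_mul]; omega)]
    · rw [List.getD_append_right _ _ _ _ (by rw [hlen]; omega), hlen]
      by_cases h2 : i < (a + 1) * b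
      · rw [add_mul, one_mul] at h2
        have hb : i - a * b < b := by omega
        obtain ⟨j, rfl⟩ : ∃ j, i = a * b + j := ⟨i - a * b, by omega⟩
        rw [Nat.add_sub_cancel_left] at hb ⊢
        rw [List.getD_eq_getElem _ _ (by simpa), if_pos (by rw [add_mul]; omega), mul_comm a b,
          Nat.mul_add_div (by omega), Nat.div_eq_of_lt hb, Nat.mul_add_mod, Nat.mod_eq_of_lt hb]
        simp
      · rw [if_neg h2, List.getD_eq_default _ _ (by simp; rw [add_mul] at h2; omega)]

theorem getD_flatMap_finRange {a b : ℕ} (f : Fin a → Fin b → ℕ) (f' : ℕ → ℕ → ℕ)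
    (h : ∀ s u, f s u = f' s u) (i : ℕ) :
    ((List.finRange a).flatMap fun s => (List.finRange b).map (f s)).getD i 0 =
      if i < a * b then f' (i / b) (i % b) else 0 := by
  obtain rfl : f = fun (s : Fin a) (u : Fin b) => f' s u := funext fun s => funext fun u => h s u
  rw [← getD_flatMap_range, ← List.map_coe_finRange_eq_range (n := a),
    ← List.map_coe_finRange_eq_range (n := b), List.flatMap_map]
  simp only [List.map_map, Function.comp_def]

/-- The adjacency relation of a graph, on natural numbers. -/
def SimpleGraph.natAdj {n : ℕ} (G : SimpleGraph (Fin n)) (u v : ℕ) : Prop :=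
  ∃ (hu : u < n) (hv : v < n), G.Adj ⟨u, hu⟩ ⟨v, hv⟩

section cliqueInput

variable {n : ℕ} (G : SimpleGraph (Fin n)) (k : ℕ)

theorem initial_cliqueInput_mem_two_add (i : ℕ) :
    (RAM.initial (cliqueInput G k)).mem (2 + i) =
      open Classical in if i < n * n then if G.natAdj (i / n) (i % n) then 1 else 0 else 0 := by
  classical
  rw [RAM.initial, cliqueInput, add_comm]
  simp only [List.getD_cons_succ]
  rw [getD_flatMap_finRange _ fun u v => if G.natAdj u v then 1 else 0]
  intro u v
  simp [SimpleGraph.natAdj]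

theorem initial_cliqueInput_mem_ne_zero {u v : ℕ} (hu : u < n) (hv : v < n) :
    (RAM.initial (cliqueInput G k)).mem (2 + u * n + v) ≠ 0 ↔ G.natAdj u v := by
  have : u * n + v < n * n := by nlinarith
  rw [add_assoc, initial_cliqueInput_mem_two_add, if_pos this, mul_comm u,
    Nat.mul_add_div (by omega), Nat.div_eq_of_lt hv, Nat.mul_add_mod, Nat.mod_eq_of_lt hv]
  simp

theorem initial_cliqueInput_mem_eq_zero {i : ℕ} (hi : 2 + n * n ≤ i) :
    (RAM.initial (cliqueInput G k)).mem i = 0 := by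
  obtain ⟨j, rfl⟩ : ∃ j, i = 2 + j := ⟨i - 2, by omega⟩
  rw [initial_cliqueInput_mem_two_add, if_neg (by omega)]

end cliqueInput

/-- Injectivity of `c` need not be demanded: adjacency is irreflexive, so distinct indices have
distinct vertices. -/
theorem exists_isNClique_iff {n : ℕ} {G : SimpleGraph (Fin n)} {k : ℕ} :
    (∃ K, G.IsNClique k K) ↔ ∃ c : ℕ → ℕ, (∀ i < k, c i < n) ∧
      ∀ i < k, ∀ j < k, i ≠ j → G.natAdj (c i) (c j) := by
  classical
  constructor
  · rintro ⟨K, hK⟩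
    let e := K.orderEmbOfFin hK.card_eq
    refine ⟨fun i => if h : i < k then e ⟨i, h⟩ else 0, fun i hi => ?_, fun i hi j hj hij => ?_⟩
    · simp [hi]
    · simp only [dif_pos hi, dif_pos hj]
      refine ⟨(e ⟨i, hi⟩).2, (e ⟨j, hj⟩).2, hK.isClique (K.orderEmbOfFin_mem hK.card_eq _)
        (K.orderEmbOfFin_mem hK.card_eq _) fun h => hij ?_⟩
      simpa using e.injective h
  · rintro ⟨c, h1, h2⟩
    let d : Fin k → Fin n := fun i => ⟨c i, h1 i i.2⟩
    have hd : ∀ i j, i ≠ j → G.Adj (d i) (d j) := by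
      intro i j hij
      obtain ⟨_, _, h⟩ := h2 i i.2 j j.2 fun h => hij (Fin.ext h)
      exact h
    refine ⟨Finset.univ.image d, ?_, ?_⟩
    · intro x hx y hy hxy
      simp only [Finset.coe_image, Finset.coe_univ, Set.image_univ, Set.mem_range] at hx hy
      obtain ⟨i, rfl⟩ := hx
      obtain ⟨j, rfl⟩ := hy
      exact hd i j fun h => hxy (by rw [h])
    · rw [Finset.card_image_of_injective, Finset.card_univ, Fintype.card_fin]
      intro i j hij
      by_contra h
      exact (hd i j h).ne hij

/-! ### The set cover instance and its input list -/

namespace Gap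

variable (g : Gap)

open Classical in
/-- The set cover instance of the reduction. -/
noncomputable def toSetCover : SetCover where
  numSets := g.numSets
  numElems := g.numElems
  adj s e := decide (g.Covers s e)

/-- The number of sets that suffice if there is a clique. -/
def K : ℕ := g.q * (g.k * g.k + 1)

open Classical in
/-- The entries of the input that describes the set cover instance. -/
noncomputable def entry (i : ℕ) : ℕ :=
  if i = 0 then g.numSets else if i = 1 then g.numElems else if i = 2 then g.K else
    if g.Covers ((i - 3) / g.numElems) ((i - 3) % g.numElems) then 1 else 0

theorem input_getD (i : ℕ) : (g.toSetCover.input g.K).getD i 0 =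
    if i < 3 + g.numSets * g.numElems then g.entry i else 0 := by
  classical
  match i with
  | 0 => simp [SetCover.input, entry, toSetCover]
  | 1 => simp [SetCover.input, entry, toSetCover]; omega
  | 2 => simp [SetCover.input, entry, toSetCover]; omega
  | i + 3 =>
    simp only [SetCover.input, List.getD_cons_succ, entry]
    rw [getD_flatMap_finRange _ fun s e => if g.Covers s e then 1 else 0]
    · change (if i < g.numSets * g.numElems then if g.Covers (i / g.numElems) (i % g.numElems)
        then 1 else 0 else 0) = _
      by_cases h : i < g.numSets * g.numElems
      · rw [if_pos h, if_pos (show i + 3 < 3 + g.numSets * g.numElems by omega),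
          if_neg (show i + 3 ≠ 0 by omega), if_neg (show i + 3 ≠ 1 by omega),
          if_neg (show i + 3 ≠ 2 by omega)]
        rfl
      · rw [if_neg h, if_neg (show ¬ i + 3 < 3 + g.numSets * g.numElems by omega)]
    · intro s e
      simp [toSetCover]

variable {g}

theorem optLE_of_isClique (hq : 0 < g.q) {c : ℕ → ℕ} (hc : g.IsClique c) :
    g.toSetCover.OptLE g.K := by
  classical
  obtain ⟨C, h1, h2, h3⟩ := exists_cover hq hc
  refine ⟨C.attach.image fun s => ⟨s.1, Finset.mem_range.1 (h1 s.2)⟩, fun e => ?_, ?_⟩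
  · obtain ⟨s, hs, hse⟩ := h2 e e.2
    exact ⟨⟨s, Finset.mem_range.1 (h1 hs)⟩, Finset.mem_image.2 ⟨⟨s, hs⟩, by simp, rfl⟩,
      decide_eq_true hse⟩
  · have := (Finset.card_image_le (s := C.attach)
      (f := fun s => (⟨s.1, Finset.mem_range.1 (h1 s.2)⟩ : Fin g.numSets))).trans
      (Finset.card_attach.trans_le h3)
    exact_mod_cast this

theorem exists_isClique_of_isCover (hq : g.q.Prime) (hN : g.N ≤ g.q ^ g.r)
    (hM : 8 * (g.M * g.M) * g.r ≤ g.q) {C : Finset (Fin g.numSets)}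
    (hC : g.toSetCover.IsCover C) (hcard : C.card ≤ g.q * g.M) : ∃ c, g.IsClique c := by
  classical
  refine exists_isClique hq hN hM (C := C.map Fin.valEmbedding) (fun e he => ?_) (by simpa)
  obtain ⟨s, hs, hse⟩ := hC ⟨e, he⟩
  exact ⟨s, Finset.mem_map.2 ⟨s, hs, rfl⟩, of_decide_eq_true hse⟩

end Gap

namespace RAM
namespace Ex

variable {m : ℕ → ℕ} {B : ℕ} {env : List ℕ} {g : Gap}

/-! ### Writing the instance and checking covers -/

def tableLength : Ex := add (const 3) (mul theNumSets theNumElems)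

theorem eval_tableLength (h : g.Fits m B) :
    tableLength.eval m B env = 3 + g.numSets * g.numElems := by
  rw [tableLength, eval_add, eval_mul, eval_theNumSets h, eval_theNumElems h]
  · rfl
  · rw [eval_theNumElems h]; exact h.numElems_le

def table : Ex :=
  ite (var 0) (ite (sub (var 0) (const 1)) (ite (sub (var 0) (const 2))
    (ite (covers (div (sub (var 0) (const 3)) theNumElems) (mod (sub (var 0) (const 3)) theNumElems))
      (const 1) (const 0))
    (mul theq (add (mul theK theK) (const 1)))) theNumElems) theNumSets

theorem eval_table (h : g.Fits m B) {i : ℕ} (hi : i < 3 + g.numSets * g.numElems) :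
    table.eval m B [i] = g.entry i := by
  classical
  have h1 : (mul theq (add (mul theK theK) (const 1))).eval m B [i] = g.K := by
    have h2 : (add (mul theK theK) (const 1)).eval m B [i] = g.k * g.k + 1 := by
      rw [eval_add, eval_theKK h]; rfl
    rw [eval_mul, h2, eval_theq h, Gap.K]
    rw [h2]; exact h.k_le
  have hiB : i ≤ B := hi.le.trans h.table_le
  have h2 : (div (sub (var 0) (const 3)) theNumElems).eval m B [i] = (i - 3) / g.numElems := by
    rw [eval_div, eval_theNumElems h]
    · rfl
    · exact (Nat.sub_le _ _).trans hiB
    · rw [eval_theNumElems h]; exact h.numElems_le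
  have h3 : (mod (sub (var 0) (const 3)) theNumElems).eval m B [i] = (i - 3) % g.numElems := by
    rw [eval_mod, eval_theNumElems h]
    · rfl
    · exact (Nat.sub_le _ _).trans hiB
    · rw [eval_theNumElems h]; exact h.numElems_le
  have h4 : 3 ≤ i → ((covers (div (sub (var 0) (const 3)) theNumElems)
      (mod (sub (var 0) (const 3)) theNumElems)).eval m B [i] ≠ 0 ↔
      g.Covers ((i - 3) / g.numElems) ((i - 3) % g.numElems)) := by
    intro hi3
    have hpos : 0 < g.numElems := by
      rcases Nat.eq_zero_or_pos g.numElems with h | h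
      · rw [h] at hi; omega
      · exact h
    rw [eval_covers h, h2, h3]
    · rw [h2]
      exact Nat.div_lt_of_lt_mul (by rw [mul_comm]; omega)
    · rw [h3]
      exact Nat.mod_lt _ hpos
  have h5 : (var 0).eval m B [i] = i := rfl
  have h6 (c : ℕ) : (const c).eval m B [i] = c := rfl
  rw [table]
  simp only [eval_ite, eval_sub, h1, eval_theNumElems h, eval_theNumSets h, h5, h6, Gap.entry]
  split_ifs with g1 g2 g3 g4 g5 g6 g7 g8 g9 <;> first | rfl | omega | skip
  · exact absurd ((h4 (by omega)).1 g4) ‹_›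
  · exact absurd ((h4 (by omega)).2 ‹_›) g4

/-- Whether the indicator vector from the address `B` on describes a cover of size at most
`g.q * g.M`. -/
def coverCheck : Ex :=
  and (all 0 theNumElems (some 2 theNumSets
      (and (eq (mem (add bound (var 3))) (const 1)) (covers (var 3) (var 1)))))
    (le (sum 0 theNumSets (and (eq (mem (add bound (var 1))) (const 1)) (const 1))) (mul theq theM))

theorem eval_coverCheck (h : g.Fits m B) {τ : State} (hτ : ∀ i, m (B + i) = τ.mem i) :
    coverCheck.eval m B [] ≠ 0 ↔ g.toSetCover.IsCover (g.toSetCover.output τ) ∧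
      (g.toSetCover.output τ).card ≤ g.q * g.M := by
  classical
  have hmem (l : List ℕ) (s : ℕ) (i : ℕ) (hl : l.getD i 0 = s) :
      (mem (add bound (var i))).eval m B l = τ.mem s := by
    rw [← hτ, ← hl]; rfl
  have hM : (mul theq theM).eval m B [] = g.q * g.M := by
    rw [eval_mul, eval_theq h, eval_theM h]
    rw [eval_theM h]; have := h.M_le; omega
  have hout (s : Fin g.numSets) : s ∈ g.toSetCover.output τ ↔ τ.mem s = 1 := by
    exact Finset.mem_filter.trans (and_iff_right (Finset.mem_univ _))
  have hcard : (sum 0 theNumSets (and (eq (mem (add bound (var 1))) (const 1))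
      (const 1))).eval m B [] = (g.toSetCover.output τ).card := by
    rw [eval_sum (k := 0) (g := fun s => if τ.mem s = 1 then 1 else 0) rfl, eval_theNumSets h,
      SetCover.output, Finset.card_filter, Finset.sum_range]
    · rfl
    · rw [eval_theNumSets h]; exact h.numSets_le
    · intro x s hs
      have h1 : (eq (mem (add bound (var 1))) (const 1)).eval m B ([] ++ [x, s]) ≠ 0 ↔
          τ.mem s = 1 := by
        rw [eval_eq, hmem _ s 1 rfl]; rfl
      rw [and, eval_ite]
      by_cases hs1 : τ.mem s = 1
      · rw [if_pos hs1, if_pos (h1.2 hs1)]; rfl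
      · rw [if_neg hs1, if_neg (mt h1.1 hs1)]; rfl
  rw [coverCheck, eval_and, eval_le, hM, hcard]
  refine and_congr ?_ Iff.rfl
  · rw [eval_all (k := 0) (p := fun e => ∃ s < g.numSets, τ.mem s = 1 ∧ g.Covers s e) rfl,
      eval_theNumElems h]
    · constructor
      · intro hc e
        obtain ⟨s, hs, h1, h2⟩ := hc e e.2
        exact ⟨⟨s, hs⟩, (hout _).2 h1, decide_eq_true h2⟩
      · intro hc e he
        obtain ⟨s, hs, hse⟩ := hc ⟨e, he⟩
        exact ⟨s, s.2, (hout _).1 hs, of_decide_eq_true hse⟩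
    · rw [eval_theNumElems h]; exact h.numElems_le
    · intro x e he
      rw [eval_theNumElems h] at he
      rw [eval_some (k := 2) (p := fun s => τ.mem s = 1 ∧ g.Covers s e) rfl, eval_theNumSets h]
      · rw [eval_theNumSets h]; exact h.numSets_le
      · intro y s hs
        rw [eval_theNumSets h] at hs
        rw [eval_and, eval_eq, hmem _ s 3 rfl, eval_covers h]
        · rfl
        · exact hs
        · exact he

/-! ### Exhaustive search -/

def digit (x i : Ex) : Ex := mod (div x (pow theN i)) theN

/-- Whether the digits of some number to the base `N` are the vertices of a clique. -/
def exhaustive : Ex :=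
  some 0 (pow theN theK) (all 2 theK (all 4 theK (or (eq (var 3) (var 5))
    (mem (add (add (const 2) (mul (digit (var 1) (var 3)) theN)) (digit (var 1) (var 5)))))))

theorem eval_exhaustive {N k : ℕ} {A : ℕ → ℕ → Prop} (h0 : m 0 = N) (h1 : m 1 = k)
    (hA : ∀ u < N, ∀ v < N, m (2 + u * N + v) ≠ 0 ↔ A u v) (hN : N ≤ B) (hk : k ≤ B)
    (hNk : N ^ k ≤ B) : exhaustive.eval m B [] ≠ 0 ↔
      ∃ c : ℕ → ℕ, (∀ i < k, c i < N) ∧ ∀ i < k, ∀ j < k, i ≠ j → A (c i) (c j) := by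
  have eN (env : List ℕ) : theN.eval m B env = N := h0
  have ek (env : List ℕ) : theK.eval m B env = k := h1
  have epow : (pow theN theK).eval m B [] = N ^ k := by
    rw [eval_pow (by rwa [eN]) (by rwa [ek]), eN, ek]
  rw [exhaustive, eval_some (k := 0)
    (p := fun x => ∀ i < k, ∀ j < k, i = j ∨ A (x / N ^ i % N) (x / N ^ j % N)) rfl
    (by rwa [epow]), epow]
  · constructor
    · rintro ⟨x, hx, h⟩
      refine ⟨fun i => x / N ^ i % N, fun i hi => Nat.mod_lt _ ?_,
        fun i hi j hj hij => (h i hi j hj).resolve_left hij⟩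
      rcases Nat.eq_zero_or_pos N with rfl | h
      · rw [zero_pow (by omega)] at hx; omega
      · exact h
    · rintro ⟨c, hc, h⟩
      obtain ⟨x, hx, hxc⟩ := exists_digits hc
      refine ⟨x, hx, fun i hi j hj => or_iff_not_imp_left.2 fun hij => ?_⟩
      rw [hxc i hi, hxc j hj]
      exact h i hi j hj hij
  · intro a x hx
    rw [epow] at hx
    rw [eval_all (k := 2) (p := fun i => ∀ j < k, i = j ∨ A (x / N ^ i % N) (x / N ^ j % N)) rfl
      (by rwa [ek]), ek]
    intro b i hi
    rw [ek] at hi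
    rw [eval_all (k := 4) (p := fun j => i = j ∨ A (x / N ^ i % N) (x / N ^ j % N)) rfl
      (by rwa [ek]), ek]
    intro c j hj
    rw [ek] at hj
    have hN0 : 0 < N := by
      rcases Nat.eq_zero_or_pos N with rfl | h
      · rw [zero_pow (by omega)] at hx; omega
      · exact h
    have edig (env : List ℕ) (v l : ℕ) (hv : (var v).eval m B env = l) (hl : l < k)
        (hx' : (var 1).eval m B env = x) :
        (digit (var 1) (var v)).eval m B env = x / N ^ l % N := by
      have e1 : (pow theN (var v)).eval m B env = N ^ l := by
        rw [eval_pow (by rwa [eN]) (by rw [hv]; omega), eN, hv]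
      have e2 : (div (var 1) (pow theN (var v))).eval m B env = x / N ^ l := by
        rw [eval_div, hx', e1]
        · rw [hx']; omega
        · rw [e1]; exact (Nat.pow_le_pow_right hN0 hl.le).trans hNk
      rw [digit, eval_mod, e2, eN]
      · rw [e2]; exact (Nat.div_le_self _ _).trans (by omega)
      · rwa [eN]
    have emem (e : Ex) (env : List ℕ) : (mem e).eval m B env = m (e.eval m B env) := rfl
    rw [eval_or, eval_eq, ← hA _ (Nat.mod_lt _ hN0) _ (Nat.mod_lt _ hN0), emem, eval_add, eval_add,
      eval_mul (by rwa [eN]), eN, edig _ 3 i rfl hi rfl, edig _ 5 j rfl hj rfl]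
    rfl

end Ex
end RAM

/-! ### Estimates -/

namespace Gap

/-- The parameter `k` is small in terms of the number of vertices. -/
structure Small (N k : ℕ) : Prop where
  one_le_k : 1 ≤ k
  le_log : 32 ≤ Nat.log 2 N
  sq_le_log : (k * k + 1) * (k * k + 1) ≤ Nat.log 2 N

variable {N k : ℕ} {A : ℕ → ℕ → Prop}

namespace Small

theorem five_le (h : Small N k) : 5 ≤ Nat.log 2 (Nat.log 2 N) := by
  exact Nat.le_log_of_pow_le (by norm_num) h.le_log

theorem pow_le (h : Small N k) : 2 ^ Nat.log 2 (Nat.log 2 N) ≤ Nat.log 2 N :=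
  Nat.pow_log_le_self 2 (by have := h.le_log; omega)

theorem lt_pow (_ : Small N k) : Nat.log 2 N < 2 ^ (Nat.log 2 (Nat.log 2 N) + 1) :=
  Nat.lt_pow_succ_log_self (by norm_num) _

theorem two_pow_le (h : Small N k) : 2 ^ Nat.log 2 N ≤ N :=
  Nat.pow_log_le_self 2 (by rintro rfl; have := h.le_log; simp at this)

theorem log_le (_ : Small N k) : Nat.log 2 N ≤ N := Nat.log_le_self 2 N

theorem sq_le (h : Small N k) :
    Nat.log 2 (Nat.log 2 N) * Nat.log 2 (Nat.log 2 N) ≤ Nat.log 2 N := by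
  refine le_trans ?_ h.pow_le
  have : ∀ l ≥ 5, l * l ≤ 2 ^ l := by
    intro l hl
    induction l, hl using Nat.le_induction with
    | base => norm_num
    | succ l hl ih => rw [pow_succ]; nlinarith
  exact this _ h.five_le

/-- Both factors have squares at most `log N`. This is what makes `M` at least 1. -/
theorem mul_le (h : Small N k) : (k * k + 1) * Nat.log 2 (Nat.log 2 N) ≤ Nat.log 2 N := by
  have h1 := h.sq_le
  have h2 := h.sq_le_log
  rw [← Nat.mul_self_le_mul_self_iff]
  calc _ = ((k * k + 1) * (k * k + 1)) *
        (Nat.log 2 (Nat.log 2 N) * Nat.log 2 (Nat.log 2 N)) := by ring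
    _ ≤ _ := Nat.mul_le_mul h2 h1

theorem ell_mul_le (_ : Small N k) : ell N * Nat.log 2 (Nat.log 2 N) ≤ Nat.log 2 N :=
  Nat.div_mul_le_self _ _

theorem lt_mul (h : Small N k) : Nat.log 2 N < (ell N + 1) * Nat.log 2 (Nat.log 2 N) := by
  rw [← Nat.div_lt_iff_lt_mul (by have := h.five_le; omega)]
  exact Nat.lt_succ_self _

theorem le_ell (h : Small N k) : k * k + 1 ≤ ell N :=
  (Nat.le_div_iff_mul_le (by have := h.five_le; omega)).2 h.mul_le

theorem four_mul_ell_le (h : Small N k) : 4 * ell N ≤ Nat.log 2 N := by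
  have h1 := h.ell_mul_le
  have h2 := h.five_le
  nlinarith

theorem one_le_M (h : Small N k) : 1 ≤ ell N / (k * k + 1) :=
  (Nat.le_div_iff_mul_le (by omega)).2 (by simpa using h.le_ell)

theorem M_mul_le (_ : Small N k) : ell N / (k * k + 1) * (k * k + 1) ≤ ell N :=
  Nat.div_mul_le_self _ _

theorem ell_le (h : Small N k) : ell N ≤ 2 * (ell N / (k * k + 1) * (k * k + 1)) := by
  have h1 : ell N < (ell N / (k * k + 1) + 1) * (k * k + 1) := by
    rw [← Nat.div_lt_iff_lt_mul (by omega)]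
    exact Nat.lt_succ_self _
  have h2 := h.one_le_M
  nlinarith

theorem M_le_ell (_ : Small N k) : ell N / (k * k + 1) ≤ ell N := Nat.div_le_self _ _

theorem arg_ne (h : Small N k) : 8 * ((of N k A).M * (of N k A).M) * (of N k A).r ≠ 0 := by
  have h1 : (of N k A).M ≠ 0 := by have := h.one_le_M; simp only [of]; omega
  have h2 : (of N k A).r ≠ 0 := by have := h.le_ell; simp only [of]; omega
  simp [h1, h2]

theorem q_le (h : Small N k) : (of N k A).q ≤ 64 * ((of N k A).M * (of N k A).M * ell N) := by
  refine (RAM.leastPrime_le_two_mul (h.arg_ne (A := A))).trans_eq ?_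
  simp only [of]
  ring

theorem arg_le (h : Small N k) :
    64 * ((of N k A).M * (of N k A).M * ell N) ≤ Nat.log 2 N * Nat.log 2 N * Nat.log 2 N := by
  have h1 := h.four_mul_ell_le
  have h2 := h.M_le_ell
  calc 64 * ((of N k A).M * (of N k A).M * ell N) ≤ 64 * (ell N * ell N * ell N) :=
        Nat.mul_le_mul_left _ (Nat.mul_le_mul_right _ (Nat.mul_le_mul h2 h2))
    _ = 4 * ell N * (4 * ell N) * (4 * ell N) := by ring
    _ ≤ _ := Nat.mul_le_mul (Nat.mul_le_mul h1 h1) h1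

theorem q_le_pow (h : Small N k) : (of N k A).q ≤ 2 ^ (4 * Nat.log 2 (Nat.log 2 N)) := by
  refine (h.q_le.trans h.arg_le).trans ?_
  calc Nat.log 2 N * Nat.log 2 N * Nat.log 2 N = Nat.log 2 N ^ 3 := by ring
    _ ≤ (2 ^ (Nat.log 2 (Nat.log 2 N) + 1)) ^ 3 := Nat.pow_le_pow_left h.lt_pow.le _
    _ = 2 ^ (3 * Nat.log 2 (Nat.log 2 N) + 3) := by rw [← pow_mul]; ring_nf
    _ ≤ _ := Nat.pow_le_pow_right (by norm_num) (by have := h.five_le; omega)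

/-- Since `q` is at most about `(log N) ^ 4`, polynomial bounds on powers of `q` reduce to comparing
exponents. -/
theorem q_pow_le (h : Small N k) {i : ℕ} (c : ℕ)
    (hi : 4 * (i * Nat.log 2 (Nat.log 2 N)) ≤ c * Nat.log 2 N) : (of N k A).q ^ i ≤ N ^ c := by
  calc (of N k A).q ^ i ≤ (2 ^ (4 * Nat.log 2 (Nat.log 2 N))) ^ i :=
        Nat.pow_le_pow_left h.q_le_pow _
    _ = 2 ^ (4 * (i * Nat.log 2 (Nat.log 2 N))) := by rw [← pow_mul]; ring_nf
    _ ≤ 2 ^ (c * Nat.log 2 N) := Nat.pow_le_pow_right (by norm_num) hi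
    _ = (2 ^ Nat.log 2 N) ^ c := by rw [← pow_mul, mul_comm]
    _ ≤ N ^ c := Nat.pow_le_pow_left h.two_pow_le _

theorem qr_le (h : Small N k) : (of N k A).q ^ (of N k A).r ≤ N ^ 16 := by
  refine h.q_pow_le _ ?_
  have := h.ell_mul_le
  simp only [of]
  nlinarith

theorem qk_le (h : Small N k) : (of N k A).q ^ k ≤ N ^ 4 := by
  refine h.q_pow_le _ ?_
  have h1 := h.mul_le
  have h2 : k * Nat.log 2 (Nat.log 2 N) ≤ (k * k + 1) * Nat.log 2 (Nat.log 2 N) :=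
    Nat.mul_le_mul_right _ (by nlinarith)
  omega

theorem q_le_N (h : Small N k) : (of N k A).q ≤ N ^ 4 :=
  (Nat.le_self_pow (by have := h.one_le_k; omega) _).trans h.qk_le

theorem D_le (h : Small N k) : k * k + 1 ≤ N :=
  (Nat.le_mul_self _).trans (h.sq_le_log.trans h.log_le)

theorem le_N (h : Small N k) : 32 ≤ N := h.le_log.trans h.log_le

theorem Q_le (h : Small N k) : (of N k A).Q ≤ N ^ 5 := by
  have h1 := h.qk_le (A := A)
  have h2 := h.D_le
  calc (of N k A).Q = (of N k A).q ^ k * (k * k) := rfl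
    _ ≤ N ^ 4 * N := Nat.mul_le_mul h1 (by omega)
    _ = N ^ 5 := by ring

/-- The exponent of `q` is `2 * k * M ≤ (k * k + 1) * M ≤ ell N`, giving `N ^ 4`. The factor for the
tests has base `k * k`, at most about `log N`, and exponent at most `2 * ell N`, giving `N ^ 2`. -/
theorem W_le (h : Small N k) : (of N k A).W ≤ N ^ 6 := by
  have hM : (of N k A).M = ell N / (k * k + 1) := rfl
  have h0 := h.ell_mul_le
  have h1 : (of N k A).q ^ (k * (2 * (of N k A).M)) ≤ N ^ 4 := by
    refine h.q_pow_le _ ?_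
    have h2 : k * (2 * (of N k A).M) ≤ ell N := by
      refine le_trans ?_ h.M_mul_le
      rw [← hM]
      have : 2 * k ≤ k * k + 1 := by
        rcases k with _ | k
        · simp
        · ring_nf; nlinarith
      nlinarith
    nlinarith
  have h3 : (k * k) ^ (2 * (of N k A).M) ≤ N ^ 2 := by
    have h4 : k * k ≤ 2 ^ Nat.log 2 (Nat.log 2 N) := by
      have h5 := h.lt_pow
      have h6 := h.sq_le_log
      have h7 : 1 ≤ k * k := Nat.mul_pos h.one_le_k h.one_le_k
      rw [pow_succ] at h5
      nlinarith
    calc (k * k) ^ (2 * (of N k A).M) ≤ (2 ^ Nat.log 2 (Nat.log 2 N)) ^ (2 * (of N k A).M) :=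
          Nat.pow_le_pow_left h4 _
      _ = 2 ^ (Nat.log 2 (Nat.log 2 N) * (2 * (of N k A).M)) := by rw [← pow_mul]
      _ ≤ 2 ^ (2 * Nat.log 2 N) := by
          refine Nat.pow_le_pow_right (by norm_num) ?_
          have := h.M_le_ell
          rw [← hM] at this
          nlinarith
      _ = (2 ^ Nat.log 2 N) ^ 2 := by rw [← pow_mul, mul_comm]
      _ ≤ N ^ 2 := Nat.pow_le_pow_left h.two_pow_le _
  calc (of N k A).W = (of N k A).q ^ (k * (2 * (of N k A).M)) * (k * k) ^ (2 * (of N k A).M) := by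
        rw [W, Q, mul_pow, ← pow_mul]; rfl
    _ ≤ N ^ 4 * N ^ 2 := Nat.mul_le_mul h1 h3
    _ = N ^ 6 := by ring

theorem two_mul_pow_le (h : Small N k) (c : ℕ) : 2 * N ^ c ≤ N ^ (c + 1) := by
  rw [pow_succ, mul_comm]
  exact Nat.mul_le_mul_left _ (by have := h.le_N; omega)

theorem numSets_le (h : Small N k) : (of N k A).numSets ≤ N ^ 9 := by
  have h1 := h.q_le_N (A := A)
  calc (of N k A).numSets = (of N k A).q * (N * N) + (of N k A).q * (of N k A).q ^ k := rfl
    _ ≤ N ^ 4 * (N * N) + N ^ 4 * N ^ 4 :=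
        Nat.add_le_add (Nat.mul_le_mul_right _ h1) (Nat.mul_le_mul h1 h.qk_le)
    _ = N ^ 6 + N ^ 8 := by ring
    _ ≤ N ^ 8 + N ^ 8 :=
        Nat.add_le_add_right (Nat.pow_le_pow_right (by have := h.le_N; omega) (by norm_num)) _
    _ = 2 * N ^ 8 := by ring
    _ ≤ N ^ 9 := h.two_mul_pow_le 8

theorem numElems_le (h : Small N k) : (of N k A).numElems ≤ N ^ 14 := by
  have h1 := h.q_le_N (A := A)
  calc (of N k A).numElems = (of N k A).q * (of N k A).q * (of N k A).W := rfl
    _ ≤ N ^ 4 * N ^ 4 * N ^ 6 := Nat.mul_le_mul (Nat.mul_le_mul h1 h1) h.W_le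
    _ = N ^ 14 := by ring

theorem size_le (h : Small N k) : (of N k A).toSetCover.size ≤ N ^ 15 := by
  calc (of N k A).toSetCover.size = (of N k A).numSets + (of N k A).numElems := rfl
    _ ≤ N ^ 9 + N ^ 14 := Nat.add_le_add h.numSets_le h.numElems_le
    _ ≤ N ^ 14 + N ^ 14 :=
        Nat.add_le_add_right (Nat.pow_le_pow_right (by have := h.le_N; omega) (by norm_num)) _
    _ = 2 * N ^ 14 := by ring
    _ ≤ N ^ 15 := h.two_mul_pow_le 14

theorem le_q (h : Small N k) : 4 * ell N ≤ (of N k A).q := by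
  refine le_trans ?_ (RAM.le_leastPrime _)
  have h2 : 1 ≤ 8 * (ell N / (k * k + 1) * (ell N / (k * k + 1))) := by
    have := Nat.mul_pos h.one_le_M h.one_le_M
    omega
  exact Nat.le_mul_of_pos_left _ h2

theorem le_size (h : Small N k) : N ≤ (of N k A).toSetCover.size := by
  have h1 := h.le_q (A := A)
  have h2 := h.le_ell
  have h3 := h.le_N
  calc N ≤ N * N := Nat.le_mul_self _
    _ ≤ (of N k A).q * (N * N) := Nat.le_mul_of_pos_left _ (by omega)
    _ ≤ (of N k A).numSets := Nat.le_add_right _ _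
    _ ≤ _ := Nat.le_add_right _ _

/-- This is the reason for the factor 4 in `r`: from `q ≥ 4 * ell N` one gets only `q ^ 2 ≥ log N`,
so one factor 2 goes into that square root and another into the rounding in `ell`. -/
theorem N_le (h : Small N k) : (of N k A).N ≤ (of N k A).q ^ (of N k A).r := by
  have h0 := h.le_q (A := A)
  have h1 := h.lt_mul
  have h2 := h.sq_le
  have h3 : 1 ≤ ell N := by have := h.le_ell; omega
  have h5 := h.five_le
  have h6 : Nat.log 2 N ≤ (of N k A).q ^ 2 := by
    have h4 : Nat.log 2 N ≤ 2 * ell N * Nat.log 2 (Nat.log 2 N) := by nlinarith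
    have h7 : Nat.log 2 N * Nat.log 2 N ≤ 4 * (ell N * ell N) * Nat.log 2 N :=
      calc Nat.log 2 N * Nat.log 2 N ≤ _ := Nat.mul_le_mul h4 h4
        _ = 4 * (ell N * ell N) * (Nat.log 2 (Nat.log 2 N) * Nat.log 2 (Nat.log 2 N)) := by ring
        _ ≤ _ := Nat.mul_le_mul_left _ h2
    have h8 := Nat.le_of_mul_le_mul_right h7 (by have := h.le_log; omega)
    nlinarith
  calc (of N k A).N ≤ 2 ^ (Nat.log 2 N + 1) := (Nat.lt_pow_succ_log_self (by norm_num) N).le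
    _ ≤ 2 ^ (Nat.log 2 (Nat.log 2 N) * (2 * ell N)) :=
        Nat.pow_le_pow_right (by norm_num) (by nlinarith)
    _ = (2 ^ Nat.log 2 (Nat.log 2 N)) ^ (2 * ell N) := pow_mul _ _ _
    _ ≤ ((of N k A).q ^ 2) ^ (2 * ell N) := Nat.pow_le_pow_left (h.pow_le.trans h6) _
    _ = (of N k A).q ^ (of N k A).r := by rw [← pow_mul]; simp only [of]; ring_nf

/-- One factor `M` of `q ≤ 64 * M² * ell N` absorbs `k * k + 1`, so the bound does not involve `k`.
-/
theorem K_le (h : Small N k) : (of N k A).K ≤ 64 * ell N ^ 3 := by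
  have h1 : (of N k A).M * (k * k + 1) ≤ ell N := h.M_mul_le
  have h2 : (of N k A).M ≤ ell N := h.M_le_ell
  calc (of N k A).K ≤ 64 * ((of N k A).M * (of N k A).M * ell N) * (k * k + 1) :=
        Nat.mul_le_mul_right _ h.q_le
    _ = 64 * ((of N k A).M * ((of N k A).M * (k * k + 1)) * ell N) := by ring
    _ ≤ 64 * (ell N * ell N * ell N) :=
        Nat.mul_le_mul_left _ (Nat.mul_le_mul_right _ (Nat.mul_le_mul h2 h1))
    _ = _ := by ring

theorem fits (h : Small N k) {m : ℕ → ℕ} {B : ℕ} (h0 : m 0 = N) (h1 : m 1 = k)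
    (hA : ∀ u < N, ∀ v < N, m (2 + u * N + v) ≠ 0 ↔ A u v) (hB : N ^ 24 ≤ B) :
    (of N k A).Fits m B := by
  have hN := h.le_N
  have hpow {c x : ℕ} (hx : x ≤ N ^ c) (hc : c ≤ 24) : x ≤ B :=
    (hx.trans (Nat.pow_le_pow_right (by omega) hc)).trans hB
  have hlog : Nat.log 2 N ≤ N := h.log_le
  have hell := h.four_mul_ell_le
  have hM := h.M_le_ell
  have hr : (of N k A).r ≤ N := hell.trans hlog
  exact
  { memN := h0
    memk := h1
    memA := hA
    M_eq := rfl
    r_eq := rfl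
    q_eq := rfl
    one_le_k := h.one_le_k
    q_arg_ne := h.arg_ne
    q_arg_le := by
      refine hpow (c := 3) ?_ (by norm_num)
      calc _ = 64 * ((of N k A).M * (of N k A).M * ell N) := by simp only [of]; ring
        _ ≤ _ := h.arg_le
        _ ≤ N * N * N := Nat.mul_le_mul (Nat.mul_le_mul hlog hlog) hlog
        _ = N ^ 3 := by ring
    N_le := hpow (c := 2) (by rw [sq]; rfl) (by norm_num)
    k_le := hpow (c := 1) (by rw [pow_one]; exact h.D_le) (by norm_num)
    q_le := hpow h.q_le_N (by norm_num)
    qk_le := hpow h.qk_le (by norm_num)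
    Q_le := hpow h.Q_le (by norm_num)
    W_le := hpow h.W_le (by norm_num)
    M_le := by
      refine hpow (c := 1) ?_ (by norm_num)
      rw [pow_one]
      simp only [of]
      omega
    r_le := hpow (c := 1) (by rwa [pow_one]) (by norm_num)
    qr_le := hpow h.qr_le (by norm_num)
    sum_le := by
      refine hpow (c := 21) ?_ (by norm_num)
      calc _ ≤ N * (N ^ 4 * N ^ 16) :=
            Nat.mul_le_mul hr (Nat.mul_le_mul h.q_le_N h.qr_le)
        _ = N ^ 21 := by ring
    numSets_le := hpow h.numSets_le (by norm_num)
    numElems_le := hpow h.numElems_le (by norm_num)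
    table_le := by
      refine hpow (c := 24) ?_ le_rfl
      calc _ ≤ N ^ 23 + N ^ 9 * N ^ 14 := by
            refine Nat.add_le_add ?_ (Nat.mul_le_mul h.numSets_le h.numElems_le)
            exact le_trans (by omega) (Nat.le_self_pow (by norm_num) N)
        _ = 2 * N ^ 23 := by ring
        _ ≤ N ^ 24 := h.two_mul_pow_le 23 }

/-- The function `log x / x` decreases from `e` on, so it suffices to compare at `x = log N`,
rounded down to `Nat.log 2 N * log 2`. The factor 2 absorbs the rounding of the iterated logarithm.
-/
theorem le_logOverLogLog (h : Small N k) {n : ℕ} (hn : N ≤ n) :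
    (ell N : ℝ) / 2 ≤ logOverLogLog n := by
  have ha : (32 : ℝ) ≤ (Nat.log 2 N : ℕ) := by exact_mod_cast h.le_log
  have hl : (5 : ℝ) ≤ (Nat.log 2 (Nat.log 2 N) : ℕ) := by exact_mod_cast h.five_le
  have hlt : ((Nat.log 2 N : ℕ) : ℝ) < 2 ^ (Nat.log 2 (Nat.log 2 N) + 1) := by
    exact_mod_cast h.lt_pow
  have hpow : (2 : ℝ) ^ Nat.log 2 N ≤ n := by exact_mod_cast h.two_pow_le.trans hn
  have hell : (ell N : ℝ) * (Nat.log 2 (Nat.log 2 N) : ℕ) ≤ (Nat.log 2 N : ℕ) := by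
    exact_mod_cast h.ell_mul_le
  generalize Nat.log 2 (Nat.log 2 N) = l at *
  generalize Nat.log 2 N = a at *
  have h2 : 0.69 < Real.log 2 := by have := Real.log_two_gt_d9; linarith
  have h2' : Real.log 2 < 1 := by have := Real.log_two_lt_d9; linarith
  have he := Real.exp_one_lt_d9
  have hy : Real.exp 1 ≤ a * Real.log 2 := by nlinarith
  have hx : a * Real.log 2 ≤ Real.log n := by
    rw [← Real.log_pow]
    exact Real.log_le_log (by positivity) hpow
  have hmono := Real.log_div_self_antitoneOn hy (hy.trans hx) hx
  have hlog1 : 0 < Real.log (Real.log n) := Real.log_pos (by linarith [Real.add_one_le_exp 1])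
  have hlog2 : Real.log (a * Real.log 2) ≤ (l + 1) * Real.log 2 := by
    have : Real.log (a * Real.log 2) ≤ Real.log (2 ^ (l + 1)) :=
      Real.log_le_log (by nlinarith) (by nlinarith)
    rw [Real.log_pow] at this
    exact_mod_cast this
  have hpos : 0 < a * Real.log 2 := by nlinarith
  have hxpos : 0 < Real.log n := hpos.trans_le hx
  rw [logOverLogLog, le_div_iff₀ hlog1]
  simp only at hmono
  rw [div_le_iff₀ hxpos, div_mul_eq_mul_div, le_div_iff₀ hpos] at hmono
  have h3 : (ell N : ℝ) / 2 * ((l + 1) * Real.log 2) ≤ a * Real.log 2 := by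
    have : (0 : ℝ) ≤ ell N := Nat.cast_nonneg _
    nlinarith
  have h4 : (ell N : ℝ) / 2 * Real.log (Real.log n) * (a * Real.log 2) ≤
      Real.log n * (a * Real.log 2) :=
    calc _ = (ell N : ℝ) / 2 * (Real.log (Real.log n) * (a * Real.log 2)) := by ring
      _ ≤ (ell N : ℝ) / 2 * (Real.log (a * Real.log 2) * Real.log n) := by gcongr
      _ ≤ (ell N : ℝ) / 2 * ((l + 1) * Real.log 2 * Real.log n) := by gcongr
      _ = (ell N : ℝ) / 2 * ((l + 1) * Real.log 2) * Real.log n := by ring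
      _ ≤ a * Real.log 2 * Real.log n := by gcongr
      _ = _ := by ring
  exact le_of_mul_le_mul_right h4 hpos

/-- The same monotonicity, now applied to the upper bound `15 * (Nat.log 2 N + 1) * log 2` for `log
n`. The constant is `15 * 4`, where 4 pays for the rounding in `ell` and in the logarithm. -/
theorem logOverLogLog_le (h : Small N k) {n : ℕ} (hn : N ≤ n) (hn' : n ≤ N ^ 15) :
    logOverLogLog n ≤ 60 * ell N := by
  have ha : (32 : ℝ) ≤ (Nat.log 2 N : ℕ) := by exact_mod_cast h.le_log
  have hl : (5 : ℝ) ≤ (Nat.log 2 (Nat.log 2 N) : ℕ) := by exact_mod_cast h.five_le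
  have hle : (2 : ℝ) ^ (Nat.log 2 (Nat.log 2 N)) ≤ (Nat.log 2 N : ℕ) := by
    exact_mod_cast h.pow_le
  have hpow : (2 : ℝ) ^ Nat.log 2 N ≤ n := by exact_mod_cast h.two_pow_le.trans hn
  have hell : ((Nat.log 2 N : ℕ) : ℝ) ≤ (ell N + 1) * (Nat.log 2 (Nat.log 2 N) : ℕ) := by
    exact_mod_cast h.lt_mul.le
  have hell1 : (1 : ℝ) ≤ ell N := by
    have := h.le_ell
    exact_mod_cast (by omega : 1 ≤ ell N)
  have hn15 : (n : ℝ) ≤ 2 ^ (15 * (Nat.log 2 N + 1)) := by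
    have : n ≤ 2 ^ (15 * (Nat.log 2 N + 1)) := by
      refine hn'.trans ?_
      rw [mul_comm, pow_mul]
      exact Nat.pow_le_pow_left (Nat.lt_pow_succ_log_self (by norm_num) N).le _
    exact_mod_cast this
  generalize Nat.log 2 (Nat.log 2 N) = l at *
  generalize Nat.log 2 N = a at *
  have h2 : 0.69 < Real.log 2 := by have := Real.log_two_gt_d9; linarith
  have he := Real.exp_one_lt_d9
  have hy : Real.exp 1 ≤ a * Real.log 2 := by nlinarith
  have hx : a * Real.log 2 ≤ Real.log n := by
    rw [← Real.log_pow]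
    exact Real.log_le_log (by positivity) hpow
  have hn0 : (0 : ℝ) < n := lt_of_lt_of_le (by positivity) hpow
  have hz : Real.log n ≤ 15 * (a + 1) * Real.log 2 := by
    have := Real.log_le_log hn0 hn15
    rw [Real.log_pow] at this
    exact_mod_cast this
  have hmono := Real.log_div_self_antitoneOn (hy.trans hx) ((hy.trans hx).trans hz) hz
  have hlog1 : 0 < Real.log (Real.log n) := Real.log_pos (by linarith [Real.add_one_le_exp 1])
  have hlog2 : l * Real.log 2 ≤ Real.log (15 * (a + 1) * Real.log 2) := by
    have : Real.log (2 ^ l) ≤ Real.log (15 * (a + 1) * Real.log 2) :=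
      Real.log_le_log (by positivity) (by nlinarith)
    rwa [Real.log_pow] at this
  have hpos : 0 < 15 * (a + 1) * Real.log 2 := by positivity
  have hxpos : 0 < Real.log n := by nlinarith
  rw [logOverLogLog, div_le_iff₀ hlog1]
  simp only at hmono
  rw [div_le_iff₀ hpos, div_mul_eq_mul_div, le_div_iff₀ hxpos] at hmono
  have h3 : 15 * (a + 1) * Real.log 2 ≤ 60 * ell N * (l * Real.log 2) := by
    nlinarith [mul_nonneg (sub_nonneg.2 hell1) (le_trans (by norm_num) hl)]
  have h4 : Real.log n * (l * Real.log 2) ≤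
      60 * ell N * Real.log (Real.log n) * (l * Real.log 2) :=
    calc _ ≤ Real.log n * Real.log (15 * (a + 1) * Real.log 2) := by gcongr
      _ ≤ Real.log (Real.log n) * (15 * (a + 1) * Real.log 2) := by linarith
      _ ≤ Real.log (Real.log n) * (60 * ell N * (l * Real.log 2)) := by gcongr
      _ = _ := by ring
  exact le_of_mul_le_mul_right h4 (by nlinarith)

theorem K_le_logOverLogLog (h : Small N k) :
    ((of N k A).K : ℝ) ≤ 512 * logOverLogLog (of N k A).toSetCover.size ^ 3 := by
  have h1 := h.le_logOverLogLog (h.le_size (A := A))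
  calc ((of N k A).K : ℝ) ≤ 64 * (ell N : ℝ) ^ 3 := by exact_mod_cast h.K_le
    _ = 512 * ((ell N : ℝ) / 2) ^ 3 := by ring
    _ ≤ _ := by gcongr

/-- Here `120 = 60 * 2`, from `logOverLogLog_le` and `ell_le`: the ratio is at most `120 * M * (k *
k + 1) / i ≤ M / (k * k + 1)`. This brings `x * K` below the threshold `q * M` of the soundness
argument. -/
theorem ratio_mul_K_le (h : Small N k) {x : ℝ} {i : ℕ}
    (hx : x ≤ logOverLogLog (of N k A).toSetCover.size / i)
    (hi : 120 * ((k * k + 1) * (k * k + 1)) ≤ i) :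
    x * (of N k A).K ≤ ((of N k A).q * (of N k A).M : ℕ) := by
  have h1 := h.logOverLogLog_le (h.le_size (A := A)) h.size_le
  have hi' : (120 * ((k * k + 1) * (k * k + 1)) : ℝ) ≤ i := by exact_mod_cast hi
  have hipos : (0 : ℝ) < i := lt_of_lt_of_le (by positivity) hi'
  have h2 : (ell N : ℝ) ≤ 2 * ((of N k A).M * (k * k + 1)) := by exact_mod_cast h.ell_le
  have h3 : x * (k * k + 1) ≤ (of N k A).M := by
    have h4 : x * i ≤ 120 * ((of N k A).M * (k * k + 1)) := by
      rw [le_div_iff₀ hipos] at hx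
      linarith
    have hD : (0 : ℝ) < k * k + 1 := by positivity
    refine le_of_mul_le_mul_right ?_ hipos
    calc x * (k * k + 1) * i = x * i * (k * k + 1) := by ring
      _ ≤ 120 * ((of N k A).M * (k * k + 1)) * (k * k + 1) := by gcongr
      _ = (of N k A).M * (120 * ((k * k + 1) * (k * k + 1))) := by ring
      _ ≤ _ := by gcongr
  have h5 : ((of N k A).K : ℝ) = (of N k A).q * (k * k + 1) := by
    rw [K]; push_cast; rfl
  rw [h5]
  push_cast
  calc x * ((of N k A).q * (k * k + 1)) = (of N k A).q * (x * (k * k + 1)) := by ring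
    _ ≤ _ := by gcongr

end Small
end Gap

/-! ### The reduction as a program -/

theorem Polynomial.eval_le_eval_of_le (p : Polynomial ℕ) {x y : ℕ} (h : x ≤ y) :
    p.eval x ≤ p.eval y := by
  rw [eval_eq_sum, eval_eq_sum]
  exact Finset.sum_le_sum fun i _ => Nat.mul_le_mul_left _ (Nat.pow_le_pow_left h i)

namespace RAM

theorem exists_reaches_kept (P : Program) : ∃ R, ∀ σ T Q, Reaches P σ T Q →
    Reaches P σ T fun τ => Q τ ∧ ∀ r ≥ R, τ.reg r = σ.reg r := by
  obtain ⟨R, hR⟩ := exists_registers_kept P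
  refine ⟨R, ?_⟩
  rintro σ T Q ⟨τ, t, h1, h2, h3⟩
  exact ⟨τ, t, h1, h2, h3, hR _ _ _ h1⟩

namespace Ex

variable {m : ℕ → ℕ} {N k : ℕ}

def theD : Ex := add (mul theK theK) (const 1)

/-- The expression is evaluated with the bound `N`. The comparisons of `theK` with `theN` and of
`theD` with the logarithm follow from the last one, but they guarantee that the products in it are
computed correctly. -/
def small : Ex :=
  and (and (le (const 1) theK) (le theK theN)) (and (le (const 32) (log theN))
    (and (le theD (log theN)) (le (mul theD theD) (log theN))))

theorem eval_theD (h1 : m 1 = k) (hk : k ≤ N) {env : List ℕ} :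
    theD.eval m N env = k * k + 1 := by
  have ek : theK.eval m N env = k := h1
  rw [theD, eval_add, eval_mul (by rwa [ek]), ek]
  rfl

theorem eval_small (h0 : m 0 = N) (h1 : m 1 = k) : small.eval m N [] ≠ 0 ↔ Gap.Small N k := by
  have eN : theN.eval m N [] = N := h0
  have ek : theK.eval m N [] = k := h1
  have elog : (log theN).eval m N [] = Nat.log 2 N := by rw [eval_log (by rw [eN]), eN]
  rw [small, eval_and, eval_and, eval_and, eval_and, eval_le, eval_le, eval_le, eval_le, eval_le,
    elog, eN, ek]
  constructor
  · rintro ⟨⟨g1, g2⟩, g3, g4, g5⟩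
    have hD := eval_theD h1 g2 (env := [])
    rw [hD] at g4
    rw [eval_mul (by rw [hD]; exact g4.trans (Nat.log_le_self 2 N)), hD] at g5
    exact ⟨g1, g3, g5⟩
  · intro h
    have g2 := h.D_le
    have g3 : k ≤ N := by nlinarith [Nat.le_mul_self k]
    have hD := eval_theD h1 g3 (env := [])
    refine ⟨⟨h.one_le_k, g3⟩, h.le_log, ?_, ?_⟩
    · rw [hD]; exact (Nat.le_mul_self _).trans h.sq_le_log
    · rw [eval_mul (by rwa [hD]), hD]; exact h.sq_le_log

/-- Whether the reduction applies, where `e` certifies lower bounds. -/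
def certified (n₀ : ℕ) (e : Ex) : Ex :=
  and (le (const n₀) theN) (and small
    (some 0 bound (lt (mul (const 120) (mul theD theD)) (call e 1 fun _ => var 1))))

theorem eval_certified (h0 : m 0 = N) (h1 : m 1 = k) {n₀ : ℕ} {e : Ex} :
    (certified n₀ e).eval m N [] ≠ 0 ↔ n₀ ≤ N ∧ Gap.Small N k ∧
      ∃ y < N, 120 * ((k * k + 1) * (k * k + 1)) < e.eval m N [y] := by
  have eN : theN.eval m N [] = N := h0
  rw [certified, eval_and, eval_and, eval_le, eval_small h0 h1, eN]
  refine and_congr Iff.rfl (and_congr_right fun h => ?_)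
  have g2 := h.D_le
  have g3 : k ≤ N := by nlinarith [Nat.le_mul_self k]
  rw [eval_some (k := 0)
    (p := fun y => 120 * ((k * k + 1) * (k * k + 1)) < e.eval m N [y]) rfl le_rfl]
  · rfl
  · intro x y _
    have hD (env : List ℕ) := eval_theD h1 g3 (env := env)
    have hDD (env : List ℕ) : (mul theD theD).eval m N env = (k * k + 1) * (k * k + 1) := by
      rw [eval_mul (by rwa [hD]), hD]
    rw [eval_lt, eval_mul (by rw [hDD]; exact h.sq_le_log.trans h.log_le), hDD]
    rfl

end Ex

/-- What a program on set cover instances and a postprocessing have to achieve in order to decide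
the clique problem. -/
def Solves (P F : Program) (p : Polynomial ℕ) (c d : ℕ) (g : Gap) : Prop :=
  ∃ τ t, RunsIn P (initial (g.toSetCover.input g.K)) τ t ∧ t ≤ p.eval g.toSetCover.size ∧
    ∀ B m σ, Embeds B m τ σ → g.Fits σ.mem B →
      Reaches F σ (c * (B + 1) ^ d) fun υ => υ.Accepts ↔ ∃ c, g.IsClique c

-- The instance is written from address `n ^ 24` on, above the graph, which stays available to the
-- postprocessing `F`. After that `P` runs there on what looks like its own initial state.
open Ex in
theorem exists_reaches_reduction (P F : Program) (p : Polynomial ℕ) (c d R₀ : ℕ) :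
    ∃ (S : Program) (p' : Polynomial ℕ), ∀ {n : ℕ} (G : SimpleGraph (Fin n)) (k : ℕ),
      Gap.Small n k → Solves P F p c d (.of n k G.natAdj) → ∀ σ : State,
      σ.mem = (initial (cliqueInput G k)).mem → σ.reg 0 = n → (∀ r ≥ R₀, σ.reg r = 0) →
      Reaches S σ (p'.eval n) fun υ => υ.Accepts ↔ ∃ K, G.IsNClique k K := by
  obtain ⟨P₁, c₁, d₁, h₁⟩ := exists_reaches_set_bound (pow theN (const 24))
  obtain ⟨P₂, c₂, d₂, h₂⟩ := exists_reaches_table tableLength table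
  obtain ⟨R, hR⟩ := exists_reaches_kept (.seq P₁ P₂)
  refine ⟨.seq (.seq P₁ P₂) (.seq (.clear (R₀ + R)) (.seq P.reloc F)),
    (.C c₁ * (.X + 1) ^ d₁ + .C c₂ * (.X ^ 24 + 1) ^ d₂) + (.C (R₀ + R) +
      (2 * p.comp (.X ^ 15) + .C c * (.X ^ 24 + 1) ^ d)), ?_⟩
  intro n G k hs hsol σ hmem hreg hzero
  set g : Gap := .of n k G.natAdj with hg
  set m := (initial (cliqueInput G k)).mem with hm
  have hn := hs.le_N
  have hfits : ∀ m' : ℕ → ℕ, (∀ i < n ^ 24, m' i = m i) → g.Fits m' (n ^ 24) := by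
    intro m' hm'
    have hle : n * n + 2 ≤ n ^ 24 := by
      calc n * n + 2 ≤ n ^ 3 := by nlinarith
        _ ≤ n ^ 24 := Nat.pow_le_pow_right (by omega) (by norm_num)
    refine hs.fits ?_ ?_ (fun u hu v hv => ?_) le_rfl
    · rw [hm' 0 (by positivity)]; rfl
    · rw [hm' 1 (by omega)]; rfl
    · rw [hm' _ (by nlinarith)]
      exact initial_cliqueInput_mem_ne_zero G k hu hv
  have hB : (pow theN (const 24)).eval σ.mem n [] = n ^ 24 := by
    have eN : theN.eval σ.mem n [] = n := by rw [hmem]; rfl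
    rw [eval_pow (by rw [eN]) (show 24 ≤ n by omega), eN]
    rfl
  have hlen := (hfits m fun _ _ => rfl).table_le
  have step₁ : Reaches (.seq P₁ P₂) σ (c₁ * (n + 1) ^ d₁ + c₂ * (n ^ 24 + 1) ^ d₂) fun τ =>
      τ.reg 0 = n ^ 24 ∧ (∀ i < n ^ 24, τ.mem i = m i) ∧
      ∀ i, τ.mem (n ^ 24 + i) = (initial (g.toSetCover.input g.K)).mem i := by
    have h := h₁ σ
    rw [hreg, hB, hmem] at h
    refine h.seq ?_
    rintro τ ⟨e1, e2⟩
    have h := h₂ τ (3 + g.numSets * g.numElems) g.entry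
    rw [e1, e2] at h
    refine (h (eval_tableLength (hfits m fun _ _ => rfl)) hlen fun m' hm' i hi =>
      eval_table (hfits m' hm') hi).mono le_rfl ?_
    rintro υ ⟨k1, k2, k3, k4⟩
    refine ⟨k1, k2, fun i => ?_⟩
    change _ = (g.toSetCover.input g.K).getD i 0
    rw [g.input_getD]
    by_cases hi : i < 3 + g.numSets * g.numElems
    · rw [if_pos hi, k3 i hi]
    -- Behind the table the memory is still zero, because the clique input ends below `n ^ 24`.
    · rw [if_neg hi, k4 i (by omega)]
      refine initial_cliqueInput_mem_eq_zero G k ?_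
      calc 2 + n * n ≤ n ^ 3 := by nlinarith
        _ ≤ n ^ 24 := Nat.pow_le_pow_right (by omega) (by norm_num)
        _ ≤ _ := Nat.le_add_right _ _
  refine ((hR _ _ _ step₁).seq (T' := R₀ + R + (2 * p.eval (n ^ 15) + c * (n ^ 24 + 1) ^ d))
    ?_).mono ?_ fun _ h => h
  · rintro τ ⟨⟨e1, e2, e3⟩, e4⟩
    refine (reaches_clear (R₀ + R) τ).seq ?_
    rintro υ ⟨k1, k2, k3⟩
    obtain ⟨φ, t, f1, f2, f3⟩ := hsol
    have hemb : Embeds (n ^ 24) m (initial (g.toSetCover.input g.K)) υ :=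
      { base := by rw [k3 0 (by omega), e1]
        reg := fun r => by
          -- The registers beyond the cleared ones were zero at the start, by `hzero`, and have not
          -- been touched since.
          by_cases hr : r < R₀ + R
          · exact k2 r hr
          · rw [k3 _ (by omega), e4 _ (by omega), hzero _ (by omega)]; rfl
        mem := fun i => by rw [k1, e3]
        low := fun i hi => by rw [k1, e2 i hi] }
    refine (((f1.reloc υ hemb).mono (T' := 2 * p.eval (n ^ 15)) ?_ fun _ h => h).seq ?_)
    · have := p.eval_le_eval_of_le (hs.size_le (A := G.natAdj))
      exact Nat.mul_le_mul_left _ (f2.trans this)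
    · intro ψ hψ
      refine (f3 _ _ ψ hψ (hfits _ hψ.low)).mono le_rfl fun χ hχ => hχ.trans ?_
      rw [exists_isNClique_iff]
      rfl
  · simp

-- The bound is raised in two stages, first to `n + k` and then to `n + k + n ^ k`, because
-- computing `n ^ k` already requires `k` to be within the bound.
open Ex in
theorem exists_reaches_exhaustive : ∃ (S : Program) (c d : ℕ),
    ∀ {n : ℕ} (G : SimpleGraph (Fin n)) (k : ℕ) (σ : State),
      σ.mem = (initial (cliqueInput G k)).mem → σ.reg 0 = n →
      Reaches S σ (c * (n + k + n ^ k + 1) ^ d) fun υ =>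
        υ.Accepts ↔ ∃ K, G.IsNClique k K := by
  obtain ⟨P₁, c₁, d₁, h₁⟩ := exists_reaches_set_bound (add theN theK)
  obtain ⟨P₂, c₂, d₂, h₂⟩ := exists_reaches_set_bound (add (add theN theK) (pow theN theK))
  obtain ⟨P₃, c₃, d₃, h₃⟩ := exists_reaches_set_bound (ite exhaustive (const 1) (const 0))
  refine ⟨.seq P₁ (.seq P₂ P₃), c₁ + (c₂ + c₃), d₁ + (d₂ + d₃), fun {n} G k σ hmem hreg => ?_⟩
  set m := (initial (cliqueInput G k)).mem with hm
  have eN (B : ℕ) : theN.eval m B [] = n := rfl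
  have ek (B : ℕ) : theK.eval m B [] = k := rfl
  have e₁ : (add theN theK).eval m n [] = n + k := rfl
  have e₂ : (add (add theN theK) (pow theN theK)).eval m (n + k) [] = n + k + n ^ k := by
    rw [eval_add, eval_add, eN, ek, eval_pow (by rw [eN]; omega) (by rw [ek]; omega), eN, ek]
  have e₃ := eval_exhaustive (m := m) (B := n + k + n ^ k) (N := n) (k := k) (A := G.natAdj) rfl rfl
    (fun u hu v hv => initial_cliqueInput_mem_ne_zero G k hu hv) (by omega) (by omega) (by omega)
  have key : Reaches (.seq P₁ (.seq P₂ P₃)) σ (c₁ * (n + 1) ^ d₁ + (c₂ * (n + k + 1) ^ d₂ +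
      c₃ * (n + k + n ^ k + 1) ^ d₃)) fun υ => υ.Accepts ↔ ∃ K, G.IsNClique k K := by
    have h := h₁ σ
    rw [hreg, hmem, e₁] at h
    refine h.seq ?_
    rintro τ ⟨g1, g2⟩
    have h := h₂ τ
    rw [g2, g1, e₂] at h
    refine h.seq ?_
    rintro υ ⟨g1, g2⟩
    have h := h₃ υ
    rw [g2, g1] at h
    refine h.mono le_rfl ?_
    rintro φ ⟨-, g2⟩
    rw [State.Accepts, g2, exists_isNClique_iff, ← e₃, eval_ite]
    split_ifs with h0
    · exact iff_of_true rfl h0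
    · exact iff_of_false (by simp [eval]) h0
  refine key.mono ?_ fun _ h => h
  calc _ ≤ c₁ * (n + k + n ^ k + 1) ^ d₁ + (c₂ * (n + k + n ^ k + 1) ^ d₂ +
        c₃ * (n + k + n ^ k + 1) ^ d₃) :=
        Nat.add_le_add (Nat.mul_le_mul_left _ (Nat.pow_le_pow_left (by omega) _))
          (Nat.add_le_add_right (Nat.mul_le_mul_left _ (Nat.pow_le_pow_left (by omega) _)) _)
    _ ≤ c₁ * (n + k + n ^ k + 1) ^ d₁ + (c₂ + c₃) * (n + k + n ^ k + 1) ^ (d₂ + d₃) :=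
        Nat.add_le_add_left (mul_pow_add_le _ _ _ _ _) _
    _ ≤ _ := mul_pow_add_le _ _ _ _ _

open Ex in
/-- The clique problem is fixed parameter tractable if the reduction can be used whenever the
parameter is small in terms of the number of vertices, which is certified by `e`. -/
theorem cliqueIsFPT_of_solves (P F : Program) (p : Polynomial ℕ) (c d n₀ : ℕ) (e : Ex) (T : ℕ → ℕ)
    (hT : Computable T) (he : ∀ K, ∃ y ≤ T K, ∀ m B, T K ≤ B → K < e.eval m B [y])
    (h : ∀ {n : ℕ} (G : SimpleGraph (Fin n)) (k : ℕ), n₀ ≤ n → Gap.Small n k →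
      (∃ m, ∃ y < n, 120 * ((k * k + 1) * (k * k + 1)) < e.eval m n [y]) →
      Solves P F p c d (.of n k G.natAdj)) : CliqueIsFPT := by
  obtain ⟨P₁, c₁, d₁, h₁⟩ := exists_reaches_eval (certified n₀ e)
  let start : Program := .seq (.instr (.load 0 0)) P₁
  obtain ⟨R, hR⟩ := exists_reaches_kept start
  obtain ⟨S, p', hS⟩ := exists_reaches_reduction P F p c d R
  obtain ⟨S', c', d', hS'⟩ := exists_reaches_exhaustive
  -- For `k ≥ 1` and `n` above this threshold the certification succeeds: the three summands provide
  -- `n₀ ≤ n`, `Gap.Small n k` and the resources of the certifier.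
  let t (k : ℕ) : ℕ := n₀ + 2 ^ (32 + (k * k + 1) * (k * k + 1)) +
    T (120 * ((k * k + 1) * (k * k + 1)))
  refine ⟨.seq start (.ite 1 S S'), fun k => (t k + k + t k ^ k + 1) ^ d',
    .C c₁ * (.X + 1) ^ d₁ + 2 + p' + .C c' * (.X + 2) ^ d', ?_, fun n G k => ?_⟩
  · have hpow : Primrec₂ ((· ^ ·) : ℕ → ℕ → ℕ) := Primrec₂.unpaired'.1 Nat.Primrec.pow
    have hsq : Primrec fun k : ℕ => (k * k + 1) * (k * k + 1) := by
      have : Primrec fun k : ℕ => k * k + 1 :=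
        Primrec.nat_add.comp (Primrec.nat_mul.comp .id .id) (.const 1)
      exact Primrec.nat_mul.comp this this
    have ht : Computable t := by
      refine Primrec.nat_add.to_comp.comp (Primrec.to_comp ?_)
        (hT.comp (Primrec.nat_mul.comp (.const 120) hsq).to_comp)
      exact Primrec.nat_add.comp (.const n₀)
        (hpow.comp (.const 2) (Primrec.nat_add.comp (.const 32) hsq))
    refine hpow.to_comp.comp ?_ (.const d')
    refine Primrec.nat_add.to_comp.comp ?_ (.const 1)
    exact Primrec.nat_add.to_comp.comp (Primrec.nat_add.to_comp.comp ht .id)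
      (hpow.to_comp.comp ht .id)
  · set m := (initial (cliqueInput G k)).mem with hm
    have hcert := eval_certified (m := m) (N := n) (k := k) rfl rfl (n₀ := n₀) (e := e)
    have hstart : Reaches start (initial (cliqueInput G k)) (1 + c₁ * (n + 1) ^ d₁) fun τ =>
        τ.mem = m ∧ τ.reg 0 = n ∧ τ.reg 1 = (certified n₀ e).eval m n [] := by
      refine Reaches.seq (Q := fun τ => τ.mem = m ∧ τ.reg 0 = n) (.instr ⟨rfl, rfl⟩) ?_
      rintro τ ⟨g1, g2⟩
      have := h₁ τ
      rwa [g1, g2] at this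
    have key : Reaches (.seq start (.ite 1 S S')) (initial (cliqueInput G k))
        (1 + c₁ * (n + 1) ^ d₁ + (p'.eval n + c' * (n + 2) ^ d' * (t k + k + t k ^ k + 1) ^ d' + 1))
        fun υ => υ.Accepts ↔ ∃ K, G.IsNClique k K := by
      refine (hR _ _ _ hstart).seq ?_
      rintro τ ⟨⟨g1, g2, g3⟩, g4⟩
      refine Reaches.ite (fun h1 => ?_) (fun h1 => ?_)
      · rw [g3, hcert] at h1
        obtain ⟨a1, a2, a3⟩ := h1
        exact (hS G k a2 (h G k a1 a2 ⟨m, a3⟩) τ g1 g2 g4).mono (Nat.le_add_right _ _) fun _ h => h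
      · refine (hS' G k τ g1 g2).mono ?_ fun _ h => h
        have hle : n + k + n ^ k + 1 ≤ (n + 2) * (t k + k + t k ^ k + 1) := by
          -- For `k = 0` the search is used for every `n`, but then it has only `n ^ 0 = 1`
          -- candidate; the factor `n + 2` covers this case.
          rcases Nat.eq_zero_or_pos k with rfl | hk
          · simp only [pow_zero, add_zero]
            nlinarith [Nat.zero_le (t 0)]
          · have hn : n ≤ t k := by
              by_contra! hn
              obtain ⟨y, hy, hy'⟩ := he (120 * ((k * k + 1) * (k * k + 1)))
              have hn' : n₀ + 2 ^ (32 + (k * k + 1) * (k * k + 1)) +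
                  T (120 * ((k * k + 1) * (k * k + 1))) < n := hn
              have hpos := Nat.two_pow_pos (32 + (k * k + 1) * (k * k + 1))
              have hlog : 32 + (k * k + 1) * (k * k + 1) ≤ Nat.log 2 n :=
                Nat.le_log_of_pow_le (by norm_num) (by omega)
              refine hcert.2 ⟨by omega, ⟨hk, by omega, by omega⟩,
                y, by omega, hy' _ _ (by omega)⟩ ?_
              rw [← g3, h1]
            have h2 : n ^ k ≤ t k ^ k := Nat.pow_le_pow_left hn k
            exact le_trans (by omega) (Nat.le_mul_of_pos_left _ (by omega))
        calc _ ≤ c' * ((n + 2) * (t k + k + t k ^ k + 1)) ^ d' := by gcongr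
          _ = c' * (n + 2) ^ d' * (t k + k + t k ^ k + 1) ^ d' := by rw [mul_pow, mul_assoc]
          _ ≤ _ := Nat.le_add_left _ _
    obtain ⟨υ, s, s1, s2, s3⟩ := key
    refine ⟨υ, s, s1, s2.trans ?_, s3⟩
    have hf : 1 ≤ (t k + k + t k ^ k + 1) ^ d' := Nat.one_le_pow _ _ (by omega)
    simp only [Polynomial.eval_add, Polynomial.eval_mul, Polynomial.eval_pow, Polynomial.eval_C,
      Polynomial.eval_X, Polynomial.eval_one, Polynomial.eval_ofNat]
    generalize (t k + k + t k ^ k + 1) ^ d' = f at *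
    generalize c' * (n + 2) ^ d' = x
    generalize c₁ * (n + 1) ^ d₁ = y
    generalize p'.eval n = z
    nlinarith [Nat.mul_le_mul_right y hf, Nat.mul_le_mul_right z hf]

end RAM

/-! ### The main theorem -/

namespace Gap

variable {N k : ℕ} {A : ℕ → ℕ → Prop}

theorem Small.exists_isClique_of_isCover (h : Small N k) {x : ℝ} {i : ℕ}
    (hx : x ≤ logOverLogLog (of N k A).toSetCover.size / i)
    (hi : 120 * ((k * k + 1) * (k * k + 1)) ≤ i) {C : Finset (Fin (of N k A).numSets)}
    (hC : (of N k A).toSetCover.IsCover C) (hcard : (C.card : ℝ) ≤ x * (of N k A).K) :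
    ∃ c, (of N k A).IsClique c :=
  Gap.exists_isClique_of_isCover (RAM.prime_leastPrime _) h.N_le (RAM.le_leastPrime _) hC
    (by exact_mod_cast hcard.trans (h.ratio_mul_K_le hx hi))

end Gap

open RAM in
theorem theorem2 (hW : W1NeFPT) :
    ∃ C : ℝ, 0 < C ∧ ∀ ρ : ℕ → ℝ, EffectiveLittleO ρ logOverLogLog →
      ¬ SetCover.GapPolyTime ρ (fun n => C * logOverLogLog n ^ 3) ∧
      ¬ SetCover.ApproxPolyTime ρ (fun n => C * logOverLogLog n ^ 3) := by
  -- The constant is `64 * 2 ^ 3`, from `Gap.Small.K_le_logOverLogLog`.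
  refine ⟨512, by norm_num, fun ρ hρ => ?_⟩
  obtain ⟨ι, hι, hmono, htop, hle⟩ := hρ
  obtain ⟨n₀, hn₀⟩ := Filter.eventually_atTop.1 hle
  obtain ⟨e, T, hT, he, he'⟩ := exists_certifier hι hmono htop
  have hsound {n k : ℕ} {A : ℕ → ℕ → Prop} (hn : n₀ ≤ n) (hs : Gap.Small n k)
      (hc : ∃ m, ∃ y < n, 120 * ((k * k + 1) * (k * k + 1)) < e.eval m n [y])
      {C : Finset (Fin (Gap.of n k A).numSets)} (hC : (Gap.of n k A).toSetCover.IsCover C)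
      (hcard : (C.card : ℝ) ≤ ρ (Gap.of n k A).toSetCover.size * (Gap.of n k A).K) :
      ∃ c, (Gap.of n k A).IsClique c := by
    obtain ⟨m, y, hy, hlt⟩ := hc
    -- The certificate bounds `ι y` from below for some `y < n`. By monotonicity the bound carries
    -- over to the size of the instance, which is at least `n`.
    exact hs.exists_isClique_of_isCover (hn₀ _ (hn.trans hs.le_size))
      ((he _ _ _ _ hlt).trans (hmono (hy.le.trans hs.le_size))) hC hcard
  refine ⟨?_, ?_⟩
  · rintro ⟨P, p, hP⟩
    -- Relocation moved the answer register of `P` from `0` to `2`; the postprocessing only copies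
    -- it back.
    refine hW (cliqueIsFPT_of_solves P (.move 0 2 1) p 2 0 n₀ e T hT he' fun G k hn hs hc => ?_)
    obtain ⟨τ, t, h1, h2, h3, h4⟩ := hP (Gap.of _ k G.natAdj).toSetCover _ hs.K_le_logOverLogLog
    refine ⟨τ, t, h1, h2, fun B m σ hemb hfits => ?_⟩
    refine (reaches_move (by norm_num) σ).mono (by simp) ?_
    rintro υ ⟨-, g2, -⟩
    rw [State.Accepts, g2, hemb.reg 0]
    constructor
    · intro hacc
      by_contra hno
      refine h4 ?_ hacc
      rintro ⟨C, hC, hcard⟩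
      exact hno (hsound hn hs hc hC hcard)
    · rintro ⟨c, hc⟩
      exact h3 (Gap.optLE_of_isClique hfits.q_pos hc)
  · rintro ⟨P, p, hP⟩
    -- The output is checked against the threshold `q * M` instead of `ρ n * K`, since `ρ` need not
    -- be computable. Without a clique no cover meets this threshold, and with one the approximate
    -- solution does.
    obtain ⟨F, c, d, hF⟩ := exists_reaches_set_bound (.ite Ex.coverCheck (.const 1) (.const 0))
    refine hW (cliqueIsFPT_of_solves P F p c d n₀ e T hT he' fun G k hn hs hc => ?_)
    obtain ⟨τ, t, h1, h2, h3⟩ := hP (Gap.of _ k G.natAdj).toSetCover _ hs.K_le_logOverLogLog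
    refine ⟨τ, t, h1, h2, fun B m σ hemb hfits => ?_⟩
    have hrun := hF σ
    rw [hemb.base] at hrun
    refine hrun.mono le_rfl ?_
    rintro υ ⟨-, g2⟩
    have hcheck := Ex.eval_coverCheck hfits hemb.mem
    have hiff : υ.Accepts ↔ Ex.coverCheck.eval σ.mem B [] ≠ 0 := by
      rw [State.Accepts, g2, Ex.eval_ite]
      split_ifs with h0
      · exact iff_of_true rfl h0
      · exact iff_of_false (by simp [Ex.eval]) h0
    rw [hiff, hcheck]
    constructor
    · rintro ⟨hC, hcard⟩
      exact Gap.exists_isClique_of_isCover (prime_leastPrime _) hs.N_le (le_leastPrime _) hC hcard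
    · rintro ⟨c, hc'⟩
      obtain ⟨hC, hcard⟩ := h3 (Gap.optLE_of_isClique hfits.q_pos hc')
      obtain ⟨m', y, hy, hlt⟩ := hc
      have := hs.ratio_mul_K_le (A := G.natAdj) (hn₀ _ (hn.trans hs.le_size))
        ((he _ _ _ _ hlt).trans (hmono (hy.le.trans hs.le_size)))
      exact ⟨hC, by exact_mod_cast hcard.trans this⟩
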